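/- **Conventions.** $\mathbf{Prof}$ is the monoidal bicategory whose objects are small categories, whose 1-morphisms $P : A \to B$ are profunctors, i.e. functors $P : B^{op}\times A \to \mathbf{Set}$ (written $P(a;b)$, covariant in $a\in A$ and contravariant in $b\in B$), composed by coends, whose 2-morphisms are natural transformations, and whose monoidal product is the product of categories; every object $X$ has the dual $X^{op}$ with cup $X(x,y)$ and cap $X(y,x)$. A functor $F : A\to B$ gives the profunctor $F_*(a;b)=B(b,Fa)$. A category is *Cauchy complete* if all its idempotents split; a *Cauchy completion* of $C$ is a functor $F : C \to D$ with $D$ Cauchy complete and $F_*$ an equivalence in $\mathbf{Prof}$. An *interpretation* of a presentation is a choice of an object $C$, 1-morphisms and 2-morphisms of $\mathbf{Prof}$ for the generators that satisfies the equations. The *right-adjoint pseudomonoid presentation* has one object $C$, a multiplication $m : C\times C\to C$, a unit $e : 1 \to C$, invertible associativity and unit 2-morphisms satisfying the pentagon and triangle equations, and right adjoints $m\dashv m^*$, $e\dashv e^*$ (with units and counits satisfying the triangle equations); $m^*$ and $e^*$ carry the coassociativity and counit 2-morphisms which are mates of those of $m$ and $e$. The *traced pseudomonoid presentation* $\mathcal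 T$ adds one 2-morphism $$\mathrm{Tr} : \mathrm{loop}(m^*\circ m) \Rightarrow \mathrm{id}_C,$$ where $\mathrm{loop}(m^* \circ m)$ is the composite $m^*\circ m : C\times C\to C\times C$ with its right-hand input and output wires joined by the cup and the cap, i.e. $(b;a)\mapsto \int^{x,y} m(b,x;y)\times m^*(y;a,x)$, and three equations: * (vanishing, unit) if the right-hand wires are capped by $e$ and $e^*$, then joining these wires by the counit $e\circ e^*\Rightarrow \mathrm{id}$ and applying $\mathrm{Tr}$ equals removing the units by the unit 2-morphisms of $m$ and $m^*$; * (vanishing, tensor) applying $\mathrm{Tr}$ to an inner loop and then to an outer loop equals reassociating on both sides, sliding the multiplication of the two looped wires around the loop, removing it by the counit $m\circ m^*\Rightarrow\mathrm{id}$, and applying $\mathrm{Tr}$ once; * (superposing) for an identity wire to the left of the loop, applying $\mathrm{Tr}$ and then the unit $\mathrm{id}\Rightarrow m^*\circ m$ equals first applying this unit to the identity wire and the wire inside the loop, reassociating on both sides, and then applying $\mathrm{Tr}$. A *traced monoidal category* is a monoidal category $D$ with a (right) trace: functions $\mathrm{tr}^x_{a,b} : D(a\otimes x, b\otimes x)\to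 D(a,b)$ with * tightening: $\mathrm{tr}^x\big((h\otimes x)\circ f\circ (g\otimes x)\big)=h\circ \mathrm{tr}^x(f)\circ g$; * sliding: $\mathrm{tr}^x\big((b\otimes g)\circ f\big)=\mathrm{tr}^y\big(f\circ(a\otimes g)\big)$ for $f : a\otimes x\to b\otimes y$, $g : y\to x$; * vanishing (unit): $\mathrm{tr}^{I}(f)=f$ and vanishing (tensor): $\mathrm{tr}^{x\otimes y}(f)=\mathrm{tr}^x(\mathrm{tr}^y(f))$, up to the unitors and associators; * superposing: $\mathrm{tr}^x(g\otimes f)=g\otimes \mathrm{tr}^x(f)$, up to associators. Let $F : C\to D$ be a Cauchy completion or, if $C$ is Cauchy complete, the identity. An interpretation with underlying category $C$ is *realized* along $F$ by a monoidal category $D$ with $\mathrm{tr}$ if, up to chosen isomorphisms, $m(a,b;c)=D(Fc,Fa\otimes Fb)$, $m^*(c;a,b)=D(Fa\otimes Fb,Fc)$, $e(c)=D(Fc,I)$, $e^*(c)=D(I,Fc)$, the adjunctions are given by tensor product and composition of morphisms, the associativity and unit 2-morphisms by those of $D$, and $F(\mathrm{Tr}[p,q])=\mathrm{tr}^{Fx}(p\circ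 q)$ for $q\in m^*(y;a,x)$, $p\in m(b,x;y)$. **Theorem.** Interpretations of $\mathcal T$ in $\mathbf{Prof}$ correspond exactly to Cauchy complete traced monoidal categories, in the following sense. 1. Every small Cauchy complete traced monoidal category $C$ realizes some interpretation of $\mathcal T$ with underlying category $C$ along the identity. 2. Every interpretation of $\mathcal T$ with underlying category $C$ is realized, along every Cauchy completion $F : C\to D$ (the identity, if $C$ is Cauchy complete), by some traced monoidal structure on $D$. 3. Every small category has a Cauchy completion. 4. Let interpretations with underlying categories $C$, $C'$ be realized along Cauchy completions $F : C\to D$, $F' : C'\to D'$ by traced monoidal categories $D$, $D'$, and let $K : C\to C'$, $G : D\to D'$ be functors with an isomorphism $\theta : GF\cong F'K$, where $K_*$ is an equivalence in $\mathbf{Prof}$. Then for every equivalence of the two interpretations over $K$ (isomorphisms between the generating 1-morphisms, compatible with all generating 2-morphisms) there is exactly one strong monoidal structure on $G$ that preserves the trace and is compatible with it via $\theta$, and conversely. Moreover, tightening and sliding come for free, and the three equations are the remaining axioms: 5. Let an interpretation of the right-adjoint pseudomonoid presentation be realized along a Cauchy completion $F : C\to D$ by a monoidal category $D$. Then the relation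 $F(\mathrm{Tr}[p,q])=\mathrm{tr}^{Fx}(p\circ q)$ is a bijection between natural transformations $\mathrm{Tr}:\mathrm{loop}(m^*\circ m)\Rightarrow\mathrm{id}_C$ (with no equation imposed) and families of functions $\mathrm{tr}$ on $D$ that satisfy tightening and sliding; and for corresponding $\mathrm{Tr}$ and $\mathrm{tr}$, each of the equations vanishing (unit), vanishing (tensor), superposing holds for $\mathrm{Tr}$ if and only if the axiom of the same name holds for $\mathrm{tr}$. -/

import Mathlib

open CategoryTheory Opposite

universe u

/-- The objects of the bicategory `Prof`: small categories. -/
structure Prof : Type (u + 1) where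
  carrier : Type u
  [cat : SmallCategory carrier]

namespace Prof

instance : CoeSort Prof.{u} (Type u) := ⟨Prof.carrier⟩
instance (C : Prof.{u}) : SmallCategory C := C.cat

section Basic
variable {A B C D : Type u} [SmallCategory A] [SmallCategory B] [SmallCategory C] [SmallCategory D]

/-- For a profunctor `P : A ⇸ B`, the set `P(b, a)`, contravariant in `b : B`, covariant in `a : A`. -/
abbrev El (P : Profunctor.{u} A B) (a : A) (b : B) : Type u := (P.obj a).obj (op b)

/-- The two-sided action of `A` and `B` on the elements of a profunctor. -/
def act (P : Profunctor.{u} A B) {a a' : A} {b b' : B} (f : a ⟶ a') (g : b' ⟶ b)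
    (p : El P a b) : El P a' b' :=
  (P.obj a').map g.op ((P.map f).app (op b) p)

@[simp] lemma act_id (P : Profunctor.{u} A B) {a : A} {b : B} (p : El P a b) :
    act P (𝟙 a) (𝟙 b) p = p := by
  have h := ConcreteCategory.congr_hom (NatTrans.congr_app (P.map_id a) (op b)) p
  have h' := ConcreteCategory.congr_hom ((P.obj a).map_id (op b)) p
  exact (congrArg (fun x => (P.obj a).map (𝟙 (op b)) x) h).trans h'

lemma act_id_left (P : Profunctor.{u} A B) {a : A} {b b' : B} (g : b' ⟶ b) (p : El P a b) :
    act P (𝟙 a) g p = (P.obj a).map g.op p :=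
  congrArg (fun x => (P.obj a).map g.op x)
    (ConcreteCategory.congr_hom (NatTrans.congr_app (P.map_id a) (op b)) p)

lemma act_id_right (P : Profunctor.{u} A B) {a a' : A} {b : B} (f : a ⟶ a') (p : El P a b) :
    act P f (𝟙 b) p = (P.map f).app (op b) p :=
  ConcreteCategory.congr_hom ((P.obj a').map_id (op b)) ((P.map f).app (op b) p)

@[simp] lemma act_act (P : Profunctor.{u} A B) {a a' a'' : A} {b b' b'' : B} (f : a ⟶ a')
    (f' : a' ⟶ a'') (g : b' ⟶ b) (g' : b'' ⟶ b') (p : El P a b) :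
    act P f' g' (act P f g p) = act P (f ≫ f') (g' ≫ g) p := by
  have h := ConcreteCategory.congr_hom ((P.map f').naturality g.op) ((P.map f).app (op b) p)
  simp only [act, op_comp, Functor.map_comp, NatTrans.comp_app]
  exact congrArg (fun x => (P.obj a'').map g'.op x) h

/-- A profunctor from a family of sets with a two-sided action. -/
def ofAct (el : A → B → Type u) (m : ∀ {a a' : A} {b b' : B}, (a ⟶ a') → (b' ⟶ b) → el a b → el a' b')
    (m_id : ∀ a b (p : el a b), m (𝟙 a) (𝟙 b) p = p)
    (m_comp : ∀ {a a' a'' : A} {b b' b'' : B} (f : a ⟶ a')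
      (f' : a' ⟶ a'') (g : b' ⟶ b) (g' : b'' ⟶ b') (p : el a b),
      m (f ≫ f') (g' ≫ g) p = m f' g' (m f g p)) : Profunctor.{u} A B :=
  Profunctor.ofCore
    { obj := el
      map f g := TypeCat.ofHom (m f g)
      map_id a b := by ext p; exact m_id a b p
      map_comp f f' g g' := by ext p; exact m_comp f f' g' g p }

lemma act_ofAct (el : A → B → Type u) (m : ∀ {a a' : A} {b b' : B}, (a ⟶ a') → (b' ⟶ b) → el a b → el a' b')
    (m_id m_comp) {a a' : A} {b b' : B} (f : a ⟶ a') (g : b' ⟶ b) (p : el a b) :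
    act (ofAct el m m_id m_comp) f g p = m f g p := by
  change m (𝟙 a') g (m f (𝟙 b) p) = m f g p
  rw [← m_comp]; simp

/-- The components of a 2-morphism (a natural transformation) of profunctors. -/
def app {P Q : Profunctor.{u} A B} (η : P ⟶ Q) {a : A} {b : B} (p : El P a b) : El Q a b :=
  (η.app a).app (op b) p

@[simp] lemma app_act {P Q : Profunctor.{u} A B} (η : P ⟶ Q) {a a' : A} {b b' : B} (f : a ⟶ a')
    (g : b' ⟶ b) (p : El P a b) : app η (act P f g p) = act Q f g (app η p) := by
  have h := ConcreteCategory.congr_hom (NatTrans.congr_app (η.naturality f) (op b)) p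
  have h' := ConcreteCategory.congr_hom ((η.app a').naturality g.op) ((P.map f).app (op b) p)
  exact h'.trans (congrArg (fun x => (Q.obj a').map g.op x) h)

@[simp] lemma app_id {P : Profunctor.{u} A B} {a : A} {b : B} (p : El P a b) :
    app (𝟙 P) p = p := rfl

@[simp] lemma app_comp {P Q R : Profunctor.{u} A B} (η : P ⟶ Q) (θ : Q ⟶ R) {a : A} {b : B}
    (p : El P a b) : app (η ≫ θ) p = app θ (app η p) := rfl

lemma hom_ext {P Q : Profunctor.{u} A B} {η θ : P ⟶ Q}
    (h : ∀ (a : A) (b : B) (p : El P a b), app η p = app θ p) : η = θ := by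
  ext a b p
  exact h a b.unop p

/-- A natural transformation of profunctors from its components. -/
def homMk {P Q : Profunctor.{u} A B} (φ : ∀ (a : A) (b : B), El P a b → El Q a b)
    (nat : ∀ {a a' : A} {b b' : B} (f : a ⟶ a') (g : b' ⟶ b) (p : El P a b),
      φ a' b' (act P f g p) = act Q f g (φ a b p)) : P ⟶ Q where
  app a :=
    { app b := TypeCat.ofHom (φ a b.unop)
      naturality b b' g := by
        ext p
        have h := nat (𝟙 a) g.unop p
        rw [act_id_left, act_id_left] at h
        exact h }
  naturality a a' f := by
    ext b p
    have h := nat f (𝟙 b.unop) p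
    rw [act_id_right, act_id_right] at h
    exact h

@[simp] lemma app_homMk {P Q : Profunctor.{u} A B} (φ : ∀ (a : A) (b : B), El P a b → El Q a b)
    (nat) {a : A} {b : B} (p : El P a b) : app (homMk (P := P) (Q := Q) φ nat) p = φ a b p := rfl

/-- The relation generating the coend `∫^b P(a, b) × Q(b, c)`: a morphism of `B` may be moved from one factor
to the other. -/
inductive CoendRel (P : Profunctor.{u} A B) (Q : Profunctor.{u} B C) (a : A) (c : C) :
    (Σ b : B, El P a b × El Q b c) → (Σ b : B, El P a b × El Q b c) → Prop
  | slide {b b' : B} (g : b ⟶ b') (p : El P a b') (q : El Q b c) :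
      CoendRel P Q a c ⟨b, act P (𝟙 a) g p, q⟩ ⟨b', p, act Q g (𝟙 c) q⟩

/-- The coend `∫^b P(a, b) × Q(b, c)`. -/
abbrev CompEl (P : Profunctor.{u} A B) (Q : Profunctor.{u} B C) (a : A) (c : C) : Type u :=
  Quot (CoendRel P Q a c)

/-- Composition of profunctors, `P` first. -/
def comp (P : Profunctor.{u} A B) (Q : Profunctor.{u} B C) : Profunctor.{u} A C :=
  ofAct (CompEl P Q)
    (fun {a a' c c'} f g => Quot.map
      (fun x => ⟨x.1, act P f (𝟙 x.1) x.2.1, act Q (𝟙 x.1) g x.2.2⟩) (by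
        rintro _ _ ⟨h, p, q⟩
        have := CoendRel.slide (P := P) (Q := Q) (a := a') (c := c') h (act P f (𝟙 _) p) (act Q (𝟙 _) g q)
        simpa using this))
    (by rintro a c ⟨b, p, q⟩; simp [Quot.map])
    (by rintro a a' a'' c c' c'' f f' g g' ⟨b, p, q⟩; simp [Quot.map])

/-- The class of `(p, q)` in the coend. -/
def pair {P : Profunctor.{u} A B} {Q : Profunctor.{u} B C} {a : A} {b : B} {c : C} (p : El P a b) (q : El Q b c) :
    El (comp P Q) a c :=
  Quot.mk _ ⟨b, p, q⟩

@[simp] lemma act_pair {P : Profunctor.{u} A B} {Q : Profunctor.{u} B C} {a a' : A} {b : B} {c c' : C}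
    (f : a ⟶ a') (g : c' ⟶ c) (p : El P a b) (q : El Q b c) :
    act (comp P Q) f g (pair p q) = pair (act P f (𝟙 b) p) (act Q (𝟙 b) g q) :=
  act_ofAct ..

lemma pair_slide {P : Profunctor.{u} A B} {Q : Profunctor.{u} B C} {a : A} {b b' : B} {c : C}
    (g : b ⟶ b') (p : El P a b') (q : El Q b c) :
    pair (act P (𝟙 a) g p) q = pair p (act Q g (𝟙 c) q) :=
  Quot.sound (.slide g p q)

lemma pair_surj {P : Profunctor.{u} A B} {Q : Profunctor.{u} B C} {a : A} {c : C}
    (x : El (comp P Q) a c) : ∃ (b : B) (p : El P a b) (q : El Q b c), pair p q = x := by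
  obtain ⟨b, p, q⟩ := x
  exact ⟨b, p, q, rfl⟩

/-- The universal property of the coend. -/
def desc {P : Profunctor.{u} A B} {Q : Profunctor.{u} B C} {R : Profunctor.{u} A C}
    (φ : ∀ {a : A} {b : B} {c : C}, El P a b → El Q b c → El R a c)
    (nat : ∀ {a a' : A} {b : B} {c c' : C} (f : a ⟶ a') (g : c' ⟶ c) (p : El P a b) (q : El Q b c),
      φ (act P f (𝟙 b) p) (act Q (𝟙 b) g q) = act R f g (φ p q))
    (slide : ∀ {a : A} {b b' : B} {c : C} (g : b ⟶ b') (p : El P a b') (q : El Q b c),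
      φ (act P (𝟙 a) g p) q = φ p (act Q g (𝟙 c) q)) : comp P Q ⟶ R :=
  homMk (fun a c => Quot.lift (fun x => φ x.2.1 x.2.2) (by
      rintro _ _ ⟨h, p, q⟩; exact slide h p q))
    (by
      intro a a' c c' f g x
      obtain ⟨b, p, q, rfl⟩ := pair_surj x
      rw [act_pair]
      exact nat f g p q)

@[simp] lemma app_desc {P : Profunctor.{u} A B} {Q : Profunctor.{u} B C} {R : Profunctor.{u} A C}
    (φ : ∀ {a : A} {b : B} {c : C}, El P a b → El Q b c → El R a c) (nat slide) {a : A} {b : B} {c : C}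
    (p : El P a b) (q : El Q b c) : app (desc (P := P) (Q := Q) (R := R) φ nat slide) (pair p q) = φ p q := rfl

lemma comp_hom_ext {P : Profunctor.{u} A B} {Q : Profunctor.{u} B C} {R : Profunctor.{u} A C}
    {η θ : comp P Q ⟶ R}
    (h : ∀ {a : A} {b : B} {c : C} (p : El P a b) (q : El Q b c),
      app η (pair p q) = app θ (pair p q)) : η = θ := by
  apply hom_ext
  intro a c x
  obtain ⟨b, p, q, rfl⟩ := pair_surj x
  exact h p q


@[simp] lemma act_idProf {a a' b b' : A} (f : a ⟶ a') (g : b' ⟶ b) (p : b ⟶ a) :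
    act (Profunctor.id (C := A)) (a := a) (b := b) f g p = g ≫ p ≫ f :=
  rfl

@[simp] lemma act_toProfunctor (F : A ⥤ B) {a a' : A} {b b' : B} (f : a ⟶ a') (g : b' ⟶ b)
    (p : b ⟶ F.obj a) : act F.toProfunctor (a := a) (b := b) f g p = g ≫ p ≫ F.map f :=
  rfl

@[simp] lemma act_toProfunctorRev (F : A ⥤ B) {b b' : B} {a a' : A} (f : b ⟶ b') (g : a' ⟶ a)
    (p : F.obj a ⟶ b) : act F.toProfunctorRev (a := b) (b := a) f g p = F.map g ≫ p ≫ f :=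
  rfl

/-- Associativity of composition, one direction. -/
def assocHom (P : Profunctor.{u} A B) (Q : Profunctor.{u} B C) (R : Profunctor.{u} C D) :
    comp (comp P Q) R ⟶ comp P (comp Q R) :=
  desc (fun {_ _ _} x r => Quot.lift (fun y => pair y.2.1 (pair y.2.2 r)) (by
      rintro _ _ ⟨g, p, q⟩
      have h := pair_slide g p (pair q r)
      rw [act_pair, act_id] at h
      exact h) x)
    (by
      intro a a' c d d' f g x r
      obtain ⟨b, p, q, rfl⟩ := pair_surj x
      rw [act_pair]
      change pair (act P f (𝟙 _) p) (pair (act Q (𝟙 _) (𝟙 _) q) (act R (𝟙 _) g r)) =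
        act _ f g (pair p (pair q r))
      simp)
    (by
      intro a c c' d g x r
      obtain ⟨b, p, q, rfl⟩ := pair_surj x
      rw [act_pair]
      change pair (act P _ _ p) (pair (act Q _ g q) r) = pair p (pair q (act R g _ r))
      rw [act_id, pair_slide])

@[simp] lemma app_assocHom {P : Profunctor.{u} A B} {Q : Profunctor.{u} B C} {R : Profunctor.{u} C D}
    {a b c d} (p : El P a b) (q : El Q b c) (r : El R c d) :
    app (assocHom P Q R) (pair (pair p q) r) = pair p (pair q r) := rfl

/-- Associativity of composition, the other direction. -/
def assocInv (P : Profunctor.{u} A B) (Q : Profunctor.{u} B C) (R : Profunctor.{u} C D) :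
    comp P (comp Q R) ⟶ comp (comp P Q) R :=
  desc (fun {_ _ _} p x => Quot.lift (fun y => pair (pair p y.2.1) y.2.2) (by
      rintro _ _ ⟨g, q, r⟩
      have h := pair_slide g (pair p q) r
      rw [act_pair, act_id] at h
      exact h) x)
    (by
      intro a a' b d d' f g p x
      obtain ⟨c, q, r, rfl⟩ := pair_surj x
      rw [act_pair]
      change pair (pair (act P f (𝟙 _) p) (act Q (𝟙 _) (𝟙 _) q)) (act R (𝟙 _) g r) =
        act _ f g (pair (pair p q) r)
      simp)
    (by
      intro a b b' d g p x
      obtain ⟨c, q, r, rfl⟩ := pair_surj x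
      rw [act_pair]
      change pair (pair (act P _ g p) q) r = pair (pair p (act Q g _ q)) (act R _ _ r)
      rw [pair_slide]; simp)

@[simp] lemma app_assocInv {P : Profunctor.{u} A B} {Q : Profunctor.{u} B C} {R : Profunctor.{u} C D}
    {a b c d} (p : El P a b) (q : El Q b c) (r : El R c d) :
    app (assocInv P Q R) (pair p (pair q r)) = pair (pair p q) r := rfl

/-- Associativity of composition. -/
def assocIso (P : Profunctor.{u} A B) (Q : Profunctor.{u} B C) (R : Profunctor.{u} C D) :
    comp (comp P Q) R ≅ comp P (comp Q R) where
  hom := assocHom P Q R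
  inv := assocInv P Q R
  hom_inv_id := by
    apply comp_hom_ext
    intro a c d x r
    obtain ⟨b, p, q, rfl⟩ := pair_surj x
    rfl
  inv_hom_id := by
    apply comp_hom_ext
    intro a c d p x
    obtain ⟨b, q, r, rfl⟩ := pair_surj x
    rfl

/-- The hom profunctor is a left identity (co-Yoneda). -/
def leftUnitIso (P : Profunctor.{u} A B) : comp Profunctor.id P ≅ P where
  hom := desc (fun {a a' b} (f : a' ⟶ a) p => act P f (𝟙 b) p)
    (by
      intro a a' b c c' f g (h : b ⟶ a) p
      have h1 := act_act P h f (𝟙 c) g p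
      have h2 := act_act P (𝟙 b) (𝟙 b ≫ h ≫ f) g (𝟙 c') p
      simp only [Category.id_comp, Category.comp_id] at h1 h2
      exact Eq.trans (congrArg (fun k => act P k (𝟙 c') (act P (𝟙 b) g p))
        (by simp : 𝟙 b ≫ h ≫ f = h ≫ f)) (h2.trans h1.symm))
    (by
      intro a b b' c g (h : b' ⟶ a) p
      have h2 := act_act P g h (𝟙 c) (𝟙 c) p
      have h3 : g ≫ h ≫ 𝟙 a = g ≫ h := by simp
      simp only [Category.id_comp] at h2
      rw [h2]
      exact congrArg (fun k => act P k (𝟙 c) p) h3)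
  inv := homMk (fun a b p => pair (P := Profunctor.id) (𝟙 a : a ⟶ a) p) (by
    intro a a' b b' f g p
    have h := pair_slide (P := Profunctor.id) (Q := P) f (𝟙 a') (act P (𝟙 _) g p)
    rw [act_act, Category.id_comp, Category.id_comp] at h
    refine h.symm.trans (Eq.trans ?_ (act_pair (P := Profunctor.id) f g (𝟙 a : a ⟶ a) p).symm)
    exact congrArg (fun k => pair (P := Profunctor.id) (a := a') k (act P (𝟙 a) g p))
      (by simp : f ≫ 𝟙 a' ≫ 𝟙 a' = 𝟙 a ≫ 𝟙 a ≫ f))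
  hom_inv_id := by
    apply comp_hom_ext
    intro a a' b (f : a' ⟶ a) p
    have h := pair_slide (P := Profunctor.id) (Q := P) f (𝟙 a) p
    exact h.symm.trans (congrArg (fun k => pair (P := Profunctor.id) (a := a) k p)
      (by simp : f ≫ 𝟙 a ≫ 𝟙 a = f))
  inv_hom_id := by
    apply hom_ext
    intro a b p
    exact act_id P p

/-- The hom profunctor is a right identity (co-Yoneda). -/
def rightUnitIso (P : Profunctor.{u} A B) : comp P Profunctor.id ≅ P where
  hom := desc (fun {a b b'} p (f : b' ⟶ b) => act P (𝟙 a) f p)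
    (by
      intro a a' b c c' f g p (h : c ⟶ b)
      have h1 := act_act P (𝟙 a) f h g p
      have h2 := act_act P f (𝟙 a') (𝟙 b) (g ≫ h ≫ 𝟙 b) p
      simp only [Category.id_comp, Category.comp_id] at h1 h2
      rw [h1]
      exact (congrArg (fun k => act P (𝟙 a') k (act P f (𝟙 b) p))
        (by simp : g ≫ h ≫ 𝟙 b = g ≫ h)).trans (by rw [act_act]; simp))
    (by
      intro a b b' c g p (h : c ⟶ b)
      have h1 := act_act P (𝟙 a) (𝟙 a) g h p
      simp only [Category.id_comp] at h1
      rw [h1]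
      exact congrArg (fun k => act P (𝟙 a) k p) (by simp : h ≫ g = 𝟙 c ≫ h ≫ g))
  inv := homMk (fun a b p => pair (Q := Profunctor.id) p (𝟙 b : b ⟶ b)) (by
    intro a a' b b' f g p
    have h := pair_slide (P := P) (Q := Profunctor.id) g (act P f (𝟙 _) p) (𝟙 b')
    rw [act_act, Category.comp_id, Category.comp_id] at h
    refine h.trans (Eq.trans ?_ (act_pair (Q := Profunctor.id) f g p (𝟙 b : b ⟶ b)).symm)
    exact congrArg (fun k => pair (Q := Profunctor.id) (c := b') (act P f (𝟙 b) p) k)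
      (by simp : 𝟙 b' ≫ 𝟙 b' ≫ g = g ≫ 𝟙 b ≫ 𝟙 b))
  hom_inv_id := by
    apply comp_hom_ext
    intro a b b' p (f : b' ⟶ b)
    have h := pair_slide (P := P) (Q := Profunctor.id) f p (𝟙 b')
    exact h.trans (congrArg (fun k => pair (Q := Profunctor.id) (c := b') p k)
      (by simp : 𝟙 b' ≫ 𝟙 b' ≫ f = f))
  inv_hom_id := by
    apply hom_ext
    intro a b p
    exact act_id P p

/-- Left whiskering. -/
def whiskL (P : Profunctor.{u} A B) {Q R : Profunctor.{u} B C} (η : Q ⟶ R) : comp P Q ⟶ comp P R :=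
  desc (fun p q => pair p (app η q)) (by intros; simp) (by intros; simp [pair_slide])

/-- Right whiskering. -/
def whiskR {P Q : Profunctor.{u} A B} (η : P ⟶ Q) (R : Profunctor.{u} B C) : comp P R ⟶ comp Q R :=
  desc (fun p q => pair (app η p) q) (by intros; simp) (by intros; simp [pair_slide])

end Basic

open Bicategory

/-- The bicategory of small categories, profunctors and natural transformations. -/
instance : Bicategory Prof.{u} where
  Hom C D := Profunctor.{u} C D
  id C := Profunctor.id
  comp P Q := comp P Q
  homCategory C D := inferInstanceAs (Category (Profunctor.{u} C D))
  whiskerLeft P _ _ η := whiskL P η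
  whiskerRight η R := whiskR η R
  associator P Q R := assocIso P Q R
  leftUnitor P := leftUnitIso P
  rightUnitor P := rightUnitIso P
  whiskerLeft_id _ _ := comp_hom_ext fun _ _ => rfl
  whiskerLeft_comp _ _ _ _ _ _ := comp_hom_ext fun _ _ => rfl
  id_whiskerLeft {_ _ P Q} η := by
    rw [← Category.assoc, Iso.eq_comp_inv]
    refine comp_hom_ext fun {a a' b} f p => ?_
    exact (app_act η f (𝟙 b) p).symm
  comp_whiskerLeft P Q _ _ η := by
    rw [← Category.assoc, Iso.eq_comp_inv]
    refine comp_hom_ext fun x r => ?_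
    obtain ⟨b, p, q, rfl⟩ := pair_surj x
    rfl
  id_whiskerRight _ _ := comp_hom_ext fun _ _ => rfl
  comp_whiskerRight _ _ _ := comp_hom_ext fun _ _ => rfl
  whiskerRight_id {_ _ P Q} η := by
    rw [← Category.assoc, Iso.eq_comp_inv]
    refine comp_hom_ext fun {a b b'} p f => ?_
    exact (app_act η (𝟙 a) f p).symm
  whiskerRight_comp η Q R := by
    rw [Iso.eq_inv_comp]
    refine comp_hom_ext fun x r => ?_
    obtain ⟨b, p, q, rfl⟩ := pair_surj x
    rfl
  whisker_assoc P _ _ η R := by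
    rw [← Category.assoc, Iso.eq_comp_inv]
    refine comp_hom_ext fun x r => ?_
    obtain ⟨b, p, q, rfl⟩ := pair_surj x
    rfl
  whisker_exchange _ _ := comp_hom_ext fun _ _ => rfl
  pentagon P Q R S := by
    refine comp_hom_ext fun x s => ?_
    obtain ⟨c, y, r, rfl⟩ := pair_surj x
    obtain ⟨b, p, q, rfl⟩ := pair_surj y
    rfl
  triangle P Q := by
    refine comp_hom_ext fun x q => ?_
    obtain ⟨b, p, f, rfl⟩ := pair_surj x
    exact (pair_slide f p q).symm


/-! ### The monoidal product of `Prof` -/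
section Products
variable {A B C A' B' C' : Type u} [SmallCategory A] [SmallCategory B] [SmallCategory C]
  [SmallCategory A'] [SmallCategory B'] [SmallCategory C']

/-- The external product of profunctors. -/
def tens (P : Profunctor.{u} A B) (Q : Profunctor.{u} A' B') : Profunctor.{u} (A × A') (B × B') :=
  ofAct (fun x y => El P x.1 y.1 × El Q x.2 y.2)
    (fun f g p => (act P f.1 g.1 p.1, act Q f.2 g.2 p.2))
    (by rintro ⟨a, a'⟩ ⟨b, b'⟩ ⟨p, q⟩; exact Prod.ext (act_id P p) (act_id Q q))
    (by intros; exact Prod.ext (act_act P _ _ _ _ _).symm (act_act Q _ _ _ _ _).symm)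

lemma act_tens (P : Profunctor.{u} A B) (Q : Profunctor.{u} A' B') {x x' : A × A'} {y y' : B × B'}
    (f : x ⟶ x') (g : y' ⟶ y) (p : El P x.1 y.1) (q : El Q x.2 y.2) :
    act (tens P Q) (a := x) (b := y) f g (p, q) = (act P f.1 g.1 p, act Q f.2 g.2 q) :=
  act_ofAct ..

/-- The interchange 2-morphism. -/
def tensComp (P : Profunctor.{u} A B) (Q : Profunctor.{u} B C) (P' : Profunctor.{u} A' B')
    (Q' : Profunctor.{u} B' C') : tens (comp P Q) (comp P' Q') ⟶ comp (tens P P') (tens Q Q') :=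
  homMk (fun x y p => Quot.map₂ (fun s t => ⟨(s.1, t.1), (s.2.1, t.2.1), (s.2.2, t.2.2)⟩)
      (by
        rintro ⟨b, p, q⟩ _ _ ⟨g, p', q'⟩
        have h := CoendRel.slide (P := tens P P') (Q := tens Q Q') (a := x) (c := y)
          (b := (b, _)) (b' := (b, _)) (𝟙 b, g) (p, p') (q, q')
        rw [act_tens, act_tens] at h
        simpa using h)
      (by
        rintro _ _ ⟨b, p, q⟩ ⟨g, p', q'⟩
        have h := CoendRel.slide (P := tens P P') (Q := tens Q Q') (a := x) (c := y)
          (b := (_, b)) (b' := (_, b)) (g, 𝟙 b) (p', p) (q', q)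
        rw [act_tens, act_tens] at h
        simpa using h) p.1 p.2)
    (by
      rintro x x' y y' f g ⟨p, p'⟩
      obtain ⟨b, p, q, rfl⟩ := pair_surj p
      obtain ⟨b', p', q', rfl⟩ := pair_surj p'
      rw [act_tens, act_pair, act_pair]
      refine Eq.trans ?_ (act_pair (P := tens P P') (Q := tens Q Q') (b := (b, b')) f g (p, p') (q, q')).symm
      rw [act_tens, act_tens]
      rfl)

@[simp] lemma app_tensComp {P : Profunctor.{u} A B} {Q : Profunctor.{u} B C} {P' : Profunctor.{u} A' B'}
    {Q' : Profunctor.{u} B' C'} {a b c a' b' c'} (p : El P a b) (q : El Q b c) (p' : El P' a' b')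
    (q' : El Q' b' c') :
    app (tensComp P Q P' Q') (a := (a, a')) (b := (c, c')) (pair p q, pair p' q') =
      pair (P := tens P P') (Q := tens Q Q') (b := (b, b')) (p, p') (q, q') := rfl

/-- The inverse of the interchange 2-morphism. -/
def tensCompInv (P : Profunctor.{u} A B) (Q : Profunctor.{u} B C) (P' : Profunctor.{u} A' B')
    (Q' : Profunctor.{u} B' C') : comp (tens P P') (tens Q Q') ⟶ tens (comp P Q) (comp P' Q') :=
  desc (fun {a b c} p q => ((pair p.1 q.1, pair p.2 q.2) : El (comp P Q) a.1 c.1 × El (comp P' Q') a.2 c.2))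
    (by
      rintro a a' b c c' f g ⟨p, p'⟩ ⟨q, q'⟩
      rw [act_tens, act_tens, act_tens, act_pair, act_pair]
      rfl)
    (by
      rintro a b b' c g ⟨p, p'⟩ ⟨q, q'⟩
      rw [act_tens, act_tens]
      exact Prod.ext (pair_slide g.1 p q) (pair_slide g.2 p' q'))

/-- The external product of natural transformations. -/
def tensMap {P Q : Profunctor.{u} A B} {P' Q' : Profunctor.{u} A' B'} (e : P ⟶ Q) (e' : P' ⟶ Q') :
    tens P P' ⟶ tens Q Q' :=
  homMk (fun x y p => ((app e p.1, app e' p.2) : El Q x.1 y.1 × El Q' x.2 y.2))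
    (by
      rintro x x' y y' f g ⟨p, p'⟩
      rw [act_tens, act_tens, app_act, app_act])

/-- The external product of identity profunctors. -/
def tensId : Profunctor.id (C := A × B) ≅ tens (Profunctor.id (C := A)) (Profunctor.id (C := B)) where
  hom := homMk (fun _ _ f => f) (fun f g p =>
    (act_tens (Profunctor.id (C := A)) (Profunctor.id (C := B)) f g p.1 p.2).symm)
  inv := homMk (fun _ _ f => f) (fun f g p =>
    act_tens (Profunctor.id (C := A)) (Profunctor.id (C := B)) f g p.1 p.2)
  hom_inv_id := rfl
  inv_hom_id := rfl

end Products

section Adj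
variable {A B : Prof.{u}}


/-- Elementwise form of the first triangle identity. -/
lemma leftZigzag_iff {P : A ⟶ B} {Q : B ⟶ A} (e : 𝟙 A ⟶ P ≫ Q) (k : Q ≫ P ⟶ 𝟙 B) :
    leftZigzag e k = (λ_ P).hom ≫ (ρ_ P).inv ↔
      ∀ {a : A} {b : B} (p : El P a b), ∃ (x : B) (j : El P a x) (j' : El Q x a),
        app (P := Profunctor.id) (Q := comp P Q) e (a := a) (b := a) (𝟙 a) = pair j j' ∧
        act P (𝟙 a) (app (P := comp Q P) (Q := Profunctor.id) k (pair j' p)) j = p := by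
  have key : leftZigzag e k = e ▷ P ≫ (α_ P Q P).hom ≫ P ◁ k := by simp [bicategoricalComp]
  have key2 : leftZigzag e k = (λ_ P).hom ≫ (ρ_ P).inv ↔
      (λ_ P).inv ≫ e ▷ P ≫ (α_ P Q P).hom ≫ P ◁ k ≫ (ρ_ P).hom = 𝟙 P := by
    rw [key, Iso.inv_comp_eq, ← Category.assoc, ← Category.assoc, ← Category.assoc, ← Iso.eq_comp_inv,
      Category.comp_id, Category.assoc]
  rw [key2]
  have calc1 : ∀ {a : A} {b x : B} (p : El P a b) (j : El P a x) (j' : El Q x a),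
        app (P := Profunctor.id) (Q := comp P Q) e (a := a) (b := a) (𝟙 a) = pair j j' →
      app (P := P) (Q := P) ((λ_ P).inv ≫ e ▷ P ≫ (α_ P Q P).hom ≫ P ◁ k ≫ (ρ_ P).hom) p =
        act P (𝟙 a) (app (P := comp Q P) (Q := Profunctor.id) k (pair j' p)) j := by
    intro a b x p j j' h
    exact congrArg (fun z => app (P := comp (comp P Q) P) (Q := P)
      ((α_ P Q P).hom ≫ P ◁ k ≫ (ρ_ P).hom) (pair (P := comp P Q) (Q := P) z p)) h
  constructor
  · intro h a b p
    obtain ⟨x, j, j', hj⟩ :=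
      pair_surj (app (P := Profunctor.id) (Q := comp P Q) e (a := a) (b := a) (𝟙 a))
    refine ⟨x, j, j', hj.symm, ?_⟩
    rw [← calc1 p j j' hj.symm, h]
    rfl
  · intro h
    refine hom_ext (P := P) (Q := P) fun a b p => ?_
    obtain ⟨x, j, j', hj, hp⟩ := h p
    exact (calc1 p j j' hj).trans hp

/-- Elementwise form of the second triangle identity. -/
lemma rightZigzag_iff {P : A ⟶ B} {Q : B ⟶ A} (e : 𝟙 A ⟶ P ≫ Q) (k : Q ≫ P ⟶ 𝟙 B) :
    rightZigzag e k = (ρ_ Q).hom ≫ (λ_ Q).inv ↔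
      ∀ {a : A} {b : B} (q : El Q b a), ∃ (x : B) (j : El P a x) (j' : El Q x a),
        app (P := Profunctor.id) (Q := comp P Q) e (a := a) (b := a) (𝟙 a) = pair j j' ∧
        act Q (app (P := comp Q P) (Q := Profunctor.id) k (pair q j)) (𝟙 a) j' = q := by
  have key : rightZigzag e k = Q ◁ e ≫ (α_ Q P Q).inv ≫ k ▷ Q := by simp [bicategoricalComp]
  have key2 : rightZigzag e k = (ρ_ Q).hom ≫ (λ_ Q).inv ↔
      (ρ_ Q).inv ≫ Q ◁ e ≫ (α_ Q P Q).inv ≫ k ▷ Q ≫ (λ_ Q).hom = 𝟙 Q := by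
    rw [key, Iso.inv_comp_eq, ← Category.assoc, ← Category.assoc, ← Category.assoc, ← Iso.eq_comp_inv,
      Category.comp_id, Category.assoc]
  rw [key2]
  have calc1 : ∀ {a : A} {b x : B} (q : El Q b a) (j : El P a x) (j' : El Q x a),
        app (P := Profunctor.id) (Q := comp P Q) e (a := a) (b := a) (𝟙 a) = pair j j' →
      app (P := Q) (Q := Q) ((ρ_ Q).inv ≫ Q ◁ e ≫ (α_ Q P Q).inv ≫ k ▷ Q ≫ (λ_ Q).hom) q =
        act Q (app (P := comp Q P) (Q := Profunctor.id) k (pair q j)) (𝟙 a) j' := by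
    intro a b x q j j' h
    exact congrArg (fun z => app (P := comp Q (comp P Q)) (Q := Q)
      ((α_ Q P Q).inv ≫ k ▷ Q ≫ (λ_ Q).hom) (pair (P := Q) (Q := comp P Q) q z)) h
  constructor
  · intro h a b q
    obtain ⟨x, j, j', hj⟩ :=
      pair_surj (app (P := Profunctor.id) (Q := comp P Q) e (a := a) (b := a) (𝟙 a))
    refine ⟨x, j, j', hj.symm, ?_⟩
    rw [← calc1 q j j' hj.symm, h]
    rfl
  · intro h
    refine hom_ext (P := Q) (Q := Q) fun b a q => ?_
    obtain ⟨x, j, j', hj, hq⟩ := h q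
    exact (calc1 q j j' hj).trans hq

/-- The monoidal product of `Prof` on objects. -/
def tensorObj (A B : Prof.{u}) : Prof.{u} := ⟨A × B⟩
/-- The monoidal unit of `Prof`: the terminal category. -/
def tensorUnit : Prof.{u} := ⟨Discrete PUnit.{u + 1}⟩
/-- The dual of an object of `Prof`: the opposite category. -/
def dual (A : Prof.{u}) : Prof.{u} := ⟨Aᵒᵖ⟩

scoped infixr:70 " ⊠ " => tensorObj

/-- The monoidal product of `Prof` on 1-morphisms. -/
def tensorHom {A B A' B' : Prof.{u}} (P : A ⟶ B) (Q : A' ⟶ B') : A ⊠ A' ⟶ B ⊠ B' := tens P Q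

scoped infixr:70 " ⊠₁ " => tensorHom



/-- The product of two adjunctions. -/
def tensorAdj {A B A' B' : Prof.{u}} {P : A ⟶ B} {P' : B ⟶ A} {Q : A' ⟶ B'} {Q' : B' ⟶ A'}
    (adj : P ⊣ P') (adj' : Q ⊣ Q') : P ⊠₁ Q ⊣ P' ⊠₁ Q' where
  unit := tensId.hom ≫ tensMap adj.unit adj'.unit ≫ tensComp P P' Q Q'
  counit := tensCompInv P' P Q' Q ≫ tensMap adj.counit adj'.counit ≫ tensId.inv
  left_triangle := by
    rw [leftZigzag_iff]
    rintro ⟨a, a'⟩ ⟨b, b'⟩ ⟨p, p'⟩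
    obtain ⟨x, j, j', h, e⟩ := (leftZigzag_iff _ _).1 adj.left_triangle p
    obtain ⟨y, k, k', h', e'⟩ := (leftZigzag_iff _ _).1 adj'.left_triangle p'
    refine ⟨(x, y), (j, k), (j', k'), ?_, ?_⟩
    · exact congrArg (app (tensComp P P' Q Q') (a := (a, a')) (b := (a, a'))) (congrArg₂ Prod.mk h h')
    · exact (act_tens P Q (x := (a, a')) (x' := (a, a')) (y := (x, y)) (y' := (b, b')) (𝟙 _)
        (app (P := comp P' P) (Q := Profunctor.id) adj.counit (pair j' p),
          app (P := comp Q' Q) (Q := Profunctor.id) adj'.counit (pair k' p')) j k).trans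
        (congrArg₂ Prod.mk e e')
  right_triangle := by
    rw [rightZigzag_iff]
    rintro ⟨a, a'⟩ ⟨b, b'⟩ ⟨p, p'⟩
    obtain ⟨x, j, j', h, e⟩ := (rightZigzag_iff _ _).1 adj.right_triangle p
    obtain ⟨y, k, k', h', e'⟩ := (rightZigzag_iff _ _).1 adj'.right_triangle p'
    refine ⟨(x, y), (j, k), (j', k'), ?_, ?_⟩
    · exact congrArg (app (tensComp P P' Q Q') (a := (a, a')) (b := (a, a'))) (congrArg₂ Prod.mk h h')
    · exact (act_tens P' Q' (x := (x, y)) (x' := (b, b')) (y := (a, a')) (y' := (a, a'))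
        (app (P := comp P' P) (Q := Profunctor.id) adj.counit (pair p j),
          app (P := comp Q' Q) (Q := Profunctor.id) adj'.counit (pair p' k)) (𝟙 _) j' k').trans
        (congrArg₂ Prod.mk e e')

/-- The covariant embedding of a functor: `(a, b) ↦ B(b, F a)`. -/
def companion {A B : Prof.{u}} (F : A ⥤ B) : A ⟶ B := F.toProfunctor
/-- The contravariant embedding of a functor: `(b, a) ↦ B(F a, b)`. -/
def conjoint {A B : Prof.{u}} (F : A ⥤ B) : B ⟶ A := F.toProfunctorRev

/-- The unit of the adjunction between the two embeddings of a functor. -/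
def companionUnit {A B : Prof.{u}} (F : A ⥤ B) : 𝟙 A ⟶ companion F ≫ conjoint F :=
  homMk (P := Profunctor.id) (Q := comp F.toProfunctor F.toProfunctorRev)
    (fun a a' (f : a' ⟶ a) => pair (P := F.toProfunctor) (Q := F.toProfunctorRev) (a := a) (c := a')
      (b := F.obj a) (𝟙 (F.obj a)) (F.map f))
    (by
      intro a₀ a₁ b₀ b₁ f g (h : b₀ ⟶ a₀)
      refine Eq.trans ?_ (act_pair (P := F.toProfunctor) (Q := F.toProfunctorRev) f g
        (𝟙 (F.obj a₀)) (F.map h)).symm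
      refine Eq.trans ?_ (Eq.trans (pair_slide (P := F.toProfunctor) (Q := F.toProfunctorRev)
        (F.map f) (𝟙 (F.obj a₁)) (F.map g ≫ F.map h)).symm ?_)
      · exact congrArg (fun k => pair (P := F.toProfunctor) (Q := F.toProfunctorRev) (a := a₁)
          (c := b₁) (𝟙 (F.obj a₁)) k)
          (by simp : F.map (g ≫ h ≫ f) = F.map (𝟙 _) ≫ (F.map g ≫ F.map h) ≫ F.map f)
      · exact congrArg₂ (pair (P := F.toProfunctor) (Q := F.toProfunctorRev) (a := a₁) (c := b₁))
          (by simp : F.map f ≫ 𝟙 _ ≫ F.map (𝟙 a₁) = 𝟙 _ ≫ 𝟙 _ ≫ F.map f)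
          (by simp : F.map g ≫ F.map h = F.map g ≫ F.map h ≫ 𝟙 _))

/-- The counit of the adjunction between the two embeddings of a functor. -/
def companionCounit {A B : Prof.{u}} (F : A ⥤ B) : conjoint F ≫ companion F ⟶ 𝟙 B :=
  desc (P := F.toProfunctorRev) (Q := F.toProfunctor) (R := Profunctor.id)
    (fun {b a b'} (p : F.obj a ⟶ b) (q : b' ⟶ F.obj a) => (q ≫ p : b' ⟶ b))
    (by
      intro b b' a c c' f g (p : F.obj a ⟶ b) (q : c ⟶ F.obj a)
      exact (by simp : (g ≫ q ≫ F.map (𝟙 a)) ≫ F.map (𝟙 a) ≫ p ≫ f = g ≫ (q ≫ p) ≫ f))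
    (by
      intro b a a' c g (p : F.obj a' ⟶ b) (q : c ⟶ F.obj a)
      exact (by simp : q ≫ F.map g ≫ p ≫ 𝟙 b = (𝟙 c ≫ q ≫ F.map g) ≫ p))

/-- The covariant embedding is left adjoint to the contravariant one. -/
def companionAdj {A B : Prof.{u}} (F : A ⥤ B) : companion F ⊣ conjoint F where
  unit := companionUnit F
  counit := companionCounit F
  left_triangle := by
    refine (leftZigzag_iff _ _).2 fun {a b} (p : b ⟶ F.obj a) => ?_
    refine ⟨F.obj a, 𝟙 (F.obj a), F.map (𝟙 a), rfl, ?_⟩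
    exact (by simp : (p ≫ F.map (𝟙 a)) ≫ 𝟙 _ ≫ F.map (𝟙 a) = p)
  right_triangle := by
    refine (rightZigzag_iff _ _).2 fun {a b} (q : F.obj a ⟶ b) => ?_
    refine ⟨F.obj a, 𝟙 (F.obj a), F.map (𝟙 a), rfl, ?_⟩
    exact (by simp : F.map (𝟙 a) ≫ F.map (𝟙 a) ≫ 𝟙 _ ≫ q = q)

end Adj

/-! ### Elements of composite 1-morphisms, and the structural 1-morphisms -/

section Bundled
variable {A B C A' B' : Prof.{u}}

/-- Apply a 2-morphism to an element. -/
def ap {P Q : A ⟶ B} (e : P ⟶ Q) {a : A} {b : B} (p : El P a b) : El Q a b := app e p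

/-- The element of a composite represented by a pair. Every element is of this form. -/
def pr {P : A ⟶ B} {Q : B ⟶ C} {a : A} {b : B} {c : C} (p : El P a b) (q : El Q b c) :
    El (P ≫ Q) a c := pair p q

/-- The element of a product of 1-morphisms given by two elements. -/
def tp {P : A ⟶ B} {Q : A' ⟶ B'} {a : A} {b : B} {a' : A'} {b' : B'} (p : El P a b)
    (q : El Q a' b') : El (P ⊠₁ Q) (a, a') (b, b') := (p, q)

/-- A morphism as an element of the identity profunctor. -/
def ofHom {a a' : A} (f : a' ⟶ a) : El (𝟙 A) a a' := f

/-- A pair of morphisms as an element of the identity profunctor of a product. -/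
def ofHom₂ {a a' : A} {b b' : B} (f : a' ⟶ a) (g : b' ⟶ b) :
    El (𝟙 (A ⊠ B)) (a, b) (a', b') := (f, g)

/-- The object of the terminal category. -/
def star : tensorUnit.{u} := (⟨PUnit.unit⟩ : Discrete PUnit.{u + 1})

/-- The associator 1-morphism. -/
def associator (A B C : Prof.{u}) : (A ⊠ B) ⊠ C ⟶ A ⊠ B ⊠ C :=
  companion (A := (A ⊠ B) ⊠ C) (B := A ⊠ B ⊠ C) (prod.associator A B C)

/-- The left unitor 1-morphism. -/
def leftUnitor (A : Prof.{u}) : tensorUnit ⊠ A ⟶ A :=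
  companion (A := tensorUnit ⊠ A) (B := A) (prod.leftUnitor A)

/-- The right unitor 1-morphism. -/
def rightUnitor (A : Prof.{u}) : A ⊠ tensorUnit ⟶ A :=
  companion (A := A ⊠ tensorUnit) (B := A) (prod.rightUnitor A)

/-- The inverse of the associator 1-morphism. -/
def associatorInv (A B C : Prof.{u}) : A ⊠ B ⊠ C ⟶ (A ⊠ B) ⊠ C :=
  conjoint (A := (A ⊠ B) ⊠ C) (B := A ⊠ B ⊠ C) (prod.associator A B C)

/-- The inverse of the right unitor 1-morphism. -/
def rightUnitorInv (A : Prof.{u}) : A ⟶ A ⊠ tensorUnit :=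
  conjoint (A := A ⊠ tensorUnit) (B := A) (prod.rightUnitor A)

/-- The associator 1-morphism is left adjoint to its inverse. -/
def associatorAdj (A B C : Prof.{u}) : associator A B C ⊣ associatorInv A B C := companionAdj _

/-- The right unitor 1-morphism is left adjoint to its inverse. -/
def rightUnitorAdj (A : Prof.{u}) : rightUnitor A ⊣ rightUnitorInv A := companionAdj _

/-- The cup of the duality between `X` and `Xᵒᵖ`: the set at `(⋆; (x, y))` is `X(x, y)`. -/
def cup (X : Prof.{u}) : tensorUnit ⟶ X ⊠ dual X :=
  ofAct (A := tensorUnit.{u}) (B := X × Xᵒᵖ) (fun _ y => y.1 ⟶ y.2.unop)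
    (fun _ g p => g.1 ≫ p ≫ g.2.unop) (by intros; simp) (by intros; simp)

/-- The cap of the duality between `X` and `Xᵒᵖ`: the set at `((x, y); ⋆)` is `X(y, x)`. -/
def cap (X : Prof.{u}) : X ⊠ dual X ⟶ tensorUnit :=
  ofAct (A := X × Xᵒᵖ) (B := tensorUnit.{u}) (fun x _ => x.2.unop ⟶ x.1)
    (fun f _ p => f.2.unop ≫ p ≫ f.1) (by intros; simp) (by intros; simp)

/-- An identity wire `A` with a cup on its right, rebracketed along `A ≅ A × 1` and
`A × (X × Xᵒᵖ) ≅ (A × X) × Xᵒᵖ`. -/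
def cupWire (A X : Prof.{u}) : A ⟶ (A ⊠ X) ⊠ dual X :=
  Profunctor.whiskerLeft₂ (𝟙 A ⊠₁ cup X : A ⊠ tensorUnit ⟶ A ⊠ X ⊠ dual X)
    (prod.rightInverseUnitor A) (prod.associator A X Xᵒᵖ)

/-- An identity wire `B` with a cap on its right, rebracketed in the same way. -/
def capWire (B X : Prof.{u}) : (B ⊠ X) ⊠ dual X ⟶ B :=
  Profunctor.whiskerLeft₂ (𝟙 B ⊠₁ cap X : B ⊠ X ⊠ dual X ⟶ B ⊠ tensorUnit)
    (prod.associator B X Xᵒᵖ) (prod.rightInverseUnitor B)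

/-- The 1-morphism `P` with its right-hand wire `X` closed to a loop by the cup and the cap. -/
def loop {A B X : Prof.{u}} (P : A ⊠ X ⟶ B ⊠ X) : A ⟶ B :=
  cupWire A X ≫ (P ⊠₁ 𝟙 (dual X)) ≫ capWire B X

/-- The element of the looped 1-morphism represented by an element of `P` with the same label `x`
at both ends of the looped wire. Every element is of this form. -/
def close {A B X : Prof.{u}} {P : A ⊠ X ⟶ B ⊠ X} {a : A} {b : B} {x : X}
    (p : El P (a, x) (b, x)) : El (loop P) a b :=
  pr (P := cupWire A X) (b := ((a, x), op x)) (𝟙 a, 𝟙 x)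
    (pr (Q := capWire B X) (b := ((b, x), op x)) (tp p (ofHom (A := dual X) (𝟙 (op x)))) (𝟙 b, 𝟙 x))

end Bundled

end Prof

open Prof Bicategory

/-! ### Interpretations in `Prof` of the pseudomonoid presentation

An interpretation of a presentation is a choice of an object, 1-morphisms and 2-morphisms of `Prof`
for the generators, such that the equations between 2-morphisms hold. The source of each of these
equations is a composite of profunctors, hence a coend: two 2-morphisms out of it are equal if and
only if they agree on the classes of tuples of elements, one for each tile of the diagram. The
equations are spelled out in this form. A 2-morphism applied at a local site of a diagram replaces
the elements at the tiles of this site by representatives of the value of the 2-morphism. -/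

/-- The generators of the pseudomonoid presentation, interpreted in `Prof`. -/
structure PseudomonoidData (C : Prof.{u}) where
  /-- The multiplication. -/
  mul : C ⊠ C ⟶ C
  /-- The unit. -/
  one : tensorUnit ⟶ C
  /-- The invertible associativity 2-morphism. -/
  assoc : (mul ⊠₁ 𝟙 C) ≫ mul ≅ associator C C C ≫ (𝟙 C ⊠₁ mul) ≫ mul
  /-- The invertible left unit 2-morphism. -/
  lunit : (one ⊠₁ 𝟙 C) ≫ mul ≅ leftUnitor C
  /-- The invertible right unit 2-morphism. -/
  runit : (𝟙 C ⊠₁ one) ≫ mul ≅ rightUnitor C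

namespace PseudomonoidData

variable {C : Prof.{u}} (M : PseudomonoidData C)

/-- The associativity 2-morphism sends the class of `(p, q)` to the class of `(r, s)`. -/
def Assoc {a b c d x y : C} (p : El M.mul (a, b) x) (q : El M.mul (x, c) d)
    (r : El M.mul (b, c) y) (s : El M.mul (a, y) d) : Prop :=
  ap M.assoc.hom (pr (tp p (ofHom (𝟙 c))) q) =
    pr (P := associator C C C) (a := ((a, b), c)) (b := (a, (b, c))) (𝟙 a, (𝟙 b, 𝟙 c))
      (pr (tp (ofHom (𝟙 a)) r) s)

/-- The value of the left unit 2-morphism on the class of `(e, p)`. -/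
def lam {x b c : C} (e : El M.one star x) (p : El M.mul (x, b) c) : c ⟶ b :=
  ap M.lunit.hom (pr (tp e (ofHom (𝟙 b))) p)

/-- The value of the right unit 2-morphism on the class of `(e, p)`. -/
def rho {x b c : C} (e : El M.one star x) (p : El M.mul (b, x) c) : c ⟶ b :=
  ap M.runit.hom (pr (tp (ofHom (𝟙 b)) e) p)

/-- The action of morphisms on the elements of the multiplication. -/
def actMul {a a' b b' x x' : C} (f : a ⟶ a') (g : b ⟶ b') (h : x' ⟶ x) (p : El M.mul (a, b) x) :
    El M.mul (a', b') x' :=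
  act M.mul (a := (a, b)) (a' := (a', b')) (f, g) h p

end PseudomonoidData

/-- An interpretation in `Prof` of the pseudomonoid presentation, with underlying object `C`. -/
structure Pseudomonoid (C : Prof.{u}) extends PseudomonoidData C where
  /-- The pentagon: both ways from `((a b) c) d` to `a (b (c d))` agree on the class of
  `(p, q, r)`. -/
  pentagon : ∀ {a b c d e s t s₁ t₂ s₃ s' s'' : C}
    (p : El mul (a, b) s) (q : El mul (s, c) t) (r : El mul (t, d) e)
    (p₁ : El mul (b, c) s₁) (q₁ : El mul (a, s₁) t)
    (q₂ : El mul (s₁, d) t₂) (r₂ : El mul (a, t₂) e)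
    (p₃ : El mul (c, d) s₃) (q₃ : El mul (b, s₃) t₂)
    (q' : El mul (c, d) s') (r' : El mul (s, s') e)
    (p'' : El mul (b, s') s'') (r'' : El mul (a, s'') e),
    toPseudomonoidData.Assoc p q p₁ q₁ → toPseudomonoidData.Assoc q₁ r q₂ r₂ →
    toPseudomonoidData.Assoc p₁ q₂ p₃ q₃ →
    toPseudomonoidData.Assoc q r q' r' → toPseudomonoidData.Assoc p r' p'' r'' →
    (pr (tp (ofHom (𝟙 a)) (pr (tp (ofHom (𝟙 b)) p₃) q₃)) r₂ :
      El ((𝟙 C ⊠₁ ((𝟙 C ⊠₁ mul) ≫ mul)) ≫ mul) (a, (b, (c, d))) e) =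
    pr (tp (ofHom (𝟙 a)) (pr (tp (ofHom (𝟙 b)) q') p'')) r''
  /-- The triangle: both ways from `(a 1) b` to `a b` agree on the class of `(e, p, q)`. -/
  triangle : ∀ {a b c x s t : C} (e : El one star x) (p : El mul (a, x) s) (q : El mul (s, b) c)
    (r : El mul (x, b) t) (q' : El mul (a, t) c),
    toPseudomonoidData.Assoc p q r q' →
    toPseudomonoidData.actMul (𝟙 a) (toPseudomonoidData.lam e r) (𝟙 c) q' =
      toPseudomonoidData.actMul (toPseudomonoidData.rho e p) (𝟙 b) (𝟙 c) q

/-- An interpretation in `Prof` of the right-adjoint pseudomonoid presentation, with underlying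
object `C`: right adjoints of the multiplication and of the unit are part of the structure. -/
structure RightAdjointPseudomonoid (C : Prof.{u}) extends Pseudomonoid C where
  /-- The right adjoint of the multiplication. -/
  comul : C ⟶ C ⊠ C
  /-- The right adjoint of the unit. -/
  coone : C ⟶ tensorUnit
  /-- The unit and counit of the first adjunction, with the triangle equations. -/
  mulAdj : mul ⊣ comul
  /-- The unit and counit of the second adjunction, with the triangle equations. -/
  oneAdj : one ⊣ coone

namespace RightAdjointPseudomonoid

variable {C : Prof.{u}} (I : RightAdjointPseudomonoid C)

/-- The coassociativity 2-morphism of the right adjoint: the mate of the inverse associativity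
2-morphism. -/
def coassoc : I.comul ≫ (I.comul ⊠₁ 𝟙 C) ⟶
    (I.comul ≫ (𝟙 C ⊠₁ I.comul)) ≫ associatorInv C C C :=
  conjugateEquiv ((tensorAdj I.mulAdj (Adjunction.id C)).comp I.mulAdj)
    ((associatorAdj C C C).comp ((tensorAdj (Adjunction.id C) I.mulAdj).comp I.mulAdj)) I.assoc.inv

/-- The right counit 2-morphism of the right adjoint: the mate of the inverse right unit
2-morphism. -/
def corunit : I.comul ≫ (𝟙 C ⊠₁ I.coone) ⟶ rightUnitorInv C :=
  conjugateEquiv ((tensorAdj (Adjunction.id C) I.oneAdj).comp I.mulAdj) (rightUnitorAdj C)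
    I.runit.inv

/-- The coassociativity 2-morphism sends the class of `(p, q)` to the class of `(r, s)`. -/
def Coassoc {a b c d x y : C} (p : El I.comul x (a, b)) (q : El I.comul d (x, c))
    (r : El I.comul y (b, c)) (s : El I.comul d (a, y)) : Prop :=
  ap I.coassoc (pr q (tp p (ofHom (𝟙 c)))) =
    pr (Q := associatorInv C C C) (b := (a, (b, c))) (c := ((a, b), c))
      (pr s (tp (ofHom (𝟙 a)) r)) (𝟙 a, (𝟙 b, 𝟙 c))

/-- The value of the right counit 2-morphism on the class of `(e, p)`. -/
def corho {x b c : C} (e : El I.coone x star) (p : El I.comul c (b, x)) : b ⟶ c :=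
  ap I.corunit (pr p (tp (ofHom (𝟙 b)) e))

/-- The value of the counit of the adjunction of the multiplication on the class of `(q, p)`. -/
def mulCounit {a b x y : C} (q : El I.comul y (a, b)) (p : El I.mul (a, b) x) : x ⟶ y :=
  ap I.mulAdj.counit (pr q p)

/-- The value of the counit of the adjunction of the unit on the class of `(q, p)`. -/
def oneCounit {x y : C} (q : El I.coone y star) (p : El I.one star x) : x ⟶ y :=
  ap I.oneAdj.counit (pr q p)

/-- The unit of the adjunction of the multiplication. -/
def mulUnit {a a' b b' : C} (f : a' ⟶ a) (g : b' ⟶ b) :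
    El (I.mul ≫ I.comul) (a, b) (a', b') :=
  ap I.mulAdj.unit (ofHom₂ f g)

/-- The unit of the adjunction of the unit. -/
def oneUnit : El (I.one ≫ I.coone) star star := ap I.oneAdj.unit (ofHom (𝟙 star))

/-- The source of the generating 2-morphism `Tr`: the multiplication followed by its right adjoint,
with the right-hand wires joined to a loop. -/
abbrev traceLoop : C ⟶ C := loop (I.mul ≫ I.comul)

/-- The value of a 2-morphism `traceLoop ⟶ 𝟙` on the class of `(p, q)`. -/
def trAt (T : I.traceLoop ⟶ 𝟙 C) {a b x y : C} (p : El I.mul (b, x) y) (q : El I.comul y (a, x)) :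
    a ⟶ b :=
  ap T (close (pr p q))

/-- First trace equation (vanishing, unit), between 2-morphisms whose source is the multiplication
followed by its right adjoint, with the right-hand wires capped by the unit and its right adjoint.
One of them joins the right-hand wires to a loop by the counit `coone ≫ one ⟶ 𝟙` and applies the
trace; the other one removes the units. -/
def VanishUnit (T : I.traceLoop ⟶ 𝟙 C) : Prop :=
  ∀ {a b x x' y : C} (p : El I.mul (b, x) y) (e : El I.one star x)
    (p' : El I.comul y (a, x')) (e' : El I.coone x' star),
    I.trAt T (I.actMul (𝟙 b) (I.oneCounit e' e) (𝟙 y) p) p' = I.corho e' p' ≫ I.rho e p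

/-- Second trace equation (vanishing, tensor), between 2-morphisms whose source has two loops `x`
and `z`, formed by two multiplications and their right adjoints. One of them applies the trace to
the inner loop `z` and then to the outer loop `x`; the other one reassociates both sides, slides the
multiplication of `x` and `z` around the loop, removes it by the counit of the adjunction, and
applies the trace once. -/
def VanishTensor (T : I.traceLoop ⟶ 𝟙 C) : Prop :=
  ∀ {a b x z y y' w v v' : C} (p : El I.mul (b, x) y) (q : El I.mul (y, z) w)
    (q' : El I.comul w (y', z)) (p' : El I.comul y' (a, x))
    (r : El I.mul (x, z) v) (s : El I.mul (b, v) w)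
    (r' : El I.comul v' (x, z)) (s' : El I.comul w (a, v')),
    I.Assoc p q r s → I.Coassoc p' q' r' s' →
    I.trAt T (I.actMul (𝟙 b) (𝟙 x) (I.trAt T q q') p) p' =
      I.trAt T (I.actMul (𝟙 b) (I.mulCounit r' r) (𝟙 w) s) s'

/-- Third trace equation (superposing), between 2-morphisms whose source is an identity wire beside
the loop. One of them applies the trace and then the unit of the adjunction of the multiplication;
the other one first applies this unit between the identity wire and the wire `y` inside the loop,
reassociates both sides, and then applies the trace. -/
def Superpose (T : I.traceLoop ⟶ 𝟙 C) : Prop :=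
  ∀ {a b c c' x y z w w' : C} (g : c' ⟶ c) (p : El I.mul (b, x) y) (p' : El I.comul y (a, x))
    (j : El I.mul (c, y) z) (j' : El I.comul z (c', y))
    (r : El I.mul (c, b) w) (s : El I.mul (w, x) z)
    (r' : El I.comul w' (c', a)) (s' : El I.comul z (w', x)),
    I.mulUnit g (𝟙 y) = pr j j' → I.Assoc r s p j → I.Coassoc r' s' p' j' →
    (pr (I.actMul (𝟙 c) (𝟙 b) (I.trAt T s s') r) r' : El (I.mul ≫ I.comul) (c, b) (c', a)) =
      I.mulUnit g (I.trAt T p p')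

end RightAdjointPseudomonoid

/-- An interpretation in `Prof` of the traced pseudomonoid presentation, with underlying object `C`:
the data of the right-adjoint pseudomonoid presentation, one further 2-morphism `Tr`, and three
further equations. -/
structure TracedPseudomonoid (C : Prof.{u}) extends RightAdjointPseudomonoid C where
  /-- The trace 2-morphism. -/
  Tr : toRightAdjointPseudomonoid.traceLoop ⟶ 𝟙 C
  vanishUnit : toRightAdjointPseudomonoid.VanishUnit Tr
  vanishTensor : toRightAdjointPseudomonoid.VanishTensor Tr
  superpose : toRightAdjointPseudomonoid.Superpose Tr

/-! ### Traced monoidal categories -/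

section Traced

open MonoidalCategory

variable (D : Type u) [SmallCategory D] [MonoidalCategory D]

/-- The operation of a (right) trace on a monoidal category, with the first two axiom families:
tightening and sliding. -/
structure TraceOperator where
  /-- The trace of `f : a ⊗ x ⟶ b ⊗ x`. -/
  tr {a b : D} (x : D) (f : a ⊗ x ⟶ b ⊗ x) : a ⟶ b
  tightening {a a' b b' x : D} (g : a' ⟶ a) (f : a ⊗ x ⟶ b ⊗ x) (h : b ⟶ b') :
    tr x ((g ▷ x) ≫ f ≫ (h ▷ x)) = g ≫ tr x f ≫ h
  sliding {a b x y : D} (f : a ⊗ x ⟶ b ⊗ y) (g : y ⟶ x) :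
    tr x (f ≫ (b ◁ g)) = tr y ((a ◁ g) ≫ f)

variable {D}

namespace TraceOperator

/-- Vanishing, unit. -/
def VanishUnit (τ : TraceOperator D) : Prop :=
  ∀ {a b : D} (f : a ⊗ 𝟙_ D ⟶ b ⊗ 𝟙_ D), τ.tr (𝟙_ D) f = (ρ_ a).inv ≫ f ≫ (ρ_ b).hom

/-- Vanishing, tensor. -/
def VanishTensor (τ : TraceOperator D) : Prop :=
  ∀ {a b x y : D} (f : a ⊗ (x ⊗ y) ⟶ b ⊗ (x ⊗ y)),
    τ.tr (x ⊗ y) f = τ.tr x (τ.tr y ((α_ a x y).hom ≫ f ≫ (α_ b x y).inv))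

/-- Superposing. -/
def Superpose (τ : TraceOperator D) : Prop :=
  ∀ {a b c d x : D} (g : c ⟶ d) (f : a ⊗ x ⟶ b ⊗ x),
    τ.tr x ((α_ c a x).hom ≫ (g ⊗ₘ f) ≫ (α_ d b x).inv) = g ⊗ₘ τ.tr x f

end TraceOperator

variable (D) in
/-- A (right) trace on a monoidal category. -/
structure RightTrace extends TraceOperator D where
  vanishUnit : toTraceOperator.VanishUnit
  vanishTensor : toTraceOperator.VanishTensor
  superpose : toTraceOperator.Superpose

/-- A monoidal functor between categories with a trace preserves the traces. -/
def PreservesTrace {D' : Type u} [SmallCategory D'] [MonoidalCategory D'] (G : D ⥤ D') [G.Monoidal]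
    (t : RightTrace D) (t' : RightTrace D') : Prop :=
  ∀ {a b : D} (x : D) (f : a ⊗ x ⟶ b ⊗ x),
    G.map (t.tr x f) =
      t'.tr (G.obj x) (Functor.LaxMonoidal.μ G a x ≫ G.map f ≫ Functor.OplaxMonoidal.δ G b x)

end Traced

/-! ### Cauchy completions -/

/-- The covariant embedding of the functor is an equivalence in `Prof`. -/
def IsProfEquivalence {C D : Prof.{u}} (F : C ⥤ D) : Prop :=
  ∃ e : Bicategory.Equivalence C D, Nonempty (e.hom ≅ companion F)

/-- The functor `F : C ⥤ D` is a Cauchy completion: idempotents split in `D`, and `F` is an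
equivalence in `Prof`. If `C` is Cauchy complete, `F` may be the identity. -/
structure IsCauchyCompletion {C D : Prof.{u}} (F : C ⥤ D) : Prop where
  complete : IsIdempotentComplete D
  equivalence : IsProfEquivalence F

/-! ### The correspondence -/

section Correspondence

open MonoidalCategory

variable {C D : Prof.{u}}

/-- `MonoidalRealization F I` says that the interpretation `I` is the one given by the monoidal
category `D`, restricted along `F : C ⥤ D` (where `F` is the identity, or a Cauchy completion): the
multiplication is `(a, b; c) ↦ D(F c, F a ⊗ F b)`, the unit is `c ↦ D(F c, 𝟙_)`, their right
adjoints are `(c; a, b) ↦ D(F a ⊗ F b, F c)` and `c ↦ D(𝟙_, F c)`, the units of the adjunctions are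
given by the tensor product of morphisms, the counits by composition, and the associativity and unit
2-morphisms by composition with the associator and the unitors of `D`. -/
structure MonoidalRealization (F : C ⥤ D) [MonoidalCategory D] (I : RightAdjointPseudomonoid C) where
  mulIso : (show Profunctor.{u} (C × C) C from I.mul) ≅
    (tensor D).toProfunctor.whiskerLeft₂ (F.prod F) F
  comulIso : (show Profunctor.{u} C (C × C) from I.comul) ≅
    (tensor D).toProfunctorRev.whiskerLeft₂ F (F.prod F)
  oneIso : (show Profunctor.{u} (Discrete PUnit.{u + 1}) C from I.one) ≅
    ((Functor.const (Discrete PUnit.{u + 1})).obj (𝟙_ D)).toProfunctor.whiskerLeft₂ (𝟭 _) F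
  cooneIso : (show Profunctor.{u} C (Discrete PUnit.{u + 1}) from I.coone) ≅
    ((Functor.const (Discrete PUnit.{u + 1})).obj (𝟙_ D)).toProfunctorRev.whiskerLeft₂ F (𝟭 _)
  mul_unit : ∀ {a a' b b' x : C} (f : a' ⟶ a) (g : b' ⟶ b) (j : El I.mul (a, b) x)
    (j' : El I.comul x (a', b')), I.mulUnit f g = pr j j' →
    (app comulIso.hom j' : F.obj a' ⊗ F.obj b' ⟶ F.obj x) ≫
      (app mulIso.hom j : F.obj x ⟶ F.obj a ⊗ F.obj b) = F.map f ⊗ₘ F.map g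
  mul_counit : ∀ {a b x y : C} (q : El I.comul y (a, b)) (p : El I.mul (a, b) x),
    F.map (I.mulCounit q p) = (app mulIso.hom p : F.obj x ⟶ F.obj a ⊗ F.obj b) ≫
      (app comulIso.hom q : F.obj a ⊗ F.obj b ⟶ F.obj y)
  one_unit : ∀ {x : C} (e : El I.one star x) (e' : El I.coone x star), I.oneUnit = pr e e' →
    (app cooneIso.hom e' : 𝟙_ D ⟶ F.obj x) ≫ (app oneIso.hom e : F.obj x ⟶ 𝟙_ D) = 𝟙 (𝟙_ D)
  one_counit : ∀ {x y : C} (q : El I.coone y star) (p : El I.one star x),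
    F.map (I.oneCounit q p) = (app oneIso.hom p : F.obj x ⟶ 𝟙_ D) ≫
      (app cooneIso.hom q : 𝟙_ D ⟶ F.obj y)
  assoc : ∀ {a b c d x y : C} (p : El I.mul (a, b) x) (q : El I.mul (x, c) d)
    (r : El I.mul (b, c) y) (s : El I.mul (a, y) d), I.Assoc p q r s →
    (app mulIso.hom q : F.obj d ⟶ F.obj x ⊗ F.obj c) ≫
      ((app mulIso.hom p : F.obj x ⟶ F.obj a ⊗ F.obj b) ▷ F.obj c) ≫
        (α_ (F.obj a) (F.obj b) (F.obj c)).hom =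
    (app mulIso.hom s : F.obj d ⟶ F.obj a ⊗ F.obj y) ≫
      (F.obj a ◁ (app mulIso.hom r : F.obj y ⟶ F.obj b ⊗ F.obj c))
  lunit : ∀ {x b c : C} (e : El I.one star x) (p : El I.mul (x, b) c),
    F.map (I.lam e p) = (app mulIso.hom p : F.obj c ⟶ F.obj x ⊗ F.obj b) ≫
      ((app oneIso.hom e : F.obj x ⟶ 𝟙_ D) ▷ F.obj b) ≫ (λ_ (F.obj b)).hom
  runit : ∀ {x b c : C} (e : El I.one star x) (p : El I.mul (b, x) c),
    F.map (I.rho e p) = (app mulIso.hom p : F.obj c ⟶ F.obj b ⊗ F.obj x) ≫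
      (F.obj b ◁ (app oneIso.hom e : F.obj x ⟶ 𝟙_ D)) ≫ (ρ_ (F.obj b)).hom

/-- Under a realization, the 2-morphism `T` of profunctors is given by the trace operation `τ`: it
sends the class of `f : F a ⊗ F x ⟶ F b ⊗ F x` to the trace of `f`. -/
def MonoidalRealization.TraceCompat {F : C ⥤ D} [MonoidalCategory D]
    {I : RightAdjointPseudomonoid C} (R : MonoidalRealization F I) (T : I.traceLoop ⟶ 𝟙 C)
    (τ : TraceOperator D) : Prop :=
  ∀ {a b x y : C} (p : El I.mul (b, x) y) (q : El I.comul y (a, x)),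
    F.map (I.trAt T p q) = τ.tr (F.obj x)
      ((app R.comulIso.hom q : F.obj a ⊗ F.obj x ⟶ F.obj y) ≫
        (app R.mulIso.hom p : F.obj y ⟶ F.obj b ⊗ F.obj x))

/-- An equivalence of interpretations of the traced pseudomonoid presentation over a functor `K`
between the underlying categories: isomorphisms between the generating 1-morphisms of `I` and the
restrictions along `K` of those of `I'`, compatible with all the generating 2-morphisms. (It is an
equivalence if `K` is an equivalence in `Prof`.) -/
@[ext]
structure InterpretationEquiv {C C' : Prof.{u}} (K : C ⥤ C') (I : TracedPseudomonoid C)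
    (I' : TracedPseudomonoid C') where
  mulIso : (show Profunctor.{u} (C × C) C from I.mul) ≅
    (show Profunctor.{u} (C' × C') C' from I'.mul).whiskerLeft₂ (K.prod K) K
  comulIso : (show Profunctor.{u} C (C × C) from I.comul) ≅
    (show Profunctor.{u} C' (C' × C') from I'.comul).whiskerLeft₂ K (K.prod K)
  oneIso : (show Profunctor.{u} (Discrete PUnit.{u + 1}) C from I.one) ≅
    (show Profunctor.{u} (Discrete PUnit.{u + 1}) C' from I'.one).whiskerLeft₂ (𝟭 _) K
  cooneIso : (show Profunctor.{u} C (Discrete PUnit.{u + 1}) from I.coone) ≅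
    (show Profunctor.{u} C' (Discrete PUnit.{u + 1}) from I'.coone).whiskerLeft₂ K (𝟭 _)
  mul_unit : ∀ {a a' b b' x : C} (f : a' ⟶ a) (g : b' ⟶ b) (j : El I.mul (a, b) x)
    (j' : El I.comul x (a', b')), I.mulUnit f g = pr j j' →
    I'.mulUnit (K.map f) (K.map g) =
      pr (app mulIso.hom j : El I'.mul (K.obj a, K.obj b) (K.obj x))
        (app comulIso.hom j' : El I'.comul (K.obj x) (K.obj a', K.obj b'))
  mul_counit : ∀ {a b x y : C} (q : El I.comul y (a, b)) (p : El I.mul (a, b) x),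
    K.map (I.mulCounit q p) =
      I'.mulCounit (app comulIso.hom q : El I'.comul (K.obj y) (K.obj a, K.obj b))
        (app mulIso.hom p : El I'.mul (K.obj a, K.obj b) (K.obj x))
  one_unit : ∀ {x : C} (e : El I.one star x) (e' : El I.coone x star), I.oneUnit = pr e e' →
    I'.oneUnit = pr (app oneIso.hom e : El I'.one star (K.obj x))
      (app cooneIso.hom e' : El I'.coone (K.obj x) star)
  one_counit : ∀ {x y : C} (q : El I.coone y star) (p : El I.one star x),
    K.map (I.oneCounit q p) =
      I'.oneCounit (app cooneIso.hom q : El I'.coone (K.obj y) star)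
        (app oneIso.hom p : El I'.one star (K.obj x))
  assoc : ∀ {a b c d x y : C} (p : El I.mul (a, b) x) (q : El I.mul (x, c) d)
    (r : El I.mul (b, c) y) (s : El I.mul (a, y) d), I.Assoc p q r s →
    I'.Assoc (app mulIso.hom p : El I'.mul (K.obj a, K.obj b) (K.obj x))
      (app mulIso.hom q : El I'.mul (K.obj x, K.obj c) (K.obj d))
      (app mulIso.hom r : El I'.mul (K.obj b, K.obj c) (K.obj y))
      (app mulIso.hom s : El I'.mul (K.obj a, K.obj y) (K.obj d))
  lunit : ∀ {x b c : C} (e : El I.one star x) (p : El I.mul (x, b) c),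
    K.map (I.lam e p) = I'.lam (app oneIso.hom e : El I'.one star (K.obj x))
      (app mulIso.hom p : El I'.mul (K.obj x, K.obj b) (K.obj c))
  runit : ∀ {x b c : C} (e : El I.one star x) (p : El I.mul (b, x) c),
    K.map (I.rho e p) = I'.rho (app oneIso.hom e : El I'.one star (K.obj x))
      (app mulIso.hom p : El I'.mul (K.obj b, K.obj x) (K.obj c))
  trace : ∀ {a b x y : C} (p : El I.mul (b, x) y) (q : El I.comul y (a, x)),
    K.map (I.trAt I.Tr p q) =
      I'.trAt I'.Tr (app mulIso.hom p : El I'.mul (K.obj b, K.obj x) (K.obj y))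
        (app comulIso.hom q : El I'.comul (K.obj y) (K.obj a, K.obj x))

/-- An equivalence `e` of interpretations over `K` and a monoidal structure on a functor `G` between
the realizing monoidal categories are given by the same maps. -/
def InterpretationEquiv.Compat {C C' D D' : Prof.{u}} [MonoidalCategory D] [MonoidalCategory D']
    {K : C ⥤ C'} {F : C ⥤ D} {F' : C' ⥤ D'} {G : D ⥤ D'} [G.Monoidal]
    {I : TracedPseudomonoid C} {I' : TracedPseudomonoid C'} (e : InterpretationEquiv K I I')
    (R : MonoidalRealization F I.toRightAdjointPseudomonoid)
    (R' : MonoidalRealization F' I'.toRightAdjointPseudomonoid) (θ : F ⋙ G ≅ K ⋙ F') : Prop :=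
  (∀ {a b c : C} (p : El I.mul (a, b) c),
    (app R'.mulIso.hom (app e.mulIso.hom p : El I'.mul (K.obj a, K.obj b) (K.obj c)) :
      F'.obj (K.obj c) ⟶ F'.obj (K.obj a) ⊗ F'.obj (K.obj b)) =
    θ.inv.app c ≫ G.map (app R.mulIso.hom p : F.obj c ⟶ F.obj a ⊗ F.obj b) ≫
      Functor.OplaxMonoidal.δ G (F.obj a) (F.obj b) ≫ (θ.hom.app a ⊗ₘ θ.hom.app b)) ∧
  (∀ {c : C} (p : El I.one star c),
    (app R'.oneIso.hom (app e.oneIso.hom p : El I'.one star (K.obj c)) :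
      F'.obj (K.obj c) ⟶ 𝟙_ D') =
    θ.inv.app c ≫ G.map (app R.oneIso.hom p : F.obj c ⟶ 𝟙_ D) ≫ Functor.OplaxMonoidal.η G)

end Correspondence

/-! The bridge between the two sides is the classical fact that a profunctor into `C` with a right
adjoint becomes a functor after Cauchy completion. Along a Cauchy completion `F : C ⥤ D`, a left
adjoint `P` has the form `P(a; b) ≅ D(F b, X a)` for a functor `X`, and its right adjoint is `D(X a,
F b)` (`exists_rep_of_adjunction`): the unit of the adjunction at `a` is a dual basis, it yields an
idempotent, and `X a` splits the image of this idempotent in `D`. Equivalences in `Prof` that come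
from functors are exactly the fully faithful functors for which every object of the target is a
retract of an image object. Along such a functor, natural transformations extend uniquely, and
functors with idempotent complete target extend. Hence the multiplication and the unit of a
right-adjoint pseudomonoid become a tensor product and a unit object on all of `D`, and the
structural 2-morphisms become an associator and unitors (`exists_monoidalRealization`).

Once all generators are represented, equations between 2-morphisms become equations in `D`. The
coend of a represented and a corepresented profunctor collapses by co-Yoneda: the class of `(p, q)`
is the composite morphism (`compMor_bijective`). Mates are read off from the counits, which are
composition in `D` (`CounitCompat.conjugateEquiv`); so coassociativity is precomposition with the
inverse associator.

An element of the loop is a morphism `F a ⊗ F x ⟶ F b ⊗ F x`, up to sliding morphisms of `C` around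
`x`. A 2-morphism from the loop to the identity is therefore an operation with values in `D(F a, F
b)` which satisfies sliding (it is well defined on the coend) and tightening (it is natural in the
open wires). These two axioms force its extension from image objects to their retracts. Each of the
three equations of the presentation is the trace axiom of the same name for those morphisms that are
factored into elements; every morphism between the relevant tensor products factors in this way.

For equivalences of interpretations, both sides are translated into realizations of one
interpretation `I` along the single functor `F ⋙ G`. An equivalence pulls the realization of `I'`
back along `θ`, and a monoidal structure on `G` pushes the realization of `I` forward. Representing
functors are unique up to unique isomorphism, so comparing realizations yields the unique monoidal
structure (`existsUnique_mapCompat`) and the unique equivalence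
(`existsUnique_interpretationEquiv`). The trace is preserved because a 2-morphism determines its
trace operation. -/

set_option linter.unusedSectionVars false
set_option linter.unusedSimpArgs false

/-! ### Extension along functors whose image contains every object up to retracts -/

namespace CategoryTheory

/-- Every object of the target is a retract of an object in the image. -/
class Functor.RetractDense {A B : Type*} [Category* A] [Category* B] (F : A ⥤ B) : Prop where
  exists_retract : ∀ b : B, ∃ a : A, Nonempty (Retract b (F.obj a))

namespace Functor

section
variable {A B E : Type*} [Category* A] [Category* B] [Category* E]

instance : (𝟭 A).RetractDense := ⟨fun a => ⟨a, ⟨.refl a⟩⟩⟩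

instance {A' B' : Type*} [Category* A'] [Category* B'] (F : A ⥤ B) (F' : A' ⥤ B')
    [F.RetractDense] [F'.RetractDense] : (F.prod F').RetractDense where
  exists_retract b := by
    obtain ⟨a, ⟨r⟩⟩ := RetractDense.exists_retract (F := F) b.1
    obtain ⟨a', ⟨r'⟩⟩ := RetractDense.exists_retract (F := F') b.2
    exact ⟨(a, a'), ⟨⟨(r.i, r'.i), (r.r, r'.r), Prod.ext r.retract r'.retract⟩⟩⟩

instance {A' B' : Type*} [Category* A'] [Category* B'] (F : A ⥤ B) (F' : A' ⥤ B')
    [F.Full] [F'.Full] : (F.prod F').Full where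
  map_surjective f := ⟨(F.preimage f.1, F'.preimage f.2), Prod.ext (F.map_preimage _) (F'.map_preimage _)⟩

instance {A' B' : Type*} [Category* A'] [Category* B'] (F : A ⥤ B) (F' : A' ⥤ B')
    [F.Faithful] [F'.Faithful] : (F.prod F').Faithful where
  map_injective {x y f g} h := by
    have h1 := congrArg (fun k : (F.obj x.1 ⟶ F.obj y.1) × (F'.obj x.2 ⟶ F'.obj y.2) => k.1) h
    have h2 := congrArg (fun k : (F.obj x.1 ⟶ F.obj y.1) × (F'.obj x.2 ⟶ F'.obj y.2) => k.2) h
    exact Prod.ext (F.map_injective h1) (F'.map_injective h2)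

variable (F : A ⥤ B) [F.RetractDense]

/-- An object of the source whose image has the given object as a retract. -/
noncomputable def cover (b : B) : A := (RetractDense.exists_retract (F := F) b).choose

/-- The given object as a retract of the image of its cover. -/
noncomputable def coverRetract (b : B) : Retract b (F.obj (F.cover b)) :=
  (RetractDense.exists_retract (F := F) b).choose_spec.some

/-- Among the morphisms `v` is the retraction of an image object onto `X`; any functor sends it to a
split epimorphism. -/
lemma retractDense_hom_ext (G : B ⥤ E) {X : B} {Y : E} {f g : G.obj X ⟶ Y}
    (h : ∀ (a : A) (v : F.obj a ⟶ X), G.map v ≫ f = G.map v ≫ g) : f = g := by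
  rw [← cancel_epi (((F.coverRetract X).map G).r)]
  exact h _ _

/-- A morphism out of the image of `X` is given by its composites with all morphisms from objects in the
image of `F` to `X`. -/
noncomputable def retractDenseDesc (G : B ⥤ E) {X : B} {Y : E}
    (φ : ∀ {a : A}, (F.obj a ⟶ X) → (G.obj (F.obj a) ⟶ Y)) : G.obj X ⟶ Y :=
  G.map (F.coverRetract X).i ≫ φ (F.coverRetract X).r

/-- By fullness `v` followed by the section into the cover comes from a morphism `k` of the source,
and naturality in `k` returns the value at `v`. The result is thus independent of the chosen
retract. -/
lemma map_comp_retractDenseDesc [F.Full] (G : B ⥤ E) {X : B} {Y : E}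
    (φ : ∀ {a : A}, (F.obj a ⟶ X) → (G.obj (F.obj a) ⟶ Y))
    (nat : ∀ {a a' : A} (k : a' ⟶ a) (v : F.obj a ⟶ X), φ (F.map k ≫ v) = G.map (F.map k) ≫ φ v)
    {a : A} (v : F.obj a ⟶ X) : G.map v ≫ F.retractDenseDesc G φ = φ v := by
  rw [retractDenseDesc, ← Category.assoc, ← G.map_comp,
    ← F.map_preimage (v ≫ (F.coverRetract X).i), ← nat, F.map_preimage, Category.assoc,
    Retract.retract, Category.comp_id]

lemma retractDense_natTrans_ext {H H' : B ⥤ E} {α β : H ⟶ H'}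
    (h : ∀ a, α.app (F.obj a) = β.app (F.obj a)) : α = β := by
  ext b
  refine F.retractDense_hom_ext H fun a v => ?_
  rw [α.naturality, β.naturality, h]

/-- The extension of a natural transformation along a functor. -/
noncomputable def extendNatTrans [F.Full] {H H' : B ⥤ E} (α : F ⋙ H ⟶ F ⋙ H') : H ⟶ H' where
  app b := F.retractDenseDesc H (fun {a} v => α.app a ≫ H'.map v)
  naturality b b' f := by
    refine F.retractDense_hom_ext H fun a v => ?_
    rw [← Category.assoc, ← H.map_comp, map_comp_retractDenseDesc, ← Category.assoc,
      map_comp_retractDenseDesc, Category.assoc, H'.map_comp]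
    all_goals
      intro a a' k v
      rw [H'.map_comp]
      exact (α.naturality_assoc k _).symm

@[simp] lemma extendNatTrans_app_obj [F.Full] {H H' : B ⥤ E} (α : F ⋙ H ⟶ F ⋙ H') (a : A) :
    (F.extendNatTrans α).app (F.obj a) = α.app a := by
  have := F.map_comp_retractDenseDesc H (X := F.obj a) (fun {a} v => α.app a ≫ H'.map v) (by
    intro a a' k v
    rw [H'.map_comp]
    exact (α.naturality_assoc k _).symm) (𝟙 _)
  rw [H.map_id, Category.id_comp] at this
  exact this.trans (by rw [H'.map_id]; exact Category.comp_id _)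

/-- The extension of a natural isomorphism along a functor. -/
noncomputable def extendNatIso [F.Full] {H H' : B ⥤ E} (α : F ⋙ H ≅ F ⋙ H') : H ≅ H' where
  hom := F.extendNatTrans α.hom
  inv := F.extendNatTrans α.inv
  hom_inv_id := F.retractDense_natTrans_ext fun a => by simp
  inv_hom_id := F.retractDense_natTrans_ext fun a => by simp

/-- An object `b` is cut out of its cover by an idempotent, which comes from the source of `F`. The
extension sends `b` to a splitting of the image of this idempotent under `T`. -/
lemma exists_extension [F.Full] [F.Faithful] [IsIdempotentComplete E] (T : A ⥤ E) :
    ∃ T' : B ⥤ E, Nonempty (F ⋙ T' ≅ T) := by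
  -- `d` is multiplicative but sends an identity only to an idempotent; splitting the images of
  -- these idempotents restores the identities.
  let d (b b' : B) (f : b ⟶ b') : F.cover b ⟶ F.cover b' :=
    F.preimage ((F.coverRetract b).r ≫ f ≫ (F.coverRetract b').i)
  have hdd {b b' b'' : B} (f : b ⟶ b') (g : b' ⟶ b'') : d b b' f ≫ d b' b'' g = d b b'' (f ≫ g) :=
    F.map_injective (by simp [d])
  choose X i p hip hpi using fun b => IsIdempotentComplete.idempotents_split _ (T.map (d b b (𝟙 b)))
    (by rw [← T.map_comp, hdd, Category.comp_id])
  let T' : B ⥤ E :=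
    { obj := X
      map f := i _ ≫ T.map (d _ _ f) ≫ p _
      map_id b := by
        rw [← hpi]
        simp [hip]
      map_comp {b b' b''} f g := by
        have h1 : T.map (d _ _ f) ≫ p b' ≫ i b' ≫ T.map (d _ _ g) = T.map (d _ _ (f ≫ g)) := by
          rw [reassoc_of% (hpi b'), ← T.map_comp, ← T.map_comp, hdd, hdd, Category.id_comp]
        simp only [Category.assoc]
        rw [reassoc_of% h1] }
  -- For `b = F.obj a` the idempotent is also split by `a` itself, and any two splittings are
  -- isomorphic.
  let s (a : A) : a ⟶ F.cover (F.obj a) := F.preimage (F.coverRetract (F.obj a)).i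
  let r (a : A) : F.cover (F.obj a) ⟶ a := F.preimage (F.coverRetract (F.obj a)).r
  have hsr (a : A) : s a ≫ r a = 𝟙 a := F.map_injective (by simp [s, r])
  have hrs (a : A) : r a ≫ s a = d _ _ (𝟙 (F.obj a)) := F.map_injective (by simp [s, r, d])
  refine ⟨T', ⟨NatIso.ofComponents (fun a =>
    { hom := i (F.obj a) ≫ T.map (r a)
      inv := T.map (s a) ≫ p (F.obj a)
      hom_inv_id := ?_
      inv_hom_id := ?_ }) ?_⟩⟩
  · change _ = 𝟙 (X _)
    have h1 : T.map (r a) ≫ T.map (s a) = p _ ≫ i _ := by rw [← T.map_comp, hrs, hpi]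
    rw [Category.assoc, reassoc_of% h1, reassoc_of% (hip (F.obj a)), hip]
  · rw [Category.assoc, reassoc_of% (hpi (F.obj a)), ← hrs, T.map_comp, Category.assoc,
      ← T.map_comp, ← T.map_comp_assoc, hsr]
    simp
  · intro a a' f
    have h1 : d _ _ (F.map f) = r a ≫ f ≫ s a' := F.map_injective (by simp [s, r, d])
    change (i _ ≫ T.map (d _ _ (F.map f)) ≫ p _) ≫ i _ ≫ T.map (r a') = (i _ ≫ T.map (r a)) ≫ T.map f
    simp only [Category.assoc]
    rw [reassoc_of% (hpi (F.obj a')), ← hrs, h1]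
    simp only [← T.map_comp, Category.assoc]
    rw [hsr, reassoc_of% (hsr a'), Category.comp_id]

end

end Functor

end CategoryTheory

/-! ### Represented and corepresented profunctors -/

namespace Prof

section Representations
variable {A B C A' B' D E D' : Type u} [SmallCategory A] [SmallCategory B] [SmallCategory C]
  [SmallCategory A'] [SmallCategory B'] [SmallCategory D] [SmallCategory E] [SmallCategory D']

lemma app_hom_inv {P Q : Profunctor.{u} A B} (e : P ≅ Q) {a : A} {b : B} (p : El P a b) :
    app e.inv (app e.hom p) = p := by
  rw [← app_comp, e.hom_inv_id, app_id]

lemma app_inv_hom {P Q : Profunctor.{u} A B} (e : P ≅ Q) {a : A} {b : B} (p : El Q a b) :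
    app e.hom (app e.inv p) = p := by
  rw [← app_comp, e.inv_hom_id, app_id]

lemma app_hom_bijective {P Q : Profunctor.{u} A B} (e : P ≅ Q) (a : A) (b : B) :
    Function.Bijective (app e.hom (a := a) (b := b)) :=
  Function.bijective_iff_has_inverse.2 ⟨fun p => app e.inv p, app_hom_inv e, app_inv_hom e⟩

/-- A natural bijection between a profunctor and `(a; b) ↦ D(F b, X a)`. -/
structure Rep (P : Profunctor.{u} A B) (F : B ⥤ D) (X : A ⥤ D) where
  /-- The morphism which represents an element. -/
  mor {a : A} {b : B} (p : El P a b) : F.obj b ⟶ X.obj a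
  bijective (a : A) (b : B) : Function.Bijective (mor (a := a) (b := b))
  mor_act {a a' : A} {b b' : B} (f : a ⟶ a') (g : b' ⟶ b) (p : El P a b) :
    mor (act P f g p) = F.map g ≫ mor p ≫ X.map f

/-- A natural bijection between a profunctor and `(b; a) ↦ D(X a, F b)`. -/
structure Corep (P : Profunctor.{u} B A) (F : B ⥤ D) (X : A ⥤ D) where
  /-- The morphism which represents an element. -/
  mor {a : A} {b : B} (p : El P b a) : X.obj a ⟶ F.obj b
  bijective (a : A) (b : B) : Function.Bijective (mor (a := a) (b := b))
  mor_act {a a' : A} {b b' : B} (f : b ⟶ b') (g : a' ⟶ a) (p : El P b a) :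
    mor (act P f g p) = X.map g ≫ mor p ≫ F.map f

namespace Rep

variable {P Q R : Profunctor.{u} A B} {F : B ⥤ D} {X Y Z : A ⥤ D}

/-- The element represented by a morphism. -/
noncomputable def elt (r : Rep P F X) {a : A} {b : B} (f : F.obj b ⟶ X.obj a) : El P a b :=
  ((r.bijective a b).2 f).choose

@[simp] lemma mor_elt (r : Rep P F X) {a : A} {b : B} (f : F.obj b ⟶ X.obj a) :
    r.mor (r.elt f) = f := ((r.bijective a b).2 f).choose_spec

lemma ext (r : Rep P F X) {a : A} {b : B} {p q : El P a b} (h : r.mor p = r.mor q) : p = q :=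
  (r.bijective a b).1 h

@[simp] lemma elt_mor (r : Rep P F X) {a : A} {b : B} (p : El P a b) : r.elt (r.mor p) = p :=
  r.ext (r.mor_elt _)

lemma exists_elt (r : Rep P F X) {a : A} {b : B} (f : F.obj b ⟶ X.obj a) :
    ∃ p : El P a b, r.mor p = f := (r.bijective a b).2 f

/-- The identity profunctor is represented by a fully faithful functor. -/
def id (F : B ⥤ D) [F.Full] [F.Faithful] : Rep (Profunctor.id (C := B)) F F where
  mor {a b} (p : b ⟶ a) := F.map p
  bijective a b := ⟨fun _ _ h => F.map_injective h, fun f => F.map_surjective f⟩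
  mor_act f g (p : _ ⟶ _) :=
    (by simp : F.map (g ≫ p ≫ f) = F.map g ≫ F.map p ≫ F.map f)

/-- The profunctor of a functor is represented by the functor. -/
def companion (K : A ⥤ B) (F : B ⥤ D) [F.Full] [F.Faithful] :
    Rep K.toProfunctor F (K ⋙ F) where
  mor {a b} (p : b ⟶ K.obj a) := F.map p
  bijective a b := ⟨fun _ _ h => F.map_injective h, fun f => F.map_surjective f⟩
  mor_act f g (p : _ ⟶ _) :=
    (by simp : F.map (g ≫ p ≫ K.map f) = F.map g ≫ F.map p ≫ F.map (K.map f))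

/-- The representation given by an isomorphism with a restriction of the profunctor of a functor. -/
def ofIso {G : A ⥤ A'} {H : A' ⥤ D} (e : P ≅ H.toProfunctor.whiskerLeft₂ G F) :
    Rep P F (G ⋙ H) where
  mor p := app e.hom p
  bijective a b := app_hom_bijective e _ _
  mor_act f g p := by
    rw [app_act]
    rfl

/-- The isomorphism given by a representation. -/
noncomputable def toIso {G : A ⥤ A'} {H : A' ⥤ D} (r : Rep P F (G ⋙ H)) :
    P ≅ H.toProfunctor.whiskerLeft₂ G F where
  hom := homMk (fun _ _ p => r.mor p) (fun f g p => r.mor_act f g p)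
  inv := homMk (fun a b f => r.elt (a := a) (b := b) f) (fun f g p => r.ext
    ((r.mor_elt _).trans ((r.mor_act f g _).trans (congrArg (fun k => F.map g ≫ k ≫ (G ⋙ H).map f) (r.mor_elt p))).symm))
  hom_inv_id := hom_ext fun _ _ p => r.elt_mor p
  inv_hom_id := hom_ext fun a b f => r.mor_elt (a := a) (b := b) f

/-- Transport of a representation along isomorphisms. -/
def congr (r : Rep P F X) (e : Q ≅ P) (i : X ≅ Y) : Rep Q F Y where
  mor p := r.mor (app e.hom p) ≫ i.hom.app _
  bijective a b := by
    refine Function.bijective_iff_has_inverse.2 ⟨fun f => app e.inv (r.elt (f ≫ i.inv.app _)), fun p => ?_,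
      fun f => ?_⟩
    · simp only [Category.assoc, Iso.hom_inv_id_app, Category.comp_id, r.elt_mor, app_hom_inv]
    · simp [app_inv_hom]
  mor_act f g p := by
    rw [app_act, r.mor_act]
    simp

/-- The external product of representations. -/
def tens {P' : Profunctor.{u} A' B'} {F' : B' ⥤ D'} {X' : A' ⥤ D'} (r : Rep P F X)
    (r' : Rep P' F' X') : Rep (Prof.tens P P') (F.prod F') (X.prod X') where
  mor p := (r.mor p.1, r'.mor p.2)
  bijective a b := by
    refine Function.bijective_iff_has_inverse.2
      ⟨fun f => (r.elt f.1, r'.elt f.2), fun p => Prod.ext ?_ ?_, fun p => Prod.ext ?_ ?_⟩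
    · exact r.elt_mor _
    · exact r'.elt_mor _
    · exact r.mor_elt _
    · exact r'.mor_elt _
  mor_act f g p := by
    obtain ⟨p, p'⟩ := p
    rw [act_tens]
    exact Prod.ext (r.mor_act _ _ _) (r'.mor_act _ _ _)

/-- The representation of a composite. -/
def comp {Q : Profunctor.{u} B C} {J : B ⥤ E} {X : A ⥤ E} {F : C ⥤ D} {H : E ⥤ D}
    [J.Full] [J.RetractDense] (r : Rep P J X) (s : Rep Q F (J ⋙ H)) :
    Rep (Prof.comp P Q) F (X ⋙ H) where
  mor := Quot.lift (fun t => s.mor t.2.2 ≫ H.map (r.mor t.2.1)) (by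
    rintro _ _ ⟨g, p, q⟩
    simp [r.mor_act, s.mor_act])
  bijective a c := by
    let ρ := J.coverRetract (X.obj a)
    -- Normal form of a class: `r.mor p` factors through the retraction of the cover of `X.obj a`,
    -- and sliding the other factor over to `q` leaves a pair that depends only on the composite
    -- morphism.
    have key {b : B} (p : El P a b) (q : El Q b c) : pair p q = pair (r.elt ρ.r)
        (s.elt (a := J.cover (X.obj a)) (b := c) ((s.mor q ≫ H.map (r.mor p)) ≫ H.map ρ.i)) := by
      have hp : p = act P (𝟙 a) (J.preimage (r.mor p ≫ ρ.i)) (r.elt ρ.r) := r.ext (by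
        rw [r.mor_act]
        simp)
      conv_lhs => rw [hp]
      rw [pair_slide]
      congr 1
      refine s.ext ?_
      rw [s.mor_act, s.mor_elt]
      simp
    constructor
    · intro x y h
      obtain ⟨b, p, q, rfl⟩ := pair_surj x
      obtain ⟨b', p', q', rfl⟩ := pair_surj y
      rw [key p q, key p' q']
      exact congrArg (fun z => pair (r.elt ρ.r)
        (s.elt (a := J.cover (X.obj a)) (b := c) (z ≫ H.map ρ.i))) h
    · intro f
      refine ⟨pair (r.elt ρ.r) (s.elt (a := J.cover (X.obj a)) (b := c) (f ≫ H.map ρ.i)), ?_⟩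
      change s.mor _ ≫ H.map (r.mor _) = f
      rw [r.mor_elt, s.mor_elt, Category.assoc, ← H.map_comp, ρ.retract]
      simp
  mor_act f g x := by
    obtain ⟨b, p, q, rfl⟩ := pair_surj x
    rw [act_pair]
    change s.mor _ ≫ H.map (r.mor _) = F.map g ≫ (s.mor _ ≫ H.map (r.mor _)) ≫ H.map (X.map f)
    rw [r.mor_act, s.mor_act]
    simp

/-- Representations turn natural transformations of profunctors into natural transformations of
functors. -/
noncomputable def natTrans [F.Full] [F.RetractDense] (r : Rep P F X) (s : Rep Q F Y) (η : P ⟶ Q) :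
    X ⟶ Y where
  app a := F.retractDenseDesc (𝟭 _) (X := X.obj a) (fun {_} v => s.mor (app η (r.elt v)))
  naturality a a' f := by
    refine F.retractDense_hom_ext (𝟭 _) fun b v => ?_
    -- Naturality in the contravariant variable makes the value at `v` compatible with
    -- `map_comp_retractDenseDesc`; the covariant variable then gives naturality in `a`.
    have h (a : A) {b b' : B} (k : b' ⟶ b) (v : F.obj b ⟶ X.obj a) :
        s.mor (app η (r.elt (F.map k ≫ v))) =
          (𝟭 D).map (F.map k) ≫ s.mor (app η (r.elt v)) := by
      rw [Functor.id_map]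
      have h1 : r.elt (F.map k ≫ v) = act P (𝟙 _) k (r.elt v) := r.ext (by
        rw [r.mor_act]
        simp)
      rw [h1, app_act, s.mor_act]
      simp
    rw [← Category.assoc, ← Category.assoc, F.map_comp_retractDenseDesc (𝟭 _) (fun {_} v => s.mor (app η (r.elt v))) (h a)]
    have h2 := F.map_comp_retractDenseDesc (𝟭 _) (fun {_} v => s.mor (app η (r.elt v))) (h a') (v ≫ X.map f)
    simp only [Functor.id_map] at h2 ⊢
    rw [h2]
    have h1 : r.elt (v ≫ X.map f) = act P f (𝟙 _) (r.elt v) := r.ext (by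
        rw [r.mor_act]
        simp)
    rw [h1, app_act, s.mor_act]
    simp

/-- Yoneda: for fixed `a`, the morphisms `r.mor p` are all morphisms from image objects to `X.obj
a`, so this property determines `natTrans`. -/
lemma mor_comp_natTrans [F.Full] [F.RetractDense] (r : Rep P F X) (s : Rep Q F Y) (η : P ⟶ Q)
    {a : A} {b : B} (p : El P a b) :
    r.mor p ≫ (r.natTrans s η).app a = s.mor (app η p) := by
  have h := F.map_comp_retractDenseDesc (𝟭 _) (X := X.obj a) (fun {_} v => s.mor (app η (r.elt v))) (by
    intro b b' k v
    rw [Functor.id_map]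
    have h1 : r.elt (F.map k ≫ v) = act P (𝟙 _) k (r.elt v) := r.ext (by
      rw [r.mor_act]
      simp)
    rw [h1, app_act, s.mor_act]
    simp) (r.mor p)
  rw [r.elt_mor] at h
  exact h

/-- Representations turn isomorphisms of profunctors into isomorphisms of functors. -/
noncomputable def natIso [F.Full] [F.RetractDense] (r : Rep P F X) (s : Rep Q F Y) (η : P ≅ Q) :
    X ≅ Y where
  hom := r.natTrans s η.hom
  inv := s.natTrans r η.inv
  hom_inv_id := by
    ext a
    refine F.retractDense_hom_ext (𝟭 _) fun b v => ?_
    obtain ⟨p, rfl⟩ := r.exists_elt v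
    rw [Functor.id_map, NatTrans.comp_app, ← Category.assoc, mor_comp_natTrans, mor_comp_natTrans,
      ← app_comp, η.hom_inv_id]
    simp
  inv_hom_id := by
    ext a
    refine F.retractDense_hom_ext (𝟭 _) fun b v => ?_
    obtain ⟨p, rfl⟩ := s.exists_elt v
    rw [Functor.id_map, NatTrans.comp_app, ← Category.assoc, mor_comp_natTrans, mor_comp_natTrans,
      ← app_comp, η.inv_hom_id]
    simp

/-- The natural isomorphism of profunctors given by a natural isomorphism of the representing
functors. -/
noncomputable def isoOfNatIso (r : Rep P F X) (s : Rep Q F Y) (τ : X ≅ Y) : P ≅ Q where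
  hom := homMk (fun a b p => s.elt (r.mor p ≫ τ.hom.app a)) (fun f g p => s.ext (by
    simp [s.mor_act, r.mor_act]))
  inv := homMk (fun a b p => r.elt (s.mor p ≫ τ.inv.app a)) (fun f g p => r.ext (by
    simp [s.mor_act, r.mor_act]))
  hom_inv_id := hom_ext fun a b p => r.ext (by simp)
  inv_hom_id := hom_ext fun a b p => s.ext (by simp)

lemma mor_app_isoOfNatIso_hom (r : Rep P F X) (s : Rep Q F Y) (τ : X ≅ Y) {a : A} {b : B}
    (p : El P a b) : s.mor (app (r.isoOfNatIso s τ).hom p) = r.mor p ≫ τ.hom.app a :=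
  s.mor_elt _

end Rep

namespace Corep

variable {P Q R : Profunctor.{u} B A} {F : B ⥤ D} {X Y Z : A ⥤ D}

/-- The element represented by a morphism. -/
noncomputable def elt (r : Corep P F X) {a : A} {b : B} (f : X.obj a ⟶ F.obj b) : El P b a :=
  ((r.bijective a b).2 f).choose

@[simp] lemma mor_elt (r : Corep P F X) {a : A} {b : B} (f : X.obj a ⟶ F.obj b) :
    r.mor (r.elt f) = f := ((r.bijective a b).2 f).choose_spec

lemma ext (r : Corep P F X) {a : A} {b : B} {p q : El P b a} (h : r.mor p = r.mor q) : p = q :=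
  (r.bijective a b).1 h

@[simp] lemma elt_mor (r : Corep P F X) {a : A} {b : B} (p : El P b a) : r.elt (r.mor p) = p :=
  r.ext (r.mor_elt _)

lemma exists_elt (r : Corep P F X) {a : A} {b : B} (f : X.obj a ⟶ F.obj b) :
    ∃ p : El P b a, r.mor p = f := (r.bijective a b).2 f

/-- The identity profunctor is corepresented by a fully faithful functor. -/
def id (F : B ⥤ D) [F.Full] [F.Faithful] : Corep (Profunctor.id (C := B)) F F where
  mor {a b} (p : a ⟶ b) := F.map p
  bijective a b := ⟨fun _ _ h => F.map_injective h, fun f => F.map_surjective f⟩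
  mor_act f g (p : _ ⟶ _) :=
    (by simp : F.map (g ≫ p ≫ f) = F.map g ≫ F.map p ≫ F.map f)

/-- The contravariant profunctor of a functor is corepresented by the functor. -/
def conjoint (K : A ⥤ B) (F : B ⥤ D) [F.Full] [F.Faithful] :
    Corep K.toProfunctorRev F (K ⋙ F) where
  mor {a b} (p : K.obj a ⟶ b) := F.map p
  bijective a b := ⟨fun _ _ h => F.map_injective h, fun f => F.map_surjective f⟩
  mor_act f g (p : _ ⟶ _) :=
    (by simp : F.map (K.map g ≫ p ≫ f) = F.map (K.map g) ≫ F.map p ≫ F.map f)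

/-- The corepresentation given by an isomorphism with a restriction of the contravariant profunctor of a
functor. -/
def ofIso {G : A ⥤ A'} {H : A' ⥤ D} (e : P ≅ H.toProfunctorRev.whiskerLeft₂ F G) :
    Corep P F (G ⋙ H) where
  mor p := app e.hom p
  bijective a b := app_hom_bijective e _ _
  mor_act f g p := by
    rw [app_act]
    rfl

/-- The isomorphism given by a corepresentation. -/
noncomputable def toIso {G : A ⥤ A'} {H : A' ⥤ D} (r : Corep P F (G ⋙ H)) :
    P ≅ H.toProfunctorRev.whiskerLeft₂ F G where
  hom := homMk (fun _ _ p => r.mor p) (fun f g p => r.mor_act f g p)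
  inv := homMk (fun b a f => r.elt (a := a) (b := b) f) (fun f g p => r.ext
    ((r.mor_elt _).trans ((r.mor_act f g _).trans (congrArg (fun k => (G ⋙ H).map g ≫ k ≫ F.map f) (r.mor_elt p))).symm))
  hom_inv_id := hom_ext fun _ _ p => r.elt_mor p
  inv_hom_id := hom_ext fun b a f => r.mor_elt (a := a) (b := b) f

/-- Transport of a corepresentation along isomorphisms. -/
def congr (r : Corep P F X) (e : Q ≅ P) (i : X ≅ Y) : Corep Q F Y where
  mor p := i.inv.app _ ≫ r.mor (app e.hom p)
  bijective a b := by
    refine Function.bijective_iff_has_inverse.2 ⟨fun f => app e.inv (r.elt (i.hom.app _ ≫ f)), fun p => ?_,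
      fun f => ?_⟩
    · simp only [Iso.hom_inv_id_app_assoc, r.elt_mor, app_hom_inv]
    · simp [app_inv_hom]
  mor_act f g p := by
    rw [app_act, r.mor_act]
    simp

/-- The external product of corepresentations. -/
def tens {P' : Profunctor.{u} B' A'} {F' : B' ⥤ D'} {X' : A' ⥤ D'} (r : Corep P F X)
    (r' : Corep P' F' X') : Corep (Prof.tens P P') (F.prod F') (X.prod X') where
  mor p := (r.mor p.1, r'.mor p.2)
  bijective a b := by
    refine Function.bijective_iff_has_inverse.2
      ⟨fun f => (r.elt f.1, r'.elt f.2), fun p => Prod.ext ?_ ?_, fun p => Prod.ext ?_ ?_⟩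
    · exact r.elt_mor _
    · exact r'.elt_mor _
    · exact r.mor_elt _
    · exact r'.mor_elt _
  mor_act f g p := by
    obtain ⟨p, p'⟩ := p
    rw [act_tens]
    exact Prod.ext (r.mor_act _ _ _) (r'.mor_act _ _ _)

/-- The corepresentation of a composite. -/
def comp {Q : Profunctor.{u} C B} {J : B ⥤ E} {X : A ⥤ E} {F : C ⥤ D} {H : E ⥤ D}
    [J.Full] [J.RetractDense] (s : Corep Q F (J ⋙ H)) (r : Corep P J X) :
    Corep (Prof.comp Q P) F (X ⋙ H) where
  mor := Quot.lift (fun t => H.map (r.mor t.2.2) ≫ s.mor t.2.1) (by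
    rintro _ _ ⟨g, p, q⟩
    simp [r.mor_act, s.mor_act])
  bijective a c := by
    let ρ := J.coverRetract (X.obj a)
    -- Dual normal form: here `r.mor p` leaves `X.obj a`, so it factors through the section of the
    -- cover.
    have key {b : B} (q : El Q c b) (p : El P b a) : pair q p = pair
        (s.elt (a := J.cover (X.obj a)) (b := c) (H.map ρ.r ≫ H.map (r.mor p) ≫ s.mor q))
        (r.elt ρ.i) := by
      have hp : p = act P (J.preimage (ρ.r ≫ r.mor p)) (𝟙 a) (r.elt ρ.i) := r.ext (by
        rw [r.mor_act]
        simp)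
      conv_lhs => rw [hp]
      rw [← pair_slide]
      congr 1
      refine s.ext ?_
      rw [s.mor_act, s.mor_elt]
      simp
    constructor
    · intro x y h
      obtain ⟨b, q, p, rfl⟩ := pair_surj x
      obtain ⟨b', q', p', rfl⟩ := pair_surj y
      rw [key q p, key q' p']
      exact congrArg (fun z => pair
        (s.elt (a := J.cover (X.obj a)) (b := c) (H.map ρ.r ≫ z)) (r.elt ρ.i)) h
    · intro f
      refine ⟨pair (s.elt (a := J.cover (X.obj a)) (b := c) (H.map ρ.r ≫ f)) (r.elt ρ.i), ?_⟩
      change H.map (r.mor _) ≫ s.mor _ = f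
      rw [r.mor_elt, s.mor_elt, ← Category.assoc, ← H.map_comp, ρ.retract]
      simp
  mor_act f g x := by
    obtain ⟨b, q, p, rfl⟩ := pair_surj x
    rw [act_pair]
    change H.map (r.mor _) ≫ s.mor _ = H.map (X.map g) ≫ (H.map (r.mor _) ≫ s.mor _) ≫ F.map f
    rw [r.mor_act, s.mor_act]
    simp

end Corep

section Composite
variable {P : Profunctor.{u} A B} {P' : Profunctor.{u} B A'} {F : B ⥤ D} {X : A ⥤ D} {X' : A' ⥤ D}

/-- The morphism given by an element of the composite of a represented and a corepresented profunctor. -/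
def compMor (r : Rep P F X) (s : Corep P' F X') {a : A} {a' : A'} :
    El (comp P P') a a' → (X'.obj a' ⟶ X.obj a) :=
  Quot.lift (fun t => s.mor t.2.2 ≫ r.mor t.2.1) (by
    rintro _ _ ⟨g, p, q⟩
    simp [r.mor_act, s.mor_act])

lemma compMor_pair (r : Rep P F X) (s : Corep P' F X') {a : A} {b : B} {a' : A'} (p : El P a b)
    (p' : El P' b a') : compMor r s (pair p p') = s.mor p' ≫ r.mor p := rfl

lemma compMor_act (r : Rep P F X) (s : Corep P' F X') {a b : A} {a' b' : A'} (f : a ⟶ b)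
    (g : b' ⟶ a') (x : El (comp P P') a a') :
    compMor r s (act _ f g x) = X'.map g ≫ compMor r s x ≫ X.map f := by
  obtain ⟨c, p, q, rfl⟩ := pair_surj x
  rw [act_pair, compMor_pair, compMor_pair, r.mor_act, s.mor_act]
  simp

/-- Co-Yoneda: the coend of the sets `D(F b, X a) × D(X' a', F b)` collapses to `D(X' a', X a)`. It
suffices that `X a` is a retract of an image object, for then every class has the normal form `key`,
which depends only on the composite. -/
lemma compMor_bijective [F.Full] [F.RetractDense] (r : Rep P F X) (s : Corep P' F X') (a : A)
    (a' : A') : Function.Bijective (compMor r s (a := a) (a' := a')) := by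
  let ρ := F.coverRetract (X.obj a)
  have key {b : B} (p : El P a b) (q : El P' b a') : pair p q = pair (r.elt ρ.r)
      (s.elt ((s.mor q ≫ r.mor p) ≫ ρ.i)) := by
    have hp : p = act P (𝟙 a) (F.preimage (r.mor p ≫ ρ.i)) (r.elt ρ.r) := r.ext (by
      rw [r.mor_act]
      simp)
    conv_lhs => rw [hp]
    rw [pair_slide]
    congr 1
    refine s.ext ?_
    rw [s.mor_act, s.mor_elt]
    simp
  constructor
  · intro x y h
    obtain ⟨b, p, q, rfl⟩ := pair_surj x
    obtain ⟨b', p', q', rfl⟩ := pair_surj y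
    rw [key p q, key p' q']
    exact congrArg (fun z => pair (r.elt ρ.r) (s.elt (z ≫ ρ.i))) h
  · intro f
    refine ⟨pair (r.elt ρ.r) (s.elt (f ≫ ρ.i)), ?_⟩
    rw [compMor_pair, r.mor_elt, s.mor_elt, Category.assoc, ρ.retract, Category.comp_id]

end Composite

end Representations

end Prof

/-! ### Functors that are equivalences in `Prof` -/

namespace Prof

/-- A natural transformation of profunctors with bijective components is an isomorphism. -/
noncomputable def isoOfBijective {A B : Type u} [SmallCategory A] [SmallCategory B]
    {P Q : Profunctor.{u} A B} (η : P ⟶ Q) (h : ∀ a b, Function.Bijective (app η (a := a) (b := b))) :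
    P ≅ Q where
  hom := η
  inv := homMk (fun a b => (Equiv.ofBijective _ (h a b)).symm) (by
    intro a a' b b' f g p
    refine (h _ _).1 ?_
    rw [app_act]
    exact (Equiv.ofBijective _ (h a' b')).apply_symm_apply _ |>.trans
      (congrArg _ ((Equiv.ofBijective _ (h a b)).apply_symm_apply p).symm))
  hom_inv_id := hom_ext fun a b p => (Equiv.ofBijective _ (h a b)).symm_apply_apply p
  inv_hom_id := hom_ext fun a b p => (Equiv.ofBijective _ (h a b)).apply_symm_apply p

variable {C D : Prof.{u}}

/-- The profunctor of a functor is represented by the functor. -/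
def Rep.toProfunctor {A B : Type u} [SmallCategory A] [SmallCategory B] (F : A ⥤ B) :
    Rep F.toProfunctor (𝟭 B) F where
  mor p := p
  bijective _ _ := Function.bijective_id
  mor_act _ _ _ := rfl

/-- The contravariant profunctor of a functor is corepresented by the functor. -/
def Corep.toProfunctorRev {A B : Type u} [SmallCategory A] [SmallCategory B] (F : A ⥤ B) :
    Corep F.toProfunctorRev (𝟭 B) F where
  mor p := p
  bijective _ _ := Function.bijective_id
  mor_act _ _ _ := rfl

/-- Under the co-Yoneda identification of the coend with `D(F b, F a)`, the unit becomes `F.map`. -/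
lemma bijective_app_companionUnit_iff (F : C ⥤ D) (a b : C) :
    Function.Bijective (app (P := Profunctor.id) (Q := comp F.toProfunctor F.toProfunctorRev)
      (companionUnit F) (a := a) (b := b)) ↔ Function.Bijective (F.map (X := b) (Y := a)) := by
  have h := compMor_bijective (Rep.toProfunctor F) (Corep.toProfunctorRev F) a b
  rw [← Function.Bijective.of_comp_iff' h]
  have : (compMor (Rep.toProfunctor F) (Corep.toProfunctorRev F)) ∘
      app (P := Profunctor.id) (Q := comp F.toProfunctor F.toProfunctorRev)
      (companionUnit F) (a := a) (b := b) = F.map (X := b) (Y := a) := by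
    ext f
    exact Category.comp_id _
  rw [this]
  exact Iff.rfl

lemma bijective_app_companionCounit (F : C ⥤ D) [F.Full] [F.Faithful] [F.RetractDense] (a b : D) :
    Function.Bijective (app (P := comp F.toProfunctorRev F.toProfunctor) (Q := Profunctor.id)
      (companionCounit F) (a := a) (b := b)) := by
  -- The sets `D(F c, d)` are here read as represented by `d`. The representation of the composite
  -- then takes values in the hom sets of `D`, and its bijection is the counit.
  let r : Rep F.toProfunctorRev F (𝟭 D) :=
    { mor p := p
      bijective _ _ := Function.bijective_id
      mor_act _ _ _ := rfl }
  let s : Rep F.toProfunctor (𝟭 D) (F ⋙ 𝟭 D) := Rep.toProfunctor F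
  have h : app (P := comp F.toProfunctorRev F.toProfunctor) (Q := Profunctor.id)
      (companionCounit F) (a := a) (b := b) = (r.comp s).mor := by
    funext x
    obtain ⟨c, p, q, rfl⟩ := pair_surj x
    rfl
  rw [h]
  exact (r.comp s).bijective a b

theorem isProfEquivalence_of_retractDense (F : C ⥤ D) [F.Full] [F.Faithful] [F.RetractDense] :
    IsProfEquivalence F :=
  ⟨Bicategory.Equivalence.mkOfAdjointifyCounit (f := companion F) (g := conjoint F)
    (isoOfBijective (companionUnit F) (fun _ _ => (bijective_app_companionUnit_iff F _ _).2
      ⟨fun _ _ h => F.map_injective h, fun f => F.map_surjective f⟩))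
    (isoOfBijective (companionCounit F) (bijective_app_companionCounit F)), ⟨Iso.refl _⟩⟩

end Prof

/-! ### Mates characterised by units and counits -/

section Mates
variable {B : Type*} [Bicategory B] {c d : B} {l₁ l₂ : c ⟶ d} {r₁ r₂ : d ⟶ c}

/-- This is the formula that defines the mate, transposed along `adj₂`. It describes the mate
through counits alone, which have a simple form on elements. -/
lemma CategoryTheory.Bicategory.conjugateEquiv_whiskerRight_comp_counit (adj₁ : l₁ ⊣ r₁) (adj₂ : l₂ ⊣ r₂)
    (α : l₂ ⟶ l₁) :
    conjugateEquiv adj₁ adj₂ α ▷ l₂ ≫ adj₂.counit = r₁ ◁ α ≫ adj₁.counit := by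
  have h : conjugateEquiv adj₁ adj₂ α ≫ (λ_ _).inv = adj₂.homEquiv₂ (r₁ ◁ α ≫ adj₁.counit) := by
    rw [conjugateEquiv_apply', Adjunction.homEquiv₂_apply]
    simp
  have h2 := (Equiv.eq_symm_apply _).2 h.symm
  rw [Adjunction.homEquiv₂_symm_apply] at h2
  rw [h2]
  simp

lemma CategoryTheory.Bicategory.unit_comp_whiskerLeft_conjugateEquiv (adj₁ : l₁ ⊣ r₁) (adj₂ : l₂ ⊣ r₂)
    (α : l₂ ⟶ l₁) :
    adj₁.unit ≫ l₁ ◁ conjugateEquiv adj₁ adj₂ α = adj₂.unit ≫ α ▷ r₂ := by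
  have h : (ρ_ _).hom ≫ conjugateEquiv adj₁ adj₂ α = adj₁.homEquiv₁ (adj₂.unit ≫ α ▷ r₂) := by
    rw [conjugateEquiv_apply', Adjunction.homEquiv₁_apply]
    simp
  have h2 := (Equiv.eq_symm_apply _).2 h.symm
  rw [Adjunction.homEquiv₁_symm_apply] at h2
  rw [h2]
  simp

end Mates

/-! ### Equivalences in `Prof` are fully faithful and dense up to retracts -/

namespace IsProfEquivalence
open Prof

variable {C D : Prof.{u}} {F : C ⥤ D}

lemma exists_equivalence (h : IsProfEquivalence F) :
    ∃ e : Bicategory.Equivalence C D, e.hom = companion F := by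
  obtain ⟨e, ⟨i⟩⟩ := h
  exact ⟨Bicategory.Equivalence.mkOfAdjointifyCounit (f := companion F) (g := e.inv)
    (e.unit ≪≫ whiskerRightIso i _) (whiskerLeftIso _ i.symm ≪≫ e.counit), rfl⟩

/-- The inverse equivalence and `conjoint F` are both right adjoint to `companion F`. Their
comparison is invertible and carries the invertible unit of the equivalence to `companionUnit F`. -/
lemma map_bijective (h : IsProfEquivalence F) (a b : C) :
    Function.Bijective (F.map (X := b) (Y := a)) := by
  obtain ⟨⟨l, r, η, k, hlr⟩, h⟩ := h.exists_equivalence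
  obtain rfl : l = companion F := h
  let e : Bicategory.Equivalence C D := ⟨companion F, r, η, k, hlr⟩
  let adj : companion F ⊣ r := ⟨η.hom, k.hom, e.left_triangle_hom, e.right_triangle_hom⟩
  have h1 := unit_comp_whiskerLeft_conjugateEquiv adj (companionAdj F) (𝟙 _)
  rw [id_whiskerRight, Category.comp_id] at h1
  let i : 𝟙 C ≅ companion F ≫ conjoint F :=
    η ≪≫ whiskerLeftIso _ (asIso (conjugateEquiv adj (companionAdj F) (𝟙 _)))
  rw [← bijective_app_companionUnit_iff]
  have h2 : companionUnit F = i.hom := h1.symm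
  rw [h2]
  exact app_hom_bijective (P := Profunctor.id) (Q := comp F.toProfunctor F.toProfunctorRev) i a b

lemma full (h : IsProfEquivalence F) : F.Full := ⟨fun {a b} => (h.map_bijective b a).2⟩

lemma faithful (h : IsProfEquivalence F) : F.Faithful := ⟨fun {a b} _ _ e => (h.map_bijective b a).1 e⟩

/-- The inverse counit sends the identity of `d` to the class of some `(q, p)` with `p : d ⟶ F.obj
c`; the counit at `q` gives a retraction of `p`, by naturality. -/
lemma retractDense (h : IsProfEquivalence F) : F.RetractDense := by
  obtain ⟨⟨l, Q, η, k, hlr⟩, h⟩ := h.exists_equivalence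
  obtain rfl : l = companion F := h
  refine ⟨fun d => ?_⟩
  obtain ⟨c, q, (p : d ⟶ F.obj c), h⟩ := pair_surj (app (P := Profunctor.id)
    (Q := comp Q F.toProfunctor) k.inv (a := d) (b := d) (𝟙 d))
  refine ⟨c, ⟨⟨p, app (P := comp Q F.toProfunctor) (Q := Profunctor.id) k.hom (a := d)
    (b := F.obj c) (pair (P := Q) (Q := F.toProfunctor) (b := c) q (𝟙 (F.obj c))), ?_⟩⟩⟩
  have h1 := app_act (P := comp Q F.toProfunctor) (Q := Profunctor.id) k.hom (𝟙 d) p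
    (pair (P := Q) (Q := F.toProfunctor) (b := c) q (𝟙 (F.obj c)))
  have h2 : act (comp Q F.toProfunctor) (𝟙 d) p (pair (P := Q) (Q := F.toProfunctor) (b := c) q (𝟙 (F.obj c)))
      = app (P := Profunctor.id) (Q := comp Q F.toProfunctor) k.inv (a := d) (b := d) (𝟙 d) := by
    refine (act_pair (P := Q) (Q := F.toProfunctor) _ _ _ _).trans (Eq.trans ?_ h)
    rw [act_id]
    exact congrArg (pair (P := Q) (Q := F.toProfunctor) q)
      (by simp : p ≫ 𝟙 (F.obj c) ≫ F.map (𝟙 c) = p)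
  rw [h2] at h1
  have h3 := app_inv_hom (P := comp Q F.toProfunctor) (Q := Profunctor.id) k (a := d) (b := d) (𝟙 d)
  refine Eq.trans ?_ (h1.symm.trans h3)
  exact congrArg (p ≫ ·) (Category.comp_id _).symm

end IsProfEquivalence

theorem Prof.exists_isCauchyCompletion (C : Prof.{u}) : ∃ (D : Prof.{u}) (F : C ⥤ D), IsCauchyCompletion F := by
  let D : Prof.{u} := ⟨Idempotents.Karoubi C⟩
  let F : C ⥤ D := Idempotents.toKaroubi C
  have : F.Full := inferInstanceAs (Idempotents.toKaroubi C).Full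
  have : F.Faithful := inferInstanceAs (Idempotents.toKaroubi C).Faithful
  -- An object of the Karoubi envelope is an idempotent on `P.X`, hence a retract of the image of
  -- `P.X`.
  have : F.RetractDense := ⟨fun (P : Idempotents.Karoubi C) => ⟨P.X, ⟨⟨P.decompId_i, P.decompId_p,
    P.decompId.symm⟩⟩⟩⟩
  exact ⟨D, F, inferInstanceAs (IsIdempotentComplete (Idempotents.Karoubi C)),
    isProfEquivalence_of_retractDense F⟩

/-! ### Sources and targets of the structural 2-morphisms as represented profunctors -/

namespace PseudomonoidData

variable {C D : Prof.{u}} {F : C ⥤ D} [F.Full] [F.Faithful] [F.RetractDense]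
  {T : D × D ⥤ D} {U : D}

section
variable {P : C ⊠ C ⟶ C} (r : Rep (A := C × C) (B := C) P F ((F.prod F) ⋙ T))

/-- The representation of the source of the associativity 2-morphism. -/
def assocRepL : Rep (A := (C × C) × C) (B := C) ((P ⊠₁ 𝟙 C) ≫ P) F
    ((((F.prod F) ⋙ T).prod F) ⋙ T) :=
  (r.tens (Rep.id F)).comp (J := F.prod F) r

lemma assocRepL_mor {a b c d x : C} (p : El P (a, b) x) (q : El P (x, c) d) :
    (assocRepL r).mor (a := ((a, b), c)) (pr (tp p (ofHom (𝟙 c))) q) =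
      r.mor (a := (x, c)) q ≫ T.map (X := (F.obj x, F.obj c)) (Y := (T.obj (F.obj a, F.obj b), F.obj c))
        (r.mor (a := (a, b)) p, 𝟙 (F.obj c)) :=
  congrArg (fun k => r.mor (a := (x, c)) q ≫ T.map (X := (F.obj x, F.obj c))
    (Y := (T.obj (F.obj a, F.obj b), F.obj c)) (r.mor (a := (a, b)) p, k)) (F.map_id c)

/-- The representation of a multiplication beside an identity, followed by the multiplication. -/
def mulMulRep : Rep (A := C × (C × C)) (B := C) ((𝟙 C ⊠₁ P) ≫ P) F
    ((F.prod (F.prod F)) ⋙ (𝟭 D).prod T ⋙ T) :=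
  ((Rep.id F).tens r).comp (J := F.prod F) r

/-- The representation of the target of the associativity 2-morphism. -/
def assocRepR : Rep (A := (C × C) × C) (B := C) (associator C C C ≫ (𝟙 C ⊠₁ P) ≫ P) F
    ((prod.associator C C C ⋙ F.prod (F.prod F)) ⋙ (𝟭 D).prod T ⋙ T) :=
  (Rep.companion (prod.associator C C C) (F.prod (F.prod F))).comp (mulMulRep r)

lemma mulMulRep_mor {a b c d y : C} (p : El P (b, c) y) (q : El P (a, y) d) :
    (mulMulRep r).mor (a := (a, (b, c))) (pr (tp (ofHom (𝟙 a)) p) q) =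
      r.mor (a := (a, y)) q ≫ T.map (X := (F.obj a, F.obj y)) (Y := (F.obj a, T.obj (F.obj b, F.obj c)))
        (𝟙 (F.obj a), r.mor (a := (b, c)) p) :=
  congrArg (fun k => r.mor (a := (a, y)) q ≫ T.map (X := (F.obj a, F.obj y))
    (Y := (F.obj a, T.obj (F.obj b, F.obj c))) (k, r.mor (a := (b, c)) p)) (F.map_id a)

lemma assocRepR_mor_pr {a b c d : C}
    (x : El (A := C × (C × C)) (B := C) ((𝟙 C ⊠₁ P) ≫ P) (a, (b, c)) d) :
    (assocRepR r).mor (a := ((a, b), c))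
      (pr (P := associator C C C) (a := ((a, b), c)) (b := (a, (b, c))) (𝟙 a, (𝟙 b, 𝟙 c)) x) =
    (mulMulRep r).mor (a := (a, (b, c))) x := by
  change (mulMulRep r).mor x ≫ T.map (X := (F.obj a, T.obj (F.obj b, F.obj c)))
    (Y := (F.obj a, T.obj (F.obj b, F.obj c))) (F.map (𝟙 a),
    T.map (X := (F.obj b, F.obj c)) (Y := (F.obj b, F.obj c)) (F.map (𝟙 b), F.map (𝟙 c))) = _
  have h : T.map (X := (F.obj b, F.obj c)) (Y := (F.obj b, F.obj c)) (F.map (𝟙 b), F.map (𝟙 c)) = 𝟙 _ := by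
    rw [F.map_id, F.map_id]
    exact T.map_id _
  rw [h, F.map_id]
  have h' := T.map_id (F.obj a, T.obj (F.obj b, F.obj c))
  exact (congrArg ((mulMulRep r).mor (a := (a, (b, c))) x ≫ ·) h').trans (Category.comp_id _)

lemma assocRepR_mor {a b c d y : C} (p : El P (b, c) y) (q : El P (a, y) d) :
    (assocRepR r).mor (a := ((a, b), c))
      (pr (P := associator C C C) (a := ((a, b), c)) (b := (a, (b, c))) (𝟙 a, (𝟙 b, 𝟙 c))
        (pr (tp (ofHom (𝟙 a)) p) q)) =
      r.mor (a := (a, y)) q ≫ T.map (X := (F.obj a, F.obj y)) (Y := (F.obj a, T.obj (F.obj b, F.obj c)))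
        (𝟙 (F.obj a), r.mor (a := (b, c)) p) :=
  (assocRepR_mor_pr r _).trans (mulMulRep_mor r p q)

/-- The representation of three multiplications, bracketed to the right. -/
def mulMulMulRep : Rep (A := C × (C × (C × C))) (B := C) ((𝟙 C ⊠₁ ((𝟙 C ⊠₁ P) ≫ P)) ≫ P) F
    (F.prod ((F.prod (F.prod F)) ⋙ (𝟭 D).prod T ⋙ T) ⋙ T) :=
  ((Rep.id F).tens (mulMulRep r)).comp (J := F.prod F) r

lemma mulMulMulRep_mor {a b c d e s t : C} (p : El P (c, d) s) (q : El P (b, s) t) (q' : El P (a, t) e) :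
    (mulMulMulRep r).mor (a := (a, (b, (c, d)))) (pr (tp (ofHom (𝟙 a)) (pr (tp (ofHom (𝟙 b)) p) q)) q') =
      r.mor (a := (a, t)) q' ≫ T.map (X := (F.obj a, F.obj t))
        (Y := (F.obj a, T.obj (F.obj b, T.obj (F.obj c, F.obj d)))) (𝟙 (F.obj a),
          r.mor (a := (b, s)) q ≫ T.map (X := (F.obj b, F.obj s))
            (Y := (F.obj b, T.obj (F.obj c, F.obj d))) (𝟙 (F.obj b), r.mor (a := (c, d)) p)) := by
  refine Eq.trans ?_ (congrArg (fun k => r.mor (a := (a, t)) q' ≫ T.map (X := (F.obj a, F.obj t))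
        (Y := (F.obj a, T.obj (F.obj b, T.obj (F.obj c, F.obj d)))) (𝟙 (F.obj a), k)) (mulMulRep_mor r p q))
  exact (congrArg (fun k => r.mor (a := (a, t)) q' ≫ T.map (X := (F.obj a, F.obj t))
    (Y := (F.obj a, T.obj (F.obj b, T.obj (F.obj c, F.obj d)))) (k, (mulMulRep r).mor (a := (b, (c, d)))
      (pr (tp (ofHom (𝟙 b)) p) q))) (F.map_id a))

variable {N : tensorUnit ⟶ C} (s : Rep (A := Discrete PUnit.{u + 1}) (B := C) N F
  ((Functor.const (Discrete PUnit.{u + 1})).obj U))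

/-- The representation of the source of the left unit 2-morphism. -/
def lunitRepL : Rep (A := Discrete PUnit.{u + 1} × C) (B := C) ((N ⊠₁ 𝟙 C) ≫ P) F
    (((Functor.const (Discrete PUnit.{u + 1})).obj U).prod F ⋙ T) :=
  (s.tens (Rep.id F)).comp (J := F.prod F) r

lemma lunitRepL_mor {b c x : C} (e : El N star x) (p : El P (x, b) c) :
    (lunitRepL r s).mor (a := (⟨PUnit.unit⟩, b)) (pr (tp e (ofHom (𝟙 b))) p) =
      r.mor (a := (x, b)) p ≫ T.map (X := (F.obj x, F.obj b)) (Y := (U, F.obj b))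
        (s.mor (a := ⟨PUnit.unit⟩) e, 𝟙 (F.obj b)) :=
  congrArg (fun k => r.mor (a := (x, b)) p ≫ T.map (X := (F.obj x, F.obj b)) (Y := (U, F.obj b))
        (s.mor (a := ⟨PUnit.unit⟩) e, k)) (F.map_id b)

/-- The representation of the source of the right unit 2-morphism. -/
def runitRepL : Rep (A := C × Discrete PUnit.{u + 1}) (B := C) ((𝟙 C ⊠₁ N) ≫ P) F
    (F.prod ((Functor.const (Discrete PUnit.{u + 1})).obj U) ⋙ T) :=
  ((Rep.id F).tens s).comp (J := F.prod F) r

lemma runitRepL_mor {b c x : C} (e : El N star x) (p : El P (b, x) c) :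
    (runitRepL r s).mor (a := (b, ⟨PUnit.unit⟩)) (pr (tp (ofHom (𝟙 b)) e) p) =
      r.mor (a := (b, x)) p ≫ T.map (X := (F.obj b, F.obj x)) (Y := (F.obj b, U))
        (𝟙 (F.obj b), s.mor (a := ⟨PUnit.unit⟩) e) :=
  congrArg (fun k => r.mor (a := (b, x)) p ≫ T.map (X := (F.obj b, F.obj x)) (Y := (F.obj b, U))
        (k, s.mor (a := ⟨PUnit.unit⟩) e)) (F.map_id b)

end

section
variable {M : PseudomonoidData C} (r : Rep (A := C × C) (B := C) M.mul F ((F.prod F) ⋙ T))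

include r in
-- The value of the associativity 2-morphism is a morphism into a triple tensor product; it is
-- factored through the cover of the inner product, and both factors are represented by elements.
lemma exists_assoc {a b c d x : C} (p : El M.mul (a, b) x) (q : El M.mul (x, c) d) :
    ∃ (y : C) (p' : El M.mul (b, c) y) (q' : El M.mul (a, y) d), M.Assoc p q p' q' := by
  let ρ := F.coverRetract (T.obj (F.obj b, F.obj c))
  let z := ap M.assoc.hom (pr (tp p (ofHom (𝟙 c))) q)
  let f : F.obj d ⟶ T.obj (F.obj a, T.obj (F.obj b, F.obj c)) := (assocRepR r).mor (a := ((a, b), c)) z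
  obtain ⟨p₁, hp⟩ := r.exists_elt (a := (b, c)) ρ.r
  obtain ⟨q₁, hq⟩ := r.exists_elt (a := (a, F.cover (T.obj (F.obj b, F.obj c)))) (b := d)
    (f ≫ T.map (X := (F.obj a, T.obj (F.obj b, F.obj c))) (Y := (F.obj a, F.obj _)) (𝟙 (F.obj a), ρ.i))
  refine ⟨_, p₁, q₁, (assocRepR r).ext (Eq.trans ?_ (assocRepR_mor r p₁ q₁).symm)⟩
  rw [hp, hq]
  have h : T.map (X := (F.obj a, T.obj (F.obj b, F.obj c))) (Y := (F.obj a, F.obj _)) (𝟙 (F.obj a), ρ.i) ≫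
      T.map (Y := (F.obj a, T.obj (F.obj b, F.obj c))) (𝟙 (F.obj a), ρ.r) = 𝟙 _ := by
    rw [← T.map_comp, ← T.map_id]
    exact congrArg T.map (Prod.ext (Category.comp_id _) ρ.retract)
  exact ((Category.assoc _ _ _).trans ((congrArg (f ≫ ·) h).trans (Category.comp_id f))).symm

/-- Only the class of the target pair matters, and the class is the composite morphism. -/
lemma assoc_of_mor_eq {a b c d x y y' : C} {p : El M.mul (a, b) x} {q : El M.mul (x, c) d}
    {p₁ : El M.mul (b, c) y} {q₁ : El M.mul (a, y) d} {p₂ : El M.mul (b, c) y'} {q₂ : El M.mul (a, y') d}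
    (h : r.mor (a := (a, y)) q₁ ≫ T.map (X := (F.obj a, F.obj y)) (Y := (F.obj a, T.obj (F.obj b, F.obj c)))
        (𝟙 (F.obj a), r.mor (a := (b, c)) p₁) =
      r.mor (a := (a, y')) q₂ ≫ T.map (X := (F.obj a, F.obj y')) (Y := (F.obj a, T.obj (F.obj b, F.obj c)))
        (𝟙 (F.obj a), r.mor (a := (b, c)) p₂))
    (h₁ : M.Assoc p q p₁ q₁) : M.Assoc p q p₂ q₂ :=
  h₁.trans ((assocRepR r).ext (((assocRepR_mor r _ _).trans h).trans (assocRepR_mor r _ _).symm))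

end

end PseudomonoidData


/-! ### Elementwise conditions as equations in the realizing category -/

namespace MonoidalRealization
open MonoidalCategory

variable {C D : Prof.{u}} {F : C ⥤ D} [MonoidalCategory D] {I : RightAdjointPseudomonoid C}
  (R : MonoidalRealization F I)

/-- The multiplication is represented by the tensor product. -/
def mulRep : Rep (A := C × C) (B := C) I.mul F ((F.prod F) ⋙ tensor D) := Rep.ofIso R.mulIso

/-- The comultiplication is corepresented by the tensor product. -/
def comulRep : Corep (A := C × C) (B := C) I.comul F ((F.prod F) ⋙ tensor D) := Corep.ofIso R.comulIso

/-- The unit is represented by the unit object. -/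
def oneRep : Rep (A := Discrete PUnit.{u + 1}) (B := C) I.one F
    (𝟭 _ ⋙ (Functor.const (Discrete PUnit.{u + 1})).obj (𝟙_ D)) := Rep.ofIso R.oneIso

/-- The counit is corepresented by the unit object. -/
def cooneRep : Corep (A := Discrete PUnit.{u + 1}) (B := C) I.coone F
    (𝟭 _ ⋙ (Functor.const (Discrete PUnit.{u + 1})).obj (𝟙_ D)) := Corep.ofIso R.cooneIso

/-- The morphism which represents an element of the multiplication. -/
def mulMor {a b x : C} (p : El I.mul (a, b) x) : F.obj x ⟶ F.obj a ⊗ F.obj b := R.mulRep.mor (a := (a, b)) p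

/-- The morphism which represents an element of the comultiplication. -/
def comulMor {a b x : C} (p : El I.comul x (a, b)) : F.obj a ⊗ F.obj b ⟶ F.obj x :=
  R.comulRep.mor (a := (a, b)) p

/-- The morphism which represents an element of the unit. -/
def oneMor {x : C} (p : El I.one star x) : F.obj x ⟶ 𝟙_ D := R.oneRep.mor (a := ⟨PUnit.unit⟩) p

/-- The morphism which represents an element of the counit. -/
def cooneMor {x : C} (p : El I.coone x star) : 𝟙_ D ⟶ F.obj x := R.cooneRep.mor (a := ⟨PUnit.unit⟩) p

lemma exists_mulMor {a b x : C} (f : F.obj x ⟶ F.obj a ⊗ F.obj b) :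
    ∃ p : El I.mul (a, b) x, R.mulMor p = f := R.mulRep.exists_elt (a := (a, b)) f

lemma exists_comulMor {a b x : C} (f : F.obj a ⊗ F.obj b ⟶ F.obj x) :
    ∃ p : El I.comul x (a, b), R.comulMor p = f := R.comulRep.exists_elt (a := (a, b)) f

lemma exists_oneMor {x : C} (f : F.obj x ⟶ 𝟙_ D) : ∃ p : El I.one star x, R.oneMor p = f :=
  R.oneRep.exists_elt (a := ⟨PUnit.unit⟩) f

lemma exists_cooneMor {x : C} (f : 𝟙_ D ⟶ F.obj x) : ∃ p : El I.coone x star, R.cooneMor p = f :=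
  R.cooneRep.exists_elt (a := ⟨PUnit.unit⟩) f

lemma oneMor_injective {x : C} {p q : El I.one star x} (h : R.oneMor p = R.oneMor q) : p = q :=
  R.oneRep.ext (a := ⟨PUnit.unit⟩) h

lemma cooneMor_injective {x : C} {p q : El I.coone x star} (h : R.cooneMor p = R.cooneMor q) : p = q :=
  R.cooneRep.ext (a := ⟨PUnit.unit⟩) h

lemma mulMor_actMul {a a' b b' x x' : C} (f : a ⟶ a') (g : b ⟶ b') (h : x' ⟶ x) (p : El I.mul (a, b) x) :
    R.mulMor (I.actMul f g h p) = F.map h ≫ R.mulMor p ≫ (F.map f ⊗ₘ F.map g) :=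
  R.mulRep.mor_act (a := (a, b)) (a' := (a', b')) (f, g) h p

lemma map_mulCounit {a b x y : C} (q : El I.comul y (a, b)) (p : El I.mul (a, b) x) :
    F.map (I.mulCounit q p) = R.mulMor p ≫ R.comulMor q := R.mul_counit q p

lemma map_oneCounit {x y : C} (q : El I.coone y star) (p : El I.one star x) :
    F.map (I.oneCounit q p) = R.oneMor p ≫ R.cooneMor q := R.one_counit q p

lemma map_lam {x b c : C} (e : El I.one star x) (p : El I.mul (x, b) c) :
    F.map (I.lam e p) = R.mulMor p ≫ R.oneMor e ▷ F.obj b ≫ (λ_ (F.obj b)).hom := R.lunit e p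

lemma map_rho {x b c : C} (e : El I.one star x) (p : El I.mul (b, x) c) :
    F.map (I.rho e p) = R.mulMor p ≫ F.obj b ◁ R.oneMor e ≫ (ρ_ (F.obj b)).hom := R.runit e p

lemma comulMor_comp_mulMor {a a' b b' x : C} {f : a' ⟶ a} {g : b' ⟶ b} {j : El I.mul (a, b) x}
    {j' : El I.comul x (a', b')} (h : I.mulUnit f g = pr j j') :
    R.comulMor j' ≫ R.mulMor j = F.map f ⊗ₘ F.map g := R.mul_unit f g j j' h

lemma cooneMor_comp_oneMor {x : C} {e : El I.one star x} {e' : El I.coone x star}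
    (h : I.oneUnit = pr e e') : R.cooneMor e' ≫ R.oneMor e = 𝟙 (𝟙_ D) := R.one_unit e e' h

variable [F.Full] [F.Faithful] [F.RetractDense]

lemma pr_eq_pr_iff {a b a' b' x y : C} (p : El I.mul (a, b) x) (q : El I.comul x (a', b'))
    (p' : El I.mul (a, b) y) (q' : El I.comul y (a', b')) :
    (pr p q : El (I.mul ≫ I.comul) (a, b) (a', b')) = pr p' q' ↔
      R.comulMor q ≫ R.mulMor p = R.comulMor q' ≫ R.mulMor p' :=
  (compMor_bijective R.mulRep R.comulRep (a, b) (a', b')).1.eq_iff.symm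

/-- A realization only asserts one implication. The converse holds because some representative of
the unit satisfies the equation, and representatives with equal composites define the same class. -/
lemma mulUnit_eq_iff {a a' b b' x : C} (f : a' ⟶ a) (g : b' ⟶ b) (j : El I.mul (a, b) x)
    (j' : El I.comul x (a', b')) :
    I.mulUnit f g = pr j j' ↔ R.comulMor j' ≫ R.mulMor j = F.map f ⊗ₘ F.map g := by
  refine ⟨R.comulMor_comp_mulMor, fun h => ?_⟩
  obtain ⟨y, k, k', hk⟩ := pair_surj (I.mulUnit f g)
  exact hk.symm.trans ((R.pr_eq_pr_iff k k' j j').2 ((R.comulMor_comp_mulMor hk.symm).trans h.symm))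

lemma oneUnit_eq_iff {x : C} (e : El I.one star x) (e' : El I.coone x star) :
    I.oneUnit = pr e e' ↔ R.cooneMor e' ≫ R.oneMor e = 𝟙 (𝟙_ D) := by
  refine ⟨R.cooneMor_comp_oneMor, fun h => ?_⟩
  obtain ⟨y, k, k', hk⟩ := pair_surj I.oneUnit
  refine hk.symm.trans ((compMor_bijective R.oneRep R.cooneRep ⟨PUnit.unit⟩ ⟨PUnit.unit⟩).1 ?_)
  exact (R.cooneMor_comp_oneMor hk.symm).trans h.symm

/-- The converse of the realization axiom: `exists_assoc` provides one pair in the relation, and it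
has the same composite morphism as `(r, s)`. -/
lemma assoc_iff {a b c d x y : C} (p : El I.mul (a, b) x) (q : El I.mul (x, c) d)
    (r : El I.mul (b, c) y) (s : El I.mul (a, y) d) :
    I.Assoc p q r s ↔
      R.mulMor q ≫ R.mulMor p ▷ F.obj c ≫ (α_ (F.obj a) (F.obj b) (F.obj c)).hom = R.mulMor s ≫ F.obj a ◁ R.mulMor r := by
  refine ⟨R.assoc p q r s, fun h => ?_⟩
  obtain ⟨y', r', s', h'⟩ := PseudomonoidData.exists_assoc R.mulRep p q
  refine PseudomonoidData.assoc_of_mor_eq R.mulRep ?_ h'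
  have h2 := (R.assoc p q r' s' h').symm.trans h
  change R.mulMor s' ≫ F.obj a ◁ R.mulMor r' = _ at h2
  change R.mulMor s' ≫ (𝟙 _ ⊗ₘ R.mulMor r') = R.mulMor s ≫ (𝟙 _ ⊗ₘ R.mulMor r)
  rw [id_tensorHom, id_tensorHom]
  exact h2

/-- The co-multiplication beside an identity is corepresented. -/
def coassocRepL : Corep (A := (C × C) × C) (B := C) (I.comul ≫ (I.comul ⊠₁ 𝟙 C)) F
    ((((F.prod F) ⋙ tensor D).prod F) ⋙ tensor D) :=
  R.comulRep.comp (J := F.prod F) (R.comulRep.tens (Corep.id F))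

lemma coassocRepL_mor {a b c d x : C} (p : El I.comul x (a, b)) (q : El I.comul d (x, c)) :
    R.coassocRepL.mor (a := ((a, b), c)) (pr q (tp p (ofHom (𝟙 c)))) =
      R.comulMor p ▷ F.obj c ≫ R.comulMor q := by
  have h : (R.comulMor p ⊗ₘ F.map (𝟙 c)) ≫ R.comulMor q = R.comulMor p ▷ F.obj c ≫ R.comulMor q := by
    simp
  exact h

end MonoidalRealization

/-! ### Counits and mates on elements -/

namespace Prof

/-- The counit of the adjunction is the composition of the representing morphisms. -/
structure CounitCompat {A B : Prof.{u}} {D : Type u} [SmallCategory D] {F : B ⥤ D} {X : A ⥤ D} {P : A ⟶ B}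
    {P' : B ⟶ A} (adj : P ⊣ P') (r : Rep (A := A) (B := B) P F X) (s : Corep (A := A) (B := B) P' F X) :
    Prop where
  map_counit {a : A} {b b' : B} (q : El P' b a) (p : El P a b') :
    F.map (ap adj.counit (pr q p) : b' ⟶ b) = r.mor p ≫ s.mor q

section
variable {A B C A' B' : Prof.{u}}

/-- The counit of a composite adjunction cancels the inner pair first; the resulting morphism of `B`
acts on `q`, and the outer counit does the rest. -/
lemma ap_comp_counit {P : A ⟶ B} {P' : B ⟶ A} {Q : B ⟶ C} {Q' : C ⟶ B} (adj : P ⊣ P') (adj' : Q ⊣ Q')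
    {a : A} {b b' : B} {c c' : C} (q' : El Q' c b) (p' : El P' b a) (p : El P a b') (q : El Q b' c') :
    (ap (adj.comp adj').counit (pr (pr q' p') (pr p q)) : c' ⟶ c) =
      (ap adj'.counit (pr q' (act (A := B) (B := C) Q (ap adj.counit (pr p' p) : b' ⟶ b) (𝟙 c') q)) :
        c' ⟶ c) := by
  have h : (adj.comp adj').counit = (α_ Q' P' (P ≫ Q)).hom ≫
      Q' ◁ ((α_ P' P Q).inv ≫ adj.counit ▷ Q ≫ (λ_ Q).hom) ≫ adj'.counit := by
    rw [Bicategory.Adjunction.comp_counit, Bicategory.Adjunction.compCounit]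
    bicategory
  exact congrArg (fun η => ap η (pr (pr q' p') (pr p q))) h

lemma ap_conjugateEquiv {P₁ P₂ : A ⟶ B} {Q₁ Q₂ : B ⟶ A} (adj₁ : P₁ ⊣ Q₁) (adj₂ : P₂ ⊣ Q₂)
    (α : P₂ ⟶ P₁) {a : A} {b b' : B} (q : El Q₁ b a) (p : El P₂ a b') :
    ap adj₂.counit (pr (ap (conjugateEquiv adj₁ adj₂ α) q) p) = ap adj₁.counit (pr q (ap α p)) :=
  congrArg (fun η => ap η (pr q p)) (conjugateEquiv_whiskerRight_comp_counit adj₁ adj₂ α)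

end

section
variable {A B C A' B' : Prof.{u}} {D E D' : Type u} [SmallCategory D] [SmallCategory E] [SmallCategory D']

/-- With `comp`, `tens`, `id` and `companion`, the compatibility spreads from the two generating
adjunctions to the composite adjunctions that define coassociativity and the right counit. -/
lemma CounitCompat.comp {P : A ⟶ B} {P' : B ⟶ A} {Q : B ⟶ C} {Q' : C ⟶ B} {adj : P ⊣ P'} {adj' : Q ⊣ Q'}
    {J : B ⥤ E} {_ : J.Full} {_ : J.RetractDense} {X : A ⥤ E} {H : E ⥤ D} {F : C ⥤ D}
    {r : Rep (A := A) (B := B) P J X} {s : Corep (A := A) (B := B) P' J X}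
    {r' : Rep (A := B) (B := C) Q F (J ⋙ H)} {s' : Corep (A := B) (B := C) Q' F (J ⋙ H)}
    (h : CounitCompat adj r s) (h' : CounitCompat adj' r' s') :
    CounitCompat (adj.comp adj') (r.comp r') (s'.comp s) := by
  refine ⟨fun {a c c'} x y => ?_⟩
  obtain ⟨b, q', p', rfl⟩ := pair_surj x
  obtain ⟨b', p, q, rfl⟩ := pair_surj y
  refine (congrArg F.map (ap_comp_counit adj adj' q' p' p q)).trans ((h'.map_counit _ _).trans ?_)
  have key (k : b' ⟶ b) (hk : J.map k = r.mor p ≫ s.mor p') :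
      r'.mor (act (A := B) (B := C) Q k (𝟙 c') q) ≫ s'.mor q' =
        (r'.mor q ≫ H.map (r.mor p)) ≫ H.map (s.mor p') ≫ s'.mor q' := by
    rw [r'.mor_act, Functor.comp_map, hk]
    simp
  exact key _ (h.map_counit p' p)

lemma CounitCompat.tens {P : A ⟶ B} {P' : B ⟶ A} {Q : A' ⟶ B'} {Q' : B' ⟶ A'} {adj : P ⊣ P'}
    {adj' : Q ⊣ Q'} {F : B ⥤ D} {F' : B' ⥤ D'} {X : A ⥤ D} {X' : A' ⥤ D'}
    {r : Rep (A := A) (B := B) P F X} {s : Corep (A := A) (B := B) P' F X}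
    {r' : Rep (A := A') (B := B') Q F' X'} {s' : Corep (A := A') (B := B') Q' F' X'}
    (h : CounitCompat adj r s) (h' : CounitCompat adj' r' s') :
    @CounitCompat (A ⊠ A') (B ⊠ B') (D × D') _ (F.prod F') (X.prod X') _ _ (tensorAdj adj adj')
      (r.tens r') (s.tens s') :=
  ⟨fun q p => Prod.ext (h.map_counit q.1 p.1) (h'.map_counit q.2 p.2)⟩

lemma CounitCompat.id (F : B ⥤ D) [F.Full] [F.Faithful] :
    CounitCompat (Adjunction.id B) (Rep.id F) (Corep.id F) := by
  refine ⟨fun {a b b'} (q : a ⟶ b) (p : b' ⟶ a) => ?_⟩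
  exact (by simp : F.map (p ≫ q ≫ 𝟙 b) = F.map p ≫ F.map q)

lemma CounitCompat.companion (K : A ⥤ B) (F : B ⥤ D) {_ : F.Full} {_ : F.Faithful} :
    CounitCompat (companionAdj K) (Rep.companion K F) (Corep.conjoint K F) := by
  refine ⟨fun {a b b'} (q : K.obj a ⟶ b) (p : b' ⟶ K.obj a) => ?_⟩
  exact F.map_comp p q

/-- The counits are composition in `D`, so both sides agree after precomposition with every `r₂.mor
p`, and these morphisms are jointly epimorphic. Mates are computed by this lemma: what postcomposes
with `τ` on left adjoints precomposes with `τ` on right adjoints. -/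
lemma CounitCompat.conjugateEquiv {P₁ P₂ : A ⟶ B} {Q₁ Q₂ : B ⟶ A} {adj₁ : P₁ ⊣ Q₁} {adj₂ : P₂ ⊣ Q₂}
    {F : B ⥤ D} [F.RetractDense] {X₁ X₂ : A ⥤ D} {r₁ : Rep (A := A) (B := B) P₁ F X₁}
    {s₁ : Corep (A := A) (B := B) Q₁ F X₁} {r₂ : Rep (A := A) (B := B) P₂ F X₂}
    {s₂ : Corep (A := A) (B := B) Q₂ F X₂} (h₁ : CounitCompat adj₁ r₁ s₁) (h₂ : CounitCompat adj₂ r₂ s₂)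
    (α : P₂ ⟶ P₁) {a : A} (τ : X₂.obj a ⟶ X₁.obj a)
    (hα : ∀ {b : B} (p : El P₂ a b), r₁.mor (ap α p) = r₂.mor p ≫ τ) {b : B} (q : El Q₁ b a) :
    s₂.mor (ap (Bicategory.conjugateEquiv adj₁ adj₂ α) q) = τ ≫ s₁.mor q := by
  refine F.retractDense_hom_ext (𝟭 D) fun b' v => ?_
  obtain ⟨p, rfl⟩ := r₂.exists_elt v
  have h := congrArg F.map (ap_conjugateEquiv adj₁ adj₂ α q p)
  have h' := ((h₂.map_counit _ p).symm.trans h).trans (h₁.map_counit q (ap α p))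
  rw [hα, Category.assoc] at h'
  exact h'

end

end Prof

/-! ### Coassociativity and the right counit in the realizing category -/

namespace MonoidalRealization
open MonoidalCategory

variable {C D : Prof.{u}} {F : C ⥤ D} [MonoidalCategory D] {I : RightAdjointPseudomonoid C}
  (R : MonoidalRealization F I) [F.Full] [F.Faithful] [F.RetractDense]

lemma mulCounitCompat : CounitCompat I.mulAdj R.mulRep R.comulRep :=
  ⟨fun q p => R.mul_counit q p⟩

lemma oneCounitCompat : CounitCompat I.oneAdj R.oneRep R.cooneRep := by
  constructor
  rintro ⟨⟨⟩⟩ x y q p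
  exact R.one_counit q p

/-- A comultiplication followed by a comultiplication and an identity is corepresented. -/
def comulMulRep : Corep (A := C × (C × C)) (B := C) (I.comul ≫ (𝟙 C ⊠₁ I.comul)) F
    ((F.prod (F.prod F)) ⋙ (𝟭 D).prod (tensor D) ⋙ tensor D) :=
  R.comulRep.comp (J := F.prod F) ((Corep.id F).tens R.comulRep)

/-- The corepresentation of the target of the coassociativity 2-morphism. -/
def coassocRepR : Corep (A := (C × C) × C) (B := C)
    ((I.comul ≫ (𝟙 C ⊠₁ I.comul)) ≫ associatorInv C C C) F
    ((prod.associator C C C ⋙ F.prod (F.prod F)) ⋙ (𝟭 D).prod (tensor D) ⋙ tensor D) :=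
  R.comulMulRep.comp (J := F.prod (F.prod F)) (Corep.conjoint (prod.associator C C C) (F.prod (F.prod F)))

lemma coassocRepR_mor {a b c d y : C} (r : El I.comul y (b, c)) (s : El I.comul d (a, y)) :
    R.coassocRepR.mor (a := ((a, b), c)) (pr (Q := associatorInv C C C) (b := (a, (b, c))) (c := ((a, b), c))
      (pr s (tp (ofHom (𝟙 a)) r)) (𝟙 a, (𝟙 b, 𝟙 c))) = F.obj a ◁ R.comulMor r ≫ R.comulMor s := by
  have h : (F.map (𝟙 a) ⊗ₘ (F.map (𝟙 b) ⊗ₘ F.map (𝟙 c))) ≫ (F.map (𝟙 a) ⊗ₘ R.comulMor r) ≫ R.comulMor s =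
      F.obj a ◁ R.comulMor r ≫ R.comulMor s := by
    simp
  exact h

/-- The inner tensor product need not be an image object; it is replaced by its cover, with the
retraction as first multiplication and the section absorbed in the second. -/
lemma exists_mul_mul {a b c d : C} (f : F.obj d ⟶ (F.obj a ⊗ F.obj b) ⊗ F.obj c) :
    ∃ (x : C) (p : El I.mul (a, b) x) (q : El I.mul (x, c) d), R.mulMor q ≫ R.mulMor p ▷ F.obj c = f := by
  let ρ := F.coverRetract (F.obj a ⊗ F.obj b)
  obtain ⟨p, hp⟩ := R.exists_mulMor ρ.r
  obtain ⟨q, hq⟩ := R.exists_mulMor (f ≫ ρ.i ▷ F.obj c)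
  refine ⟨_, p, q, ?_⟩
  rw [hp, hq, Category.assoc, ← MonoidalCategory.comp_whiskerRight, ρ.retract]
  simp

lemma exists_comul_comul {a b c d : C} (f : (F.obj a ⊗ F.obj b) ⊗ F.obj c ⟶ F.obj d) :
    ∃ (x : C) (p : El I.comul x (a, b)) (q : El I.comul d (x, c)),
      R.comulMor p ▷ F.obj c ≫ R.comulMor q = f := by
  let ρ := F.coverRetract (F.obj a ⊗ F.obj b)
  obtain ⟨p, hp⟩ := R.exists_comulMor ρ.i
  obtain ⟨q, hq⟩ := R.exists_comulMor (ρ.r ▷ F.obj c ≫ f)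
  refine ⟨_, p, q, ?_⟩
  rw [hp, hq, ← Category.assoc, ← MonoidalCategory.comp_whiskerRight, ρ.retract]
  simp

lemma assocRepL_mor {a b c d x : C} (p : El I.mul (a, b) x) (q : El I.mul (x, c) d) :
    (PseudomonoidData.assocRepL R.mulRep).mor (a := ((a, b), c)) (pr (tp p (ofHom (𝟙 c))) q) =
      R.mulMor q ≫ R.mulMor p ▷ F.obj c := by
  refine (PseudomonoidData.assocRepL_mor R.mulRep p q).trans ?_
  change R.mulMor q ≫ (R.mulMor p ⊗ₘ 𝟙 _) = _
  rw [tensorHom_id]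

lemma assocRepR_mor {a b c d y : C} (p : El I.mul (b, c) y) (q : El I.mul (a, y) d) :
    (PseudomonoidData.assocRepR R.mulRep).mor (a := ((a, b), c))
      (pr (P := associator C C C) (a := ((a, b), c)) (b := (a, (b, c))) (𝟙 a, (𝟙 b, 𝟙 c))
        (pr (tp (ofHom (𝟙 a)) p) q)) = R.mulMor q ≫ F.obj a ◁ R.mulMor p := by
  refine (PseudomonoidData.assocRepR_mor R.mulRep p q).trans ?_
  change R.mulMor q ≫ (𝟙 _ ⊗ₘ R.mulMor p) = _
  rw [id_tensorHom]

/-- The realization describes associativity on pairs of elements; `exists_mul_mul` writes any class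
`z` as such a pair. -/
lemma assocRepR_mor_ap {a b c d : C}
    (z : El (A := (C × C) × C) (B := C) ((I.mul ⊠₁ 𝟙 C) ≫ I.mul) ((a, b), c) d) :
    (PseudomonoidData.assocRepR R.mulRep).mor (a := ((a, b), c)) (ap I.assoc.hom z) =
      (PseudomonoidData.assocRepL R.mulRep).mor (a := ((a, b), c)) z ≫
        (α_ (F.obj a) (F.obj b) (F.obj c)).hom := by
  obtain ⟨x, p, q, h⟩ := R.exists_mul_mul ((PseudomonoidData.assocRepL R.mulRep).mor (a := ((a, b), c)) z)
  obtain rfl := (PseudomonoidData.assocRepL R.mulRep).ext (a := ((a, b), c)) ((R.assocRepL_mor p q).trans h)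
  obtain ⟨y, r, s, h'⟩ := PseudomonoidData.exists_assoc R.mulRep p q
  refine (congrArg ((PseudomonoidData.assocRepR R.mulRep).mor (a := ((a, b), c))) h').trans ?_
  refine (R.assocRepR_mor r s).trans (((R.assoc_iff p q r s).1 h').symm.trans ?_)
  refine Eq.trans ?_ (congrArg (· ≫ (α_ (F.obj a) (F.obj b) (F.obj c)).hom) (R.assocRepL_mor p q).symm)
  exact (Category.assoc _ _ _).symm

/-- Coassociativity is by definition the mate of `I.assoc.inv`, which postcomposes with the inverse
associator; hence it precomposes with it. -/
lemma coassocRepR_mor_ap {a b c d : C}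
    (z : El (A := C) (B := (C × C) × C) (I.comul ≫ (I.comul ⊠₁ 𝟙 C)) d ((a, b), c)) :
    R.coassocRepR.mor (a := ((a, b), c)) (ap I.coassoc z) =
      (α_ (F.obj a) (F.obj b) (F.obj c)).inv ≫ R.coassocRepL.mor (a := ((a, b), c)) z := by
  -- `h₁` and `h₂` treat the two composite adjunctions between which the mate is taken.
  have h₁ : CounitCompat ((tensorAdj I.mulAdj (Adjunction.id C)).comp I.mulAdj)
      (PseudomonoidData.assocRepL R.mulRep) R.coassocRepL :=
    CounitCompat.comp (A := (C ⊠ C) ⊠ C) (B := C ⊠ C) (C := C) (E := D × D) (D := D) (J := F.prod F)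
      (X := ((F.prod F) ⋙ tensor D).prod F) (H := tensor D) (F := F) (r := R.mulRep.tens (Rep.id F))
      (s := R.comulRep.tens (Corep.id F)) (r' := R.mulRep) (s' := R.comulRep)
      (R.mulCounitCompat.tens (CounitCompat.id F)) R.mulCounitCompat
  have h₃ : CounitCompat ((tensorAdj (Adjunction.id C) I.mulAdj).comp I.mulAdj)
      (PseudomonoidData.mulMulRep R.mulRep) R.comulMulRep :=
    CounitCompat.comp (A := C ⊠ C ⊠ C) (B := C ⊠ C) (C := C) (E := D × D) (D := D) (J := F.prod F)
      (X := F.prod ((F.prod F) ⋙ tensor D)) (H := tensor D) (F := F) (r := (Rep.id F).tens R.mulRep)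
      (s := (Corep.id F).tens R.comulRep) (r' := R.mulRep) (s' := R.comulRep)
      ((CounitCompat.id F).tens R.mulCounitCompat) R.mulCounitCompat
  have h₂ : CounitCompat ((associatorAdj C C C).comp ((tensorAdj (Adjunction.id C) I.mulAdj).comp I.mulAdj))
      (PseudomonoidData.assocRepR R.mulRep) R.coassocRepR :=
    CounitCompat.comp (A := (C ⊠ C) ⊠ C) (B := C ⊠ C ⊠ C) (C := C) (E := D × (D × D)) (D := D)
      (J := F.prod (F.prod F)) (X := prod.associator C C C ⋙ F.prod (F.prod F))
      (H := (𝟭 D).prod (tensor D) ⋙ tensor D) (F := F)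
      (r := Rep.companion (prod.associator C C C) (F.prod (F.prod F)))
      (s := Corep.conjoint (prod.associator C C C) (F.prod (F.prod F)))
      (r' := PseudomonoidData.mulMulRep R.mulRep) (s' := R.comulMulRep)
      (CounitCompat.companion (A := (C ⊠ C) ⊠ C) (B := C ⊠ C ⊠ C) (prod.associator C C C)
        (F.prod (F.prod F))) h₃
  refine h₁.conjugateEquiv h₂ I.assoc.inv (a := ((a, b), c)) (α_ (F.obj a) (F.obj b) (F.obj c)).inv
    (fun {d} p => ?_) z
  have h' : ap I.assoc.hom (ap I.assoc.inv p) = p :=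
    congrArg (fun η => ap η p) I.assoc.inv_hom_id
  have h := (congrArg (PseudomonoidData.assocRepR R.mulRep).mor h').symm.trans
    (R.assocRepR_mor_ap (ap I.assoc.inv p))
  exact (Iso.eq_comp_inv _).2 h.symm

lemma coassoc_iff {a b c d x y : C} (p : El I.comul x (a, b)) (q : El I.comul d (x, c))
    (r : El I.comul y (b, c)) (s : El I.comul d (a, y)) :
    I.Coassoc p q r s ↔
      R.comulMor p ▷ F.obj c ≫ R.comulMor q =
        (α_ (F.obj a) (F.obj b) (F.obj c)).hom ≫ F.obj a ◁ R.comulMor r ≫ R.comulMor s := by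
  have hx := (R.coassocRepR_mor_ap (pr q (tp p (ofHom (𝟙 c))))).trans
    (congrArg ((α_ (F.obj a) (F.obj b) (F.obj c)).inv ≫ ·) (R.coassocRepL_mor p q))
  have hy := R.coassocRepR_mor r s
  refine (R.coassocRepR.bijective ((a, b), c) d).1.eq_iff.symm.trans ?_
  rw [← Iso.inv_comp_eq]
  exact ⟨fun e => hx.symm.trans (e.trans hy), fun e => hx.trans (e.trans hy.symm)⟩

/-- The source of the right unit 2-morphism is represented. -/
def runitRep : Rep (A := C × Discrete PUnit.{u + 1}) (B := C) ((𝟙 C ⊠₁ I.one) ≫ I.mul) F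
    (F.prod (𝟭 _ ⋙ (Functor.const (Discrete PUnit.{u + 1})).obj (𝟙_ D)) ⋙ tensor D) :=
  ((Rep.id F).tens R.oneRep).comp (J := F.prod F) R.mulRep

lemma runitRep_mor {x b c : C} (e : El I.one star x) (p : El I.mul (b, x) c) :
    R.runitRep.mor (a := (b, ⟨PUnit.unit⟩)) (pr (tp (ofHom (𝟙 b)) e) p) =
      R.mulMor p ≫ F.obj b ◁ R.oneMor e := by
  have h : R.mulMor p ≫ (F.map (𝟙 b) ⊗ₘ R.oneMor e) = R.mulMor p ≫ F.obj b ◁ R.oneMor e := by simp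
  exact h

/-- The source of the right counit 2-morphism is corepresented. -/
def corunitRep : Corep (A := C × Discrete PUnit.{u + 1}) (B := C) (I.comul ≫ (𝟙 C ⊠₁ I.coone)) F
    (F.prod (𝟭 _ ⋙ (Functor.const (Discrete PUnit.{u + 1})).obj (𝟙_ D)) ⋙ tensor D) :=
  R.comulRep.comp (J := F.prod F) ((Corep.id F).tens R.cooneRep)

/-- The mate of the inverse right unit 2-morphism precomposes with the inverse right unitor, for the
same reason as for coassociativity. -/
lemma map_corho {x b c : C} (e : El I.coone x star) (p : El I.comul c (b, x)) :
    F.map (I.corho e p) = (ρ_ (F.obj b)).inv ≫ F.obj b ◁ R.cooneMor e ≫ R.comulMor p := by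
  have h₁ : CounitCompat ((tensorAdj (Adjunction.id C) I.oneAdj).comp I.mulAdj) R.runitRep R.corunitRep :=
    CounitCompat.comp (A := C ⊠ tensorUnit) (B := C ⊠ C) (C := C) (E := D × D) (D := D) (J := F.prod F)
      (X := F.prod (𝟭 _ ⋙ (Functor.const (Discrete PUnit.{u + 1})).obj (𝟙_ D))) (H := tensor D) (F := F)
      (r := (Rep.id F).tens R.oneRep) (s := (Corep.id F).tens R.cooneRep) (r' := R.mulRep)
      (s' := R.comulRep) ((CounitCompat.id F).tens R.oneCounitCompat) R.mulCounitCompat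
  have h₂ : CounitCompat (rightUnitorAdj C) (Rep.companion (A := C × Discrete PUnit.{u + 1}) (B := C)
      (prod.rightUnitor C) F) (Corep.conjoint (A := C × Discrete PUnit.{u + 1}) (B := C)
        (prod.rightUnitor C) F) :=
    CounitCompat.companion (A := C ⊠ tensorUnit) (B := C) (prod.rightUnitor C) F
  have h := h₁.conjugateEquiv h₂ I.runit.inv (a := (b, ⟨PUnit.unit⟩)) (ρ_ (F.obj b)).inv
    (fun {d} p => ?_) (pr p (tp (ofHom (𝟙 b)) e))
  · refine h.trans (congrArg ((ρ_ (F.obj b)).inv ≫ ·) ?_)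
    have h : (F.map (𝟙 b) ⊗ₘ R.cooneMor e) ≫ R.comulMor p = F.obj b ◁ R.cooneMor e ≫ R.comulMor p := by simp
    exact h
  -- It remains to see that `I.runit.inv` postcomposes with the inverse unitor. The realization
  -- describes `I.runit.hom` on pairs, so the class `ap I.runit.inv p` is written as a pair by means
  -- of a cover of the unit object.
  · let f : F.obj d ⟶ F.obj b ⊗ 𝟙_ D := R.runitRep.mor (a := (b, ⟨PUnit.unit⟩)) (ap I.runit.inv p)
    let r := F.coverRetract (𝟙_ D)
    obtain ⟨e', he⟩ := R.exists_oneMor r.r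
    obtain ⟨p', hp⟩ := R.exists_mulMor (f ≫ F.obj b ◁ r.i)
    have h3 : R.mulMor p' ≫ F.obj b ◁ R.oneMor e' = f := by
      rw [he, hp, Category.assoc, ← MonoidalCategory.whiskerLeft_comp, r.retract]
      simp
    have h4 := R.runitRep.ext (a := (b, ⟨PUnit.unit⟩)) ((R.runitRep_mor e' p').trans h3)
    have h5 : ap I.runit.hom (ap I.runit.inv p) = p :=
      congrArg (fun η => ap η p) I.runit.inv_hom_id
    have h6 : F.map (show d ⟶ b from p) = f ≫ (ρ_ (F.obj b)).hom := by
      rw [← h3, Category.assoc, ← R.map_rho]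
      exact congrArg F.map ((h5.symm.trans (congrArg _ h4.symm)))
    exact (Iso.eq_comp_inv _).2 h6.symm

end MonoidalRealization

/-! ### The coend of a loop and its universal property -/

namespace Prof

section Loop
variable {A B X : Prof.{u}}

lemma act_cupWire {a a' : A} {w w' : (A × X) × Xᵒᵖ} (f : a ⟶ a') (g : w' ⟶ w) (e : w.1.1 ⟶ a)
    (v : w.1.2 ⟶ w.2.unop) :
    act (A := A) (B := (A × X) × Xᵒᵖ) (cupWire A X) f g (e, v) =
      (g.1.1 ≫ e ≫ f, g.1.2 ≫ v ≫ g.2.unop) := by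
  refine (act_tens (Profunctor.id (C := A)) (A' := Discrete PUnit.{u + 1}) (B' := X × Xᵒᵖ) (cup X)
    (x := (a, ⟨PUnit.unit⟩)) (x' := (a', ⟨PUnit.unit⟩)) (y := (w.1.1, (w.1.2, w.2)))
    (y' := (w'.1.1, (w'.1.2, w'.2))) (f, 𝟙 _) (g.1.1, (g.1.2, g.2)) e v).trans ?_
  exact congrArg (Prod.mk (g.1.1 ≫ e ≫ f)) (act_ofAct (A := Discrete PUnit.{u + 1}) (B := X × Xᵒᵖ)
    _ _ _ _ _ _ _)

lemma act_capWire {b b' : B} {w w' : (B × X) × Xᵒᵖ} (f : w ⟶ w') (g : b' ⟶ b) (e : b ⟶ w.1.1)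
    (v : w.2.unop ⟶ w.1.2) :
    act (A := (B × X) × Xᵒᵖ) (B := B) (capWire B X) f g (e, v) =
      (g ≫ e ≫ f.1.1, f.2.unop ≫ v ≫ f.1.2) := by
  refine (act_tens (Profunctor.id (C := B)) (A' := X × Xᵒᵖ) (B' := Discrete PUnit.{u + 1}) (cap X)
    (y := (b, ⟨PUnit.unit⟩)) (y' := (b', ⟨PUnit.unit⟩)) (x := (w.1.1, (w.1.2, w.2)))
    (x' := (w'.1.1, (w'.1.2, w'.2))) (f.1.1, (f.1.2, f.2)) (g, 𝟙 _) e v).trans ?_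
  exact congrArg (Prod.mk (g ≫ e ≫ f.1.1)) (act_ofAct (A := X × Xᵒᵖ) (B := Discrete PUnit.{u + 1})
    _ _ _ _ _ _ _)

variable {P : A ⊠ X ⟶ B ⊠ X}

/-- The action of morphisms on the elements of a 1-morphism between products. -/
def act₂ (P : A ⊠ X ⟶ B ⊠ X) {a a' : A} {b b' : B} {x x' y y' : X} (f : a ⟶ a') (k : x ⟶ x') (g : b' ⟶ b)
    (l : y' ⟶ y) (p : El P (a, x) (b, y)) : El P (a', x') (b', y') :=
  act (A := A × X) (B := B × X) P (a := (a, x)) (a' := (a', x')) (b := (b, y)) (b' := (b', y')) (f, k) (g, l) p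

lemma act₂_id {a : A} {b : B} {x y : X} (p : El P (a, x) (b, y)) :
    act₂ P (𝟙 a) (𝟙 x) (𝟙 b) (𝟙 y) p = p :=
  act_id (A := A × X) (B := B × X) P p

lemma act₂_act₂ {a a' a'' : A} {b b' b'' : B} {x x' x'' y y' y'' : X} (f : a ⟶ a') (f' : a' ⟶ a'')
    (k : x ⟶ x') (k' : x' ⟶ x'') (g : b' ⟶ b) (g' : b'' ⟶ b') (l : y' ⟶ y) (l' : y'' ⟶ y')
    (p : El P (a, x) (b, y)) :
    act₂ P f' k' g' l' (act₂ P f k g l p) = act₂ P (f ≫ f') (k ≫ k') (g' ≫ g) (l' ≫ l) p :=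
  act_act (A := A × X) (B := B × X) P (a := (a, x)) (a' := (a', x')) (a'' := (a'', x''))
      (b := (b, y)) (b' := (b', y')) (b'' := (b'', y'')) (f, k) (f', k') (g, l) (g', l') p

/-- An element of the 1-morphism beside a morphism of the dual. -/
def loopMid {a : A} {b : B} {x y x' y' : X} (p : El P (a, x) (b, y)) (k : x' ⟶ y') :
    El (A := (A × X) × Xᵒᵖ) (B := (B × X) × Xᵒᵖ) (P ⊠₁ 𝟙 (dual X)) ((a, x), op x') ((b, y), op y') :=
  (p, k.op)

lemma act_loopMid {a a' : A} {b b' : B} {x x' y y' z z' t t' : X} (f : a ⟶ a') (l : x ⟶ x') (h : t' ⟶ t)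
    (g : b' ⟶ b) (l' : y' ⟶ y) (h' : z ⟶ z') (p : El P (a, x) (b, y)) (k : t ⟶ z) :
    act (A := (A × X) × Xᵒᵖ) (B := (B × X) × Xᵒᵖ) (P ⊠₁ 𝟙 (dual X)) (a := ((a, x), op t))
      (a' := ((a', x'), op t')) (b := ((b, y), op z)) (b' := ((b', y'), op z'))
      ((f, l), h.op) ((g, l'), h'.op) (loopMid p k) = loopMid (act₂ P f l g l' p) (h ≫ k ≫ h') := by
  refine (act_tens (A := A × X) (B := B × X) (A' := Xᵒᵖ) (B' := Xᵒᵖ) P Profunctor.id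
    (x := ((a, x), op t)) (x' := ((a', x'), op t')) (y := ((b, y), op z)) (y' := ((b', y'), op z')) _ _ p
    k.op).trans ?_
  exact Prod.ext rfl (by simp : h'.op ≫ k.op ≫ h.op = (h ≫ k ≫ h').op)

/-- The right-hand part of the general element of a loop. -/
def loopRight {a₁ : A} {b b₁ : B} {x x' y y' : X} (p : El P (a₁, x) (b₁, y)) (k : x' ⟶ y') (e' : b ⟶ b₁)
    (v' : y' ⟶ y) : El (A := (A × X) × Xᵒᵖ) (B := B) ((P ⊠₁ 𝟙 (dual X)) ≫ capWire B X) ((a₁, x), op x') b :=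
  pair (A := (A × X) × Xᵒᵖ) (B := (B × X) × Xᵒᵖ) (C := B) (P := P ⊠₁ 𝟙 (dual X)) (Q := capWire B X)
    (a := ((a₁, x), op x')) (b := ((b₁, y), op y')) (loopMid p k) (e', v')

/-- The general element of a loop. -/
def loopElt {a a₁ : A} {b b₁ : B} {x x' y y' : X} (e : a₁ ⟶ a) (v : x ⟶ x') (p : El P (a₁, x) (b₁, y))
    (k : x' ⟶ y') (e' : b ⟶ b₁) (v' : y' ⟶ y) : El (loop P) a b :=
  pair (A := A) (B := (A × X) × Xᵒᵖ) (C := B) (P := cupWire A X) (Q := (P ⊠₁ 𝟙 (dual X)) ≫ capWire B X)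
    (b := ((a₁, x), op x')) (e, v) (loopRight p k e' v')

lemma exists_loopElt {a : A} {b : B} (z : El (loop P) a b) :
    ∃ (a₁ : A) (b₁ : B) (x x' y y' : X) (e : a₁ ⟶ a) (v : x ⟶ x') (p : El P (a₁, x) (b₁, y))
      (k : x' ⟶ y') (e' : b ⟶ b₁) (v' : y' ⟶ y), loopElt e v p k e' v' = z := by
  obtain ⟨⟨⟨a₁, x⟩, x'⟩, ⟨e, v⟩, z, rfl⟩ := pair_surj z
  obtain ⟨⟨⟨b₁, y⟩, y'⟩, ⟨p, k⟩, ⟨e', v'⟩, rfl⟩ := pair_surj z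
  exact ⟨a₁, b₁, x, x'.unop, y, y'.unop, e, v, p, Quiver.Hom.unop k, e', v', rfl⟩

lemma loopRight_slide {a₁ : A} {b b₁ b₂ : B} {x x' y y' z z' : X} (p : El P (a₁, x) (b₁, y)) (k : x' ⟶ y')
    (g : b₂ ⟶ b₁) (h : z ⟶ y) (l : y' ⟶ z') (e' : b ⟶ b₂) (v' : z' ⟶ z) :
    loopRight (act₂ P (𝟙 _) (𝟙 _) g h p) (k ≫ l) e' v' = loopRight p k (e' ≫ g) (l ≫ v' ≫ h) := by
  have h₁ := act_loopMid (P := P) (𝟙 _) (𝟙 _) (𝟙 _) g h l p k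
  rw [Category.id_comp] at h₁
  have h₂ := act_capWire (B := B) (X := X) (w := ((b₂, z), op z')) (w' := ((b₁, y), op y'))
    ((g, h), l.op) (𝟙 b) e' v'
  refine (congrArg (fun t => pair (A := (A × X) × Xᵒᵖ) (B := (B × X) × Xᵒᵖ) (C := B) (P := P ⊠₁ 𝟙 (dual X))
    (Q := capWire B X) (a := ((a₁, x), op x')) (b := ((b₂, z), op z')) t (e', v')) h₁).symm.trans ?_
  refine (pair_slide (A := (A × X) × Xᵒᵖ) (B := (B × X) × Xᵒᵖ) (C := B) (P := P ⊠₁ 𝟙 (dual X))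
    (Q := capWire B X) (a := ((a₁, x), op x')) (b := ((b₂, z), op z')) (b' := ((b₁, y), op y')) ((g, h), l.op) (loopMid p k) (e', v')).trans ?_
  refine congrArg (pair (A := (A × X) × Xᵒᵖ) (B := (B × X) × Xᵒᵖ) (C := B) (P := P ⊠₁ 𝟙 (dual X))
    (Q := capWire B X) (a := ((a₁, x), op x')) (b := ((b₁, y), op y')) (loopMid p k)) (h₂.trans ?_)
  exact Prod.ext (Category.id_comp _) rfl

lemma act_loopRight {a₁ a₂ : A} {b b' b₁ : B} {x x' y y' z z' : X} (f : a₁ ⟶ a₂) (l : x ⟶ z) (h : z' ⟶ x')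
    (g : b' ⟶ b) (p : El P (a₁, x) (b₁, y)) (k : x' ⟶ y') (e' : b ⟶ b₁) (v' : y' ⟶ y) :
    act (A := (A × X) × Xᵒᵖ) (B := B) ((P ⊠₁ 𝟙 (dual X)) ≫ capWire B X) (a := ((a₁, x), op x'))
      (a' := ((a₂, z), op z')) ((f, l), h.op) g (loopRight p k e' v') =
    loopRight (act₂ P f l (𝟙 _) (𝟙 _) p) (h ≫ k) (g ≫ e') v' := by
  have h₁ := act_loopMid (P := P) f l h (𝟙 _) (𝟙 _) (𝟙 _) p k
  rw [Category.comp_id] at h₁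
  have h₂ := act_capWire (B := B) (X := X) (w := ((b₁, y), op y')) (w' := ((b₁, y), op y'))
    (𝟙 _) g e' v'
  refine (act_pair (A := (A × X) × Xᵒᵖ) (B := (B × X) × Xᵒᵖ) (C := B) (P := P ⊠₁ 𝟙 (dual X))
    (Q := capWire B X) (a := ((a₁, x), op x')) (b := ((b₁, y), op y')) _ _ (loopMid p k) (e', v')).trans ?_
  refine congrArg₂ (pair (A := (A × X) × Xᵒᵖ) (B := (B × X) × Xᵒᵖ) (C := B) (P := P ⊠₁ 𝟙 (dual X))
    (Q := capWire B X) (a := ((a₂, z), op z')) (b := ((b₁, y), op y'))) h₁ (h₂.trans ?_)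
  exact Prod.ext (by simp : g ≫ e' ≫ 𝟙 _ = g ≫ e') (by simp : 𝟙 _ ≫ v' ≫ 𝟙 _ = v')

lemma loopElt_slide {a a₁ a₂ : A} {b b₁ : B} {x x' y y' z z' : X} (e : a₁ ⟶ a) (v : x ⟶ x')
    (f : a₂ ⟶ a₁) (l : z ⟶ x) (h : x' ⟶ z') (p : El P (a₂, z) (b₁, y)) (k : z' ⟶ y') (e' : b ⟶ b₁)
    (v' : y' ⟶ y) :
    loopElt (f ≫ e) (l ≫ v ≫ h) p k e' v' = loopElt e v (act₂ P f l (𝟙 _) (𝟙 _) p) (h ≫ k) e' v' := by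
  have h₁ := act_cupWire (A := A) (X := X) (w := ((a₁, x), op x')) (w' := ((a₂, z), op z')) (𝟙 a)
        ((f, l), h.op) e v
  have h₂ := act_loopRight f l h (𝟙 b) p k e' v'
  rw [Category.id_comp] at h₂
  refine Eq.trans ?_ ((pair_slide (A := A) (B := (A × X) × Xᵒᵖ) (C := B) (P := cupWire A X)
    (Q := (P ⊠₁ 𝟙 (dual X)) ≫ capWire B X) (b := ((a₂, z), op z')) (b' := ((a₁, x), op x')) ((f, l), h.op) (e, v) (loopRight p k e' v')).trans
    (congrArg (pair (A := A) (B := (A × X) × Xᵒᵖ) (C := B) (P := cupWire A X)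
      (Q := (P ⊠₁ 𝟙 (dual X)) ≫ capWire B X) (b := ((a₁, x), op x')) (e, v)) h₂))
  refine (congrArg (fun t => pair (A := A) (B := (A × X) × Xᵒᵖ) (C := B) (P := cupWire A X)
      (Q := (P ⊠₁ 𝟙 (dual X)) ≫ capWire B X) (b := ((a₂, z), op z')) t (loopRight p k e' v'))
      (h₁.trans ?_)).symm
  exact Prod.ext (by simp : f ≫ e ≫ 𝟙 _ = f ≫ e) rfl

lemma close_eq_loopElt {a : A} {b : B} {x : X} (p : El P (a, x) (b, x)) :
    close p = loopElt (𝟙 a) (𝟙 x) p (𝟙 x) (𝟙 b) (𝟙 x) := rfl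

/-- All morphisms on the wires are pushed into `p`. Those of the cup act on the input, and so does
`k` after it has passed from the dual wire through the cup; those of the cap act on the output. -/
lemma loopElt_eq_close {a a₁ : A} {b b₁ : B} {x x' y y' : X} (e : a₁ ⟶ a) (v : x ⟶ x')
    (p : El P (a₁, x) (b₁, y)) (k : x' ⟶ y') (e' : b ⟶ b₁) (v' : y' ⟶ y) :
    loopElt e v p k e' v' = close (act₂ P e (v ≫ k) e' v' p) := by
  have h₁ := loopElt_slide (𝟙 a) (𝟙 x') e v (𝟙 x') p k e' v'
  have h₂ := loopElt_slide (𝟙 a) (𝟙 x') (𝟙 a) (𝟙 x') k (act₂ P e v (𝟙 _) (𝟙 _) p) (𝟙 y') e' v'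
  have h₃ := loopElt_slide (𝟙 a) (𝟙 y') (𝟙 a) k (𝟙 y') (act₂ P e v (𝟙 _) (𝟙 _) p) (𝟙 y') e' v'
  have h₄ := loopRight_slide (act₂ P e (v ≫ k) (𝟙 _) (𝟙 _) p) (𝟙 y') e' v' (𝟙 y') (𝟙 b) (𝟙 y')
  simp only [Category.comp_id, Category.id_comp, act₂_act₂] at h₁ h₂ h₃ h₄
  rw [h₁, ← h₂, h₃, close_eq_loopElt, loopElt, loopElt, h₄]

/-- A morphism `k` can travel around the loop: put on the dual wire it reaches the input of `p`
through the cup, put on the cap it reaches the output, and the coend over the middle wire identifies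
the two. -/
lemma close_slide {a : A} {b : B} {x y : X} (p : El P (a, x) (b, y)) (k : x ⟶ y) :
    close (act₂ P (𝟙 a) k (𝟙 b) (𝟙 y) p) = close (act₂ P (𝟙 a) (𝟙 x) (𝟙 b) k p) := by
  have h₁ := loopElt_eq_close (𝟙 a) (𝟙 x) p k (𝟙 b) (𝟙 y)
  have h₂ := loopElt_eq_close (𝟙 a) (𝟙 x) p (𝟙 x) (𝟙 b) k
  have h₃ := loopRight_slide p (𝟙 x) (𝟙 _) (𝟙 _) k (𝟙 b) (𝟙 y)
  simp only [Category.comp_id, Category.id_comp, act₂_id] at h₁ h₂ h₃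
  rw [← h₁, ← h₂, loopElt, loopElt, h₃]

lemma exists_close {a : A} {b : B} (z : El (loop P) a b) :
    ∃ (x : X) (p : El P (a, x) (b, x)), close p = z := by
  obtain ⟨a₁, b₁, x, x', y, y', e, v, p, k, e', v', rfl⟩ := exists_loopElt z
  exact ⟨y', _, (loopElt_eq_close e v p k e' v').symm⟩

lemma act_loopElt {a a' a₁ : A} {b b' b₁ : B} {x x' y y' : X} (f : a ⟶ a') (g : b' ⟶ b) (e : a₁ ⟶ a)
    (v : x ⟶ x') (p : El P (a₁, x) (b₁, y)) (k : x' ⟶ y') (e' : b ⟶ b₁) (v' : y' ⟶ y) :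
    act (A := A) (B := B) (loop P) f g (loopElt e v p k e' v') = loopElt (e ≫ f) v p k (g ≫ e') v' := by
  have h₁ := act_cupWire (A := A) (X := X) (w := ((a₁, x), op x')) (w' := ((a₁, x), op x')) f (𝟙 _) e v
  have h₂ := act_loopRight (𝟙 _) (𝟙 _) (𝟙 _) g p k e' v'
  rw [Category.id_comp, act₂_id] at h₂
  refine (act_pair (A := A) (B := (A × X) × Xᵒᵖ) (C := B) (P := cupWire A X)
      (Q := (P ⊠₁ 𝟙 (dual X)) ≫ capWire B X) (b := ((a₁, x), op x')) f g (e, v) _).trans ?_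
  refine congrArg₂ (pair (A := A) (B := (A × X) × Xᵒᵖ) (C := B) (P := cupWire A X)
      (Q := (P ⊠₁ 𝟙 (dual X)) ≫ capWire B X) (b := ((a₁, x), op x'))) (h₁.trans ?_) h₂
  exact Prod.ext (by simp : 𝟙 _ ≫ e ≫ f = e ≫ f) (by simp : 𝟙 _ ≫ v ≫ 𝟙 _ = v)

lemma act_close {a a' : A} {b b' : B} {x : X} (f : a ⟶ a') (g : b' ⟶ b) (p : El P (a, x) (b, x)) :
    act (A := A) (B := B) (loop P) f g (close p) = close (act₂ P f (𝟙 x) g (𝟙 x) p) := by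
  have h := act_loopElt f g (𝟙 a) (𝟙 x) p (𝟙 x) (𝟙 b) (𝟙 x)
  rw [loopElt_eq_close, loopElt_eq_close] at h
  simpa [act₂_id] using h

lemma loop_hom_ext {Q : A ⟶ B} {η θ : loop P ⟶ Q}
    (h : ∀ {a : A} {b : B} {x : X} (p : El P (a, x) (b, x)), ap η (close p) = ap θ (close p)) : η = θ := by
  refine hom_ext (A := A) (B := B) fun a b z => ?_
  obtain ⟨x, p, rfl⟩ := exists_close z
  exact h p

section Desc
variable {Q : A ⟶ B} (φ : ∀ {a : A} {b : B} {x : X}, El P (a, x) (b, x) → El Q a b)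
  (nat : ∀ {a a' : A} {b b' : B} {x : X} (f : a ⟶ a') (g : b' ⟶ b) (p : El P (a, x) (b, x)),
    φ (act₂ P f (𝟙 x) g (𝟙 x) p) = act (A := A) (B := B) Q f g (φ p))
  (slide : ∀ {a : A} {b : B} {x y : X} (p : El P (a, x) (b, y)) (k : x ⟶ y),
    φ (act₂ P (𝟙 a) k (𝟙 b) (𝟙 y) p) = φ (act₂ P (𝟙 a) (𝟙 x) (𝟙 b) k p))

/-- The value on the right-hand part of an element of a loop of a 2-morphism with given values on
closures. -/
def loopVal (slide : ∀ {a : A} {b : B} {x y : X} (p : El P (a, x) (b, y)) (k : x ⟶ y),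
    φ (act₂ P (𝟙 a) k (𝟙 b) (𝟙 y) p) = φ (act₂ P (𝟙 a) (𝟙 x) (𝟙 b) k p)) {a a₁ : A} {b : B} {x x' : X}
    (e : a₁ ⟶ a) (v : x ⟶ x')
    (z : El (A := (A × X) × Xᵒᵖ) (B := B) ((P ⊠₁ 𝟙 (dual X)) ≫ capWire B X) ((a₁, x), op x') b) : El Q a b :=
  Quot.lift (fun t => φ (act₂ P (x' := t.1.2.unop) (b := t.1.1.1) (y := t.1.1.2) (y' := t.1.2.unop) e
    (v ≫ Quiver.Hom.unop (X := t.1.2) (Y := op x') t.2.1.2) t.2.2.1 t.2.2.2 t.2.1.1)) (by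
      rintro _ _ @⟨⟨⟨b₂, z⟩, z'⟩, ⟨⟨b₁, y⟩, y'⟩, ⟨⟨g, h⟩, l⟩, ⟨p, k⟩, ⟨e', v'⟩⟩
      have h₁ := act_loopMid (P := P) (𝟙 _) (𝟙 _) (𝟙 _) g h (Quiver.Hom.unop l) p (Quiver.Hom.unop k)
      have h₂ := act_capWire (B := B) (X := X) (w := ((b₂, z), z')) (w' := ((b₁, y), y'))
        ((g, h), l) (𝟙 b) e' v'
      rw [Category.id_comp] at h₁
      -- The coend relation moves `g` and `h`, for which associativity of the action suffices, and
      -- `l` on the dual wire, for which the hypothesis `slide` is needed.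
      have h₃ := slide (act₂ P e (v ≫ Quiver.Hom.unop k) (e' ≫ g) (v' ≫ h) p) (Quiver.Hom.unop l)
      rw [act₂_act₂, act₂_act₂] at h₃
      simp only [Category.comp_id, Category.id_comp, Category.assoc] at h₃
      refine (congrArg (fun (t : El (A := (A × X) × Xᵒᵖ) (B := (B × X) × Xᵒᵖ) (P ⊠₁ 𝟙 (dual X))
        ((a₁, x), op x') ((b₂, z), z')) => φ (act₂ P (x' := z'.unop) (y' := z'.unop) e (v ≫ Quiver.Hom.unop (X := z')
          (Y := op x') t.2) e' v' t.1)) h₁).trans ?_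
      refine Eq.trans ?_ (congrArg (fun (t : El (A := (B × X) × Xᵒᵖ) (B := B) (capWire B X) ((b₁, y), y') b) =>
        φ (act₂ P (x' := y'.unop) (y' := y'.unop) e (v ≫ Quiver.Hom.unop k) t.1 t.2 p)) h₂).symm
      refine Eq.trans ?_ (h₃.trans ?_)
      · refine (congrArg φ (act₂_act₂ ..)).trans ?_
        simp only [Category.id_comp]
        rfl
      · simp only [Category.id_comp]
        rfl) z

lemma loopVal_loopRight {a a₁ : A} {b b₁ : B} {x x' y y' : X}
    (e : a₁ ⟶ a) (v : x ⟶ x') (p : El P (a₁, x) (b₁, y)) (k : x' ⟶ y') (e' : b ⟶ b₁) (v' : y' ⟶ y) :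
    loopVal φ slide e v (loopRight p k e' v') = φ (act₂ P e (v ≫ k) e' v' p) := rfl

include nat in
lemma loopVal_nat {a a' a₁ : A} {b b' b₁ : B} {x x' y y' : X} (f : a ⟶ a') (g : b' ⟶ b)
    (e : a₁ ⟶ a) (v : x ⟶ x') (p : El P (a₁, x) (b₁, y)) (k : x' ⟶ y') (e' : b ⟶ b₁) (v' : y' ⟶ y) :
    loopVal φ slide (act (A := A) (B := (A × X) × Xᵒᵖ) (cupWire A X) (b := ((a₁, x), op x')) f (𝟙 _) (e, v)).1
      (act (A := A) (B := (A × X) × Xᵒᵖ) (cupWire A X) (b := ((a₁, x), op x')) f (𝟙 _) (e, v)).2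
      (act (A := (A × X) × Xᵒᵖ) (B := B) ((P ⊠₁ 𝟙 (dual X)) ≫ capWire B X) (a := ((a₁, x), op x')) (𝟙 _) g
        (loopRight p k e' v')) =
    act (A := A) (B := B) Q f g (loopVal φ slide e v (loopRight p k e' v')) := by
  have h₁ := act_cupWire (A := A) (X := X) (w := ((a₁, x), op x')) (w' := ((a₁, x), op x')) f (𝟙 _) e v
  have h₂ := act_loopRight (𝟙 _) (𝟙 _) (𝟙 _) g p k e' v'
  rw [Category.id_comp, act₂_id] at h₂
  have h₃ : (𝟙 _ ≫ e ≫ f, 𝟙 _ ≫ v ≫ 𝟙 _) = (e ≫ f, v) :=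
    Prod.ext (by simp : 𝟙 _ ≫ e ≫ f = e ≫ f) (by simp : 𝟙 _ ≫ v ≫ 𝟙 _ = v)
  refine (congrArg₂ (fun (s : (a₁ ⟶ a') × (x ⟶ x')) t => loopVal φ slide s.1 s.2 t) (h₁.trans h₃) h₂).trans ?_
  rw [loopVal_loopRight, loopVal_loopRight, ← nat, act₂_act₂, Category.comp_id, Category.id_comp]

/-- The coend at the cup needs only associativity of the action, since all three morphisms `f`, `l`,
`h` end up on the input of `p`. -/
lemma loopVal_slide {a a₁ a₂ : A} {b b₁ : B} {x x' y y' z z' : X} (e : a₁ ⟶ a) (v : x ⟶ x')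
    (f : a₂ ⟶ a₁) (l : z ⟶ x) (h : x' ⟶ z') (p : El P (a₂, z) (b₁, y)) (k : z' ⟶ y') (e' : b ⟶ b₁)
    (v' : y' ⟶ y) :
    loopVal φ slide (act (A := A) (B := (A × X) × Xᵒᵖ) (cupWire A X) (b := ((a₁, x), op x'))
        (b' := ((a₂, z), op z')) (𝟙 a) ((f, l), h.op) (e, v)).1
      (act (A := A) (B := (A × X) × Xᵒᵖ) (cupWire A X) (b := ((a₁, x), op x'))
        (b' := ((a₂, z), op z')) (𝟙 a) ((f, l), h.op) (e, v)).2 (loopRight p k e' v') =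
    loopVal φ slide e v (act (A := (A × X) × Xᵒᵖ) (B := B) ((P ⊠₁ 𝟙 (dual X)) ≫ capWire B X)
      (a := ((a₂, z), op z')) (a' := ((a₁, x), op x')) ((f, l), h.op) (𝟙 b) (loopRight p k e' v')) := by
  have h₁ := act_cupWire (A := A) (X := X) (w := ((a₁, x), op x')) (w' := ((a₂, z), op z')) (𝟙 a)
        ((f, l), h.op) e v
  have h₂ := act_loopRight f l h (𝟙 b) p k e' v'
  refine (congrArg (fun (s : (a₂ ⟶ a) × (z ⟶ z')) => loopVal φ slide s.1 s.2 (loopRight p k e' v')) h₁).trans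
    (Eq.trans ?_ (congrArg (loopVal φ slide e v) h₂).symm)
  refine (loopVal_loopRight φ slide _ _ _ _ _ _).trans (Eq.trans ?_ (loopVal_loopRight φ slide _ _ _ _ _ _).symm)
  rw [act₂_act₂]
  exact congrArg φ (by simp : act₂ P (f ≫ e ≫ 𝟙 a) ((l ≫ v ≫ h) ≫ k) e' v' p = _)

/-- The universal property of the loop. -/
def loopDesc : loop P ⟶ Q :=
  desc (A := A) (B := (A × X) × Xᵒᵖ) (C := B) (P := cupWire A X) (Q := (P ⊠₁ 𝟙 (dual X)) ≫ capWire B X)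
    (R := Q) (fun {a w b} s z => loopVal φ slide (a₁ := w.1.1) (x := w.1.2) (x' := w.2.unop) s.1 s.2 z)
    (by
      rintro a a' ⟨⟨a₁, x⟩, x'⟩ b b' f g ⟨e, v⟩ z
      obtain ⟨⟨⟨b₁, y⟩, y'⟩, ⟨p, k⟩, ⟨e', v'⟩, rfl⟩ := pair_surj z
      exact loopVal_nat φ nat slide f g e v p (Quiver.Hom.unop k) e' v')
    (by
      rintro a ⟨⟨a₂, z⟩, z'⟩ ⟨⟨a₁, x⟩, x'⟩ b ⟨⟨f, l⟩, h⟩ ⟨e, v⟩ t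
      obtain ⟨⟨⟨b₁, y⟩, y'⟩, ⟨p, k⟩, ⟨e', v'⟩, rfl⟩ := pair_surj t
      exact loopVal_slide φ slide e v f l (Quiver.Hom.unop h) p (Quiver.Hom.unop k) e' v')

lemma ap_loopDesc {a : A} {b : B} {x : X} (p : El P (a, x) (b, x)) :
    ap (loopDesc φ nat slide) (close p) = φ p := by
  have h : act₂ P (𝟙 a) (𝟙 x ≫ 𝟙 x) (𝟙 b) (𝟙 x) p = p := by rw [Category.id_comp, act₂_id]
  exact congrArg φ h

end Desc

end Loop
end Prof

/-! ### Trace operations and retracts -/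

section TraceExtension
open MonoidalCategory

variable {D : Type u} [SmallCategory D] [MonoidalCategory D]

namespace TraceOperator

/-- Sliding `r.i` around the loop brings it in front of `r.r`, where the two cancel. -/
lemma tr_retract (τ : TraceOperator D) {a b x x' : D} (r : Retract x x') (f : a ⊗ x ⟶ b ⊗ x) :
    τ.tr x f = τ.tr x' (a ◁ r.r ≫ f ≫ b ◁ r.i) := by
  rw [← Category.assoc, τ.sliding, ← Category.assoc, ← MonoidalCategory.whiskerLeft_comp, r.retract,
    MonoidalCategory.whiskerLeft_id, Category.id_comp]

lemma tr_retract_ends (τ : TraceOperator D) {a a' b b' x : D} (r : Retract a a') (s : Retract b b')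
    (f : a ⊗ x ⟶ b ⊗ x) : τ.tr x f = r.i ≫ τ.tr x (r.r ▷ x ≫ f ≫ s.i ▷ x) ≫ s.r := by
  rw [τ.tightening, Category.assoc, Category.assoc, s.retract, Category.comp_id, r.retract_assoc]

/-- Tightening and sliding alone express every trace by traces at objects of which the given ones
are retracts. This forces the extension of an operation from image objects, and later handles
conjugation by isomorphisms. -/
lemma tr_retract_all (τ : TraceOperator D) {a a' b b' x x' : D} (r : Retract a a') (s : Retract b b')
    (t : Retract x x') (f : a ⊗ x ⟶ b ⊗ x) :
    τ.tr x f = r.i ≫ τ.tr x' ((r.r ⊗ₘ t.r) ≫ f ≫ (s.i ⊗ₘ t.i)) ≫ s.r := by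
  rw [τ.tr_retract_ends r s, τ.tr_retract t, tensorHom_def' r.r, MonoidalCategory.tensorHom_def s.i]
  simp only [Category.assoc]

@[ext]
lemma ext {τ τ' : TraceOperator D} (h : ∀ {a b : D} (x : D) (f : a ⊗ x ⟶ b ⊗ x), τ.tr x f = τ'.tr x f) :
    τ = τ' := by
  obtain ⟨t, _, _⟩ := τ
  obtain ⟨t', _, _⟩ := τ'
  congr
  funext a b x f
  exact h x f

variable {C : Type u} [SmallCategory C] (F : C ⥤ D) [F.RetractDense]

lemma ext_of_retractDense {τ τ' : TraceOperator D}
    (h : ∀ {a b x : C} (f : F.obj a ⊗ F.obj x ⟶ F.obj b ⊗ F.obj x), τ.tr (F.obj x) f = τ'.tr (F.obj x) f) :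
    τ = τ' := by
  ext a b x f
  rw [τ.tr_retract_ends (F.coverRetract a) (F.coverRetract b), τ.tr_retract (F.coverRetract x), h,
    τ'.tr_retract_ends (F.coverRetract a) (F.coverRetract b), τ'.tr_retract (F.coverRetract x)]

/-- A tensor product of image objects need not be an image object, so the hypothesis traces over
`F.obj x ⊗ F.obj z` itself. The general case follows by writing `x ⊗ z` as a retract of the tensor
product of the covers and moving the retractions past the associators. -/
lemma vanishTensor_of_retractDense {τ : TraceOperator D}
    (h : ∀ {a b x z : C} (f : F.obj a ⊗ (F.obj x ⊗ F.obj z) ⟶ F.obj b ⊗ (F.obj x ⊗ F.obj z)),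
      τ.tr (F.obj x ⊗ F.obj z) f = τ.tr (F.obj x) (τ.tr (F.obj z)
        ((α_ (F.obj a) (F.obj x) (F.obj z)).hom ≫ f ≫ (α_ (F.obj b) (F.obj x) (F.obj z)).inv))) :
    τ.VanishTensor := by
  intro a b x z f
  let ra := F.coverRetract a
  let rb := F.coverRetract b
  let rx := F.coverRetract x
  let rz := F.coverRetract z
  let rxz : Retract (x ⊗ z) (F.obj (F.cover x) ⊗ F.obj (F.cover z)) :=
    ⟨rx.i ⊗ₘ rz.i, rx.r ⊗ₘ rz.r, by rw [tensorHom_comp_tensorHom, rx.retract, rz.retract, id_tensorHom_id]⟩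
  rw [τ.tr_retract_all ra rb rxz, h, τ.tr_retract_all ra rb rx, ← τ.tightening (ra.r ⊗ₘ rx.r) _ (rb.i ⊗ₘ rx.i),
    τ.tr_retract rz]
  have h₁ := associator_naturality ra.r rx.r rz.r
  have h₂ := associator_inv_naturality rb.i rx.i rz.i
  have h₃ := tensorHom_def' (ra.r ⊗ₘ rx.r) rz.r
  have h₄ := MonoidalCategory.tensorHom_def (rb.i ⊗ₘ rx.i) rz.i
  simp only [Category.assoc]
  rw [h₂, h₄, ← reassoc_of% h₁, h₃]
  simp only [Category.assoc]

/-- The hypothesis is applied to `g` and `f` conjugated by the retracts of all five objects;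
naturality of the associator gathers the retractions at the ends, where they cancel. -/
lemma superpose_of_retractDense {τ : TraceOperator D}
    (h : ∀ {a b c d x : C} (g : F.obj c ⟶ F.obj d) (f : F.obj a ⊗ F.obj x ⟶ F.obj b ⊗ F.obj x),
      τ.tr (F.obj x) ((α_ (F.obj c) (F.obj a) (F.obj x)).hom ≫ (g ⊗ₘ f) ≫
        (α_ (F.obj d) (F.obj b) (F.obj x)).inv) = g ⊗ₘ τ.tr (F.obj x) f) :
    τ.Superpose := by
  intro a b c d x g f
  let ra := F.coverRetract a
  let rb := F.coverRetract b
  let rc := F.coverRetract c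
  let rd := F.coverRetract d
  let rx := F.coverRetract x
  let rca : Retract (c ⊗ a) (F.obj (F.cover c) ⊗ F.obj (F.cover a)) :=
    ⟨rc.i ⊗ₘ ra.i, rc.r ⊗ₘ ra.r, by rw [tensorHom_comp_tensorHom, rc.retract, ra.retract, id_tensorHom_id]⟩
  let rdb : Retract (d ⊗ b) (F.obj (F.cover d) ⊗ F.obj (F.cover b)) :=
    ⟨rd.i ⊗ₘ rb.i, rd.r ⊗ₘ rb.r, by rw [tensorHom_comp_tensorHom, rd.retract, rb.retract, id_tensorHom_id]⟩
  have h₀ := h (rc.r ≫ g ≫ rd.i) ((ra.r ⊗ₘ rx.r) ≫ f ≫ (rb.i ⊗ₘ rx.i))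
  have h₁ := associator_naturality rc.r ra.r rx.r
  have h₂ := associator_inv_naturality rd.i rb.i rx.i
  rw [τ.tr_retract_all rca rdb rx, τ.tr_retract_all ra rb rx f]
  simp only [Category.assoc]
  rw [← h₂, reassoc_of% h₁]
  simp only [← tensorHom_comp_tensorHom, ← tensorHom_comp_tensorHom_assoc, Category.assoc] at h₀
  rw [h₀]
  simp only [rca, rdb, tensorHom_comp_tensorHom, Category.assoc, Retract.retract, Retract.retract_assoc, Category.comp_id]

/-- The extension of a trace operation on the objects in the image of a functor. -/
noncomputable def extend
    (t : ∀ {a b x : C}, (F.obj a ⊗ F.obj x ⟶ F.obj b ⊗ F.obj x) → (F.obj a ⟶ F.obj b))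
    (tight : ∀ {a a' b b' x : C} (g : F.obj a' ⟶ F.obj a) (f : F.obj a ⊗ F.obj x ⟶ F.obj b ⊗ F.obj x)
      (h : F.obj b ⟶ F.obj b'), t (g ▷ F.obj x ≫ f ≫ h ▷ F.obj x) = g ≫ t f ≫ h)
    (slide : ∀ {a b x y : C} (f : F.obj a ⊗ F.obj x ⟶ F.obj b ⊗ F.obj y) (g : F.obj y ⟶ F.obj x),
      t (f ≫ F.obj b ◁ g) = t (F.obj a ◁ g ≫ f)) : TraceOperator D where
  -- The formula is the one forced by `tr_retract_all`.
  tr {a b} x f := (F.coverRetract a).i ≫ t (((F.coverRetract a).r ⊗ₘ (F.coverRetract x).r) ≫ f ≫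
    ((F.coverRetract b).i ⊗ₘ (F.coverRetract x).i)) ≫ (F.coverRetract b).r
  tightening {a a' b b' x} g f h := by
    have := tight ((F.coverRetract a').r ≫ g ≫ (F.coverRetract a).i)
      (((F.coverRetract a).r ⊗ₘ (F.coverRetract x).r) ≫ f ≫
        ((F.coverRetract b).i ⊗ₘ (F.coverRetract x).i)) ((F.coverRetract b).r ≫ h ≫ (F.coverRetract b').i)
    have h₁ : ((F.coverRetract a').r ≫ g ≫ (F.coverRetract a).i) ▷ F.obj (F.cover x) ≫
        ((F.coverRetract a).r ⊗ₘ (F.coverRetract x).r) = ((F.coverRetract a').r ⊗ₘ (F.coverRetract x).r) ≫ g ▷ x := by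
      simp only [← tensorHom_id, ← id_tensorHom, tensorHom_comp_tensorHom, Category.assoc, Retract.retract,
        Retract.retract_assoc, Category.comp_id, Category.id_comp]
    have h₂ : ((F.coverRetract b).i ⊗ₘ (F.coverRetract x).i) ≫ ((F.coverRetract b).r ≫ h ≫ (F.coverRetract b').i) ▷ F.obj (F.cover x) =
        h ▷ x ≫ ((F.coverRetract b').i ⊗ₘ (F.coverRetract x).i) := by
      simp only [← tensorHom_id, ← id_tensorHom, tensorHom_comp_tensorHom, Category.assoc, Retract.retract,
        Retract.retract_assoc, Category.comp_id, Category.id_comp]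
    simp only [Category.assoc, h₂, reassoc_of% h₁] at this
    simp only [Category.assoc, this, Retract.retract, Retract.retract_assoc, Category.comp_id]
  sliding {a b x y} f g := by
    have := slide (((F.coverRetract a).r ⊗ₘ (F.coverRetract x).r) ≫ f ≫
        ((F.coverRetract b).i ⊗ₘ (F.coverRetract y).i)) ((F.coverRetract y).r ≫ g ≫ (F.coverRetract x).i)
    have h₁ : F.obj (F.cover a) ◁ ((F.coverRetract y).r ≫ g ≫ (F.coverRetract x).i) ≫
        ((F.coverRetract a).r ⊗ₘ (F.coverRetract x).r) = ((F.coverRetract a).r ⊗ₘ (F.coverRetract y).r) ≫ a ◁ g := by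
      simp only [← tensorHom_id, ← id_tensorHom, tensorHom_comp_tensorHom, Category.assoc, Retract.retract,
        Retract.retract_assoc, Category.comp_id, Category.id_comp]
    have h₂ : ((F.coverRetract b).i ⊗ₘ (F.coverRetract y).i) ≫ F.obj (F.cover b) ◁ ((F.coverRetract y).r ≫ g ≫ (F.coverRetract x).i) =
        b ◁ g ≫ ((F.coverRetract b).i ⊗ₘ (F.coverRetract x).i) := by
      simp only [← tensorHom_id, ← id_tensorHom, tensorHom_comp_tensorHom, Category.assoc, Retract.retract,
        Retract.retract_assoc, Category.comp_id, Category.id_comp]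
    simp only [Category.assoc, h₂, reassoc_of% h₁] at this
    simp only [Category.assoc, this]

/-- The chosen cover of `F.obj x` need not be `x`; tightening and sliding of `t` remove the
superfluous retractions. -/
lemma extend_tr
    (t : ∀ {a b x : C}, (F.obj a ⊗ F.obj x ⟶ F.obj b ⊗ F.obj x) → (F.obj a ⟶ F.obj b))
    (tight slide) {a b x : C} (f : F.obj a ⊗ F.obj x ⟶ F.obj b ⊗ F.obj x) :
    (extend F t tight slide).tr (F.obj x) f = t f := by
  have h₁ := tight (F.coverRetract (F.obj a)).r
    (F.obj a ◁ (F.coverRetract (F.obj x)).r ≫ f ≫ F.obj b ◁ (F.coverRetract (F.obj x)).i)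
    (F.coverRetract (F.obj b)).i
  have h₂ := slide (F.obj a ◁ (F.coverRetract (F.obj x)).r ≫ f) (F.coverRetract (F.obj x)).i
  rw [← Category.assoc, ← MonoidalCategory.whiskerLeft_comp, Retract.retract,
    MonoidalCategory.whiskerLeft_id, Category.id_comp, Category.assoc] at h₂
  rw [h₂] at h₁
  have h₃ : ((F.coverRetract (F.obj a)).r ⊗ₘ (F.coverRetract (F.obj x)).r) ≫ f ≫
      ((F.coverRetract (F.obj b)).i ⊗ₘ (F.coverRetract (F.obj x)).i) =
      (F.coverRetract (F.obj a)).r ▷ F.obj (F.cover (F.obj x)) ≫ (F.obj a ◁ (F.coverRetract (F.obj x)).r ≫ f ≫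
        F.obj b ◁ (F.coverRetract (F.obj x)).i) ≫ (F.coverRetract (F.obj b)).i ▷ F.obj (F.cover (F.obj x)) := by
    rw [MonoidalCategory.tensorHom_def, MonoidalCategory.tensorHom_def']
    simp only [Category.assoc]
  change _ ≫ t _ ≫ _ = _
  rw [h₃, h₁]
  simp

end TraceOperator

end TraceExtension

/-! ### Trace 2-morphisms and trace operations -/

namespace MonoidalRealization
open MonoidalCategory

variable {C D : Prof.{u}} {F : C ⥤ D} [MonoidalCategory D] {I : RightAdjointPseudomonoid C}
  (R : MonoidalRealization F I) [F.Full] [F.Faithful] [F.RetractDense]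

/-- The morphism given by an element of the multiplication followed by the comultiplication. -/
def midMor {a b x y : C} (z : El (I.mul ≫ I.comul) (b, x) (a, y)) : F.obj a ⊗ F.obj y ⟶ F.obj b ⊗ F.obj x :=
  compMor R.mulRep R.comulRep (a := (b, x)) (a' := (a, y)) z

lemma midMor_injective {a b x y : C} {z z' : El (I.mul ≫ I.comul) (b, x) (a, y)}
    (h : R.midMor z = R.midMor z') : z = z' :=
  (compMor_bijective R.mulRep R.comulRep (b, x) (a, y)).1 h

lemma exists_midMor {a b x y : C} (f : F.obj a ⊗ F.obj y ⟶ F.obj b ⊗ F.obj x) :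
    ∃ z : El (I.mul ≫ I.comul) (b, x) (a, y), R.midMor z = f :=
  (compMor_bijective R.mulRep R.comulRep (b, x) (a, y)).2 f

lemma exists_comulMor_comp_mulMor {a b x y : C} (f : F.obj a ⊗ F.obj y ⟶ F.obj b ⊗ F.obj x) :
    ∃ (w : C) (p : El I.mul (b, x) w) (q : El I.comul w (a, y)), R.comulMor q ≫ R.mulMor p = f := by
  obtain ⟨z, rfl⟩ := R.exists_midMor f
  obtain ⟨w, p, q, rfl⟩ := pair_surj z
  exact ⟨w, p, q, rfl⟩

lemma midMor_act₂ {a a' b b' x x' y y' : C} (f : b ⟶ b') (k : x ⟶ x') (g : a' ⟶ a) (l : y' ⟶ y)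
    (z : El (I.mul ≫ I.comul) (b, x) (a, y)) :
    R.midMor (act₂ (I.mul ≫ I.comul) f k g l z) =
      (F.map g ⊗ₘ F.map l) ≫ R.midMor z ≫ (F.map f ⊗ₘ F.map k) :=
  compMor_act R.mulRep R.comulRep (a := (b, x)) (b := (b', x')) (a' := (a, y)) (b' := (a', y')) (f, k) (g, l) z

/-- Tightening is naturality in the open wires. -/
lemma preimage_tr_act (τ : TraceOperator D) {a a' b b' x : C} (f : b ⟶ b') (g : a' ⟶ a)
    (z : El (I.mul ≫ I.comul) (b, x) (a, x)) :
    F.preimage (τ.tr (F.obj x) (R.midMor (act₂ (I.mul ≫ I.comul) f (𝟙 x) g (𝟙 x) z))) =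
      g ≫ F.preimage (τ.tr (F.obj x) (R.midMor z)) ≫ f := by
  refine F.map_injective ((F.map_preimage _).trans ?_)
  rw [midMor_act₂, F.map_id, tensorHom_id, tensorHom_id, τ.tightening]
  simp

/-- Sliding is what makes the trace well defined on the coend of the loop. -/
lemma tr_slide (τ : TraceOperator D) {a b x y : C} (z : El (I.mul ≫ I.comul) (b, x) (a, y)) (k : x ⟶ y) :
    τ.tr (F.obj y) (R.midMor (act₂ (I.mul ≫ I.comul) (𝟙 b) k (𝟙 a) (𝟙 y) z)) =
      τ.tr (F.obj x) (R.midMor (act₂ (I.mul ≫ I.comul) (𝟙 b) (𝟙 x) (𝟙 a) k z)) := by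
  have h₁ := R.midMor_act₂ (𝟙 b) k (𝟙 a) (𝟙 y) z
  have h₂ := R.midMor_act₂ (𝟙 b) (𝟙 x) (𝟙 a) k z
  rw [h₁, h₂]
  simp only [F.map_id, id_tensorHom, tensorHom_id, MonoidalCategory.id_whiskerRight,
    MonoidalCategory.whiskerLeft_id, Category.id_comp, Category.comp_id]
  exact τ.sliding _ _

/-- The 2-morphism of profunctors given by a trace operation. -/
noncomputable def traceHom (τ : TraceOperator D) : I.traceLoop ⟶ 𝟙 C :=
  loopDesc (P := I.mul ≫ I.comul) (Q := 𝟙 C)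
    (fun {b a x} z => (F.preimage (τ.tr (F.obj x) (R.midMor z)) : a ⟶ b))
    (fun f g z => R.preimage_tr_act τ f g z) (fun z k => congrArg F.preimage (R.tr_slide τ z k))

lemma traceCompat_traceHom (τ : TraceOperator D) : R.TraceCompat (R.traceHom τ) τ := by
  intro a b x y p q
  have h : I.trAt (R.traceHom τ) p q = F.preimage (τ.tr (F.obj x) (R.midMor (pr p q))) :=
    ap_loopDesc (P := I.mul ≫ I.comul) (Q := 𝟙 C)
      (fun {b a x} z => (F.preimage (τ.tr (F.obj x) (R.midMor z)) : a ⟶ b))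
      (fun f g z => R.preimage_tr_act τ f g z) (fun z k => congrArg F.preimage (R.tr_slide τ z k)) (pr p q)
  exact (congrArg F.map h).trans (F.map_preimage _)

variable {R} in
lemma TraceCompat.map_ap {T : I.traceLoop ⟶ 𝟙 C} {τ : TraceOperator D} (h : R.TraceCompat T τ) {a b x : C}
    (z : El (I.mul ≫ I.comul) (b, x) (a, x)) :
    F.map (show a ⟶ b from ap T (close z)) = τ.tr (F.obj x) (R.midMor z) := by
  obtain ⟨y, p, q, rfl⟩ := pair_surj z
  exact h p q

variable {R} in
lemma TraceCompat.map_trAt {T : I.traceLoop ⟶ 𝟙 C} {τ : TraceOperator D} (h : R.TraceCompat T τ) {a b x y : C}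
    (p : El I.mul (b, x) y) (q : El I.comul y (a, x)) :
    F.map (I.trAt T p q) = τ.tr (F.obj x) (R.comulMor q ≫ R.mulMor p) := h p q

variable {R} in
lemma TraceCompat.eq_of_traceCompat {T T' : I.traceLoop ⟶ 𝟙 C} {τ : TraceOperator D} (h : R.TraceCompat T τ)
    (h' : R.TraceCompat T' τ) : T = T' :=
  loop_hom_ext fun z => F.map_injective ((h.map_ap z).trans (h'.map_ap z).symm)

variable {R} in
-- At image objects every morphism is `midMor` of an element, so `T` determines the operation there,
-- and retracts determine it everywhere.
lemma TraceCompat.eq_of_traceCompat' {T : I.traceLoop ⟶ 𝟙 C} {τ τ' : TraceOperator D} (h : R.TraceCompat T τ)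
    (h' : R.TraceCompat T τ') : τ = τ' :=
  TraceOperator.ext_of_retractDense F fun f => by
    obtain ⟨z, rfl⟩ := R.exists_midMor f
    exact (h.map_ap z).symm.trans (h'.map_ap z)

/-- The trace of a morphism between tensor products of objects in the image, given by a 2-morphism. -/
noncomputable def imageTrace (T : I.traceLoop ⟶ 𝟙 C) {a b x : C} (f : F.obj a ⊗ F.obj x ⟶ F.obj b ⊗ F.obj x) :
    F.obj a ⟶ F.obj b :=
  F.map (show a ⟶ b from ap T (close (R.exists_midMor f).choose))

/-- Since `midMor` is injective, the element chosen in `imageTrace` is the given one. -/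
lemma imageTrace_midMor (T : I.traceLoop ⟶ 𝟙 C) {a b x : C} (z : El (I.mul ≫ I.comul) (b, x) (a, x)) :
    R.imageTrace T (R.midMor z) = F.map (show a ⟶ b from ap T (close z)) := by
  have h := R.midMor_injective (R.exists_midMor (R.midMor z)).choose_spec
  exact congrArg (fun z => F.map (show a ⟶ b from ap T (close z))) h

/-- The trace operation given by a 2-morphism of profunctors. -/
noncomputable def traceOperator (T : I.traceLoop ⟶ 𝟙 C) : TraceOperator D :=
  TraceOperator.extend F (R.imageTrace T)
    (by
      intro a a' b b' x g f h
      obtain ⟨z, rfl⟩ := R.exists_midMor f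
      obtain ⟨g, rfl⟩ := F.map_surjective g
      obtain ⟨h, rfl⟩ := F.map_surjective h
      have h₁ := R.midMor_act₂ h (𝟙 x) g (𝟙 x) z
      rw [F.map_id, tensorHom_id, tensorHom_id] at h₁
      rw [← h₁, imageTrace_midMor, imageTrace_midMor]
      -- Tightening is the naturality of `T`.
      have h₂ : ap T (close (act₂ (I.mul ≫ I.comul) h (𝟙 x) g (𝟙 x) z)) =
          act (A := C) (B := C) (𝟙 C) h g (ap T (close z)) :=
        (congrArg (ap T) (act_close h g z).symm).trans (app_act (A := C) (B := C) T h g (close z))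
      refine (congrArg F.map h₂).trans ?_
      have h₃ (k : a ⟶ b) : F.map (g ≫ k ≫ h) = F.map g ≫ F.map k ≫ F.map h := by simp
      exact h₃ _)
    (by
      intro a b x y f g
      obtain ⟨z, rfl⟩ := R.exists_midMor f
      obtain ⟨g, rfl⟩ := F.map_surjective g
      have h₁ := R.midMor_act₂ (𝟙 b) g (𝟙 a) (𝟙 x) z
      have h₂ := R.midMor_act₂ (𝟙 b) (𝟙 y) (𝟙 a) g z
      simp only [F.map_id, id_tensorHom, tensorHom_id, MonoidalCategory.id_whiskerRight,
        MonoidalCategory.whiskerLeft_id, Category.id_comp, Category.comp_id] at h₁ h₂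
      rw [← h₁, ← h₂, imageTrace_midMor, imageTrace_midMor]
      -- Sliding holds because the two closures are the same element of the coend, whatever `T` is.
      exact congrArg (fun t => F.map (show a ⟶ b from ap T t)) (close_slide z g))

lemma traceCompat_traceOperator (T : I.traceLoop ⟶ 𝟙 C) : R.TraceCompat T (R.traceOperator T) := by
  intro a b x y p q
  exact (R.imageTrace_midMor T (pr p q)).symm.trans (TraceOperator.extend_tr F (R.imageTrace T) _ _ _).symm

lemma exists_mul_mul' {a b c d : C} (f : F.obj d ⟶ F.obj a ⊗ (F.obj b ⊗ F.obj c)) :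
    ∃ (x : C) (p : El I.mul (b, c) x) (q : El I.mul (a, x) d), R.mulMor q ≫ F.obj a ◁ R.mulMor p = f := by
  let ρ := F.coverRetract (F.obj b ⊗ F.obj c)
  obtain ⟨p, hp⟩ := R.exists_mulMor ρ.r
  obtain ⟨q, hq⟩ := R.exists_mulMor (f ≫ F.obj a ◁ ρ.i)
  refine ⟨_, p, q, ?_⟩
  rw [hp, hq, Category.assoc, ← MonoidalCategory.whiskerLeft_comp, ρ.retract]
  simp

lemma exists_comul_comul' {a b c d : C} (f : F.obj a ⊗ (F.obj b ⊗ F.obj c) ⟶ F.obj d) :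
    ∃ (x : C) (p : El I.comul x (b, c)) (q : El I.comul d (a, x)),
      F.obj a ◁ R.comulMor p ≫ R.comulMor q = f := by
  let ρ := F.coverRetract (F.obj b ⊗ F.obj c)
  obtain ⟨p, hp⟩ := R.exists_comulMor ρ.i
  obtain ⟨q, hq⟩ := R.exists_comulMor (F.obj a ◁ ρ.r ≫ f)
  refine ⟨_, p, q, ?_⟩
  rw [hp, hq, ← Category.assoc, ← MonoidalCategory.whiskerLeft_comp, ρ.retract]
  simp

/-! ### The three equations and the three trace axioms -/

section Axioms
variable {R} {T : I.traceLoop ⟶ 𝟙 C} {τ : TraceOperator D} (h : R.TraceCompat T τ)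
include h

/-- Sliding `cooneMor e'` around the loop turns the elementwise equation into the axiom for one
morphism `F.obj a ⊗ 𝟙_ D ⟶ F.obj b ⊗ 𝟙_ D`. All such morphisms occur, since the unit object is a
retract of an image object; tightening then reaches arbitrary ends. -/
theorem TraceCompat.vanishUnit_iff : I.VanishUnit T ↔ τ.VanishUnit := by
  have key {a b x x' y : C} (p : El I.mul (b, x) y) (e : El I.one star x)
      (p' : El I.comul y (a, x')) (e' : El I.coone x' star) :
      I.trAt T (I.actMul (𝟙 b) (I.oneCounit e' e) (𝟙 y) p) p' = I.corho e' p' ≫ I.rho e p ↔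
      τ.tr (𝟙_ D) (F.obj a ◁ R.cooneMor e' ≫ (R.comulMor p' ≫ R.mulMor p) ≫ F.obj b ◁ R.oneMor e) =
        (ρ_ (F.obj a)).inv ≫ (F.obj a ◁ R.cooneMor e' ≫ (R.comulMor p' ≫ R.mulMor p) ≫
          F.obj b ◁ R.oneMor e) ≫ (ρ_ (F.obj b)).hom := by
    rw [← F.map_injective.eq_iff, h.map_trAt, R.mulMor_actMul, F.map_comp, R.map_corho, R.map_rho,
      R.map_oneCounit]
    have h₁ := τ.sliding ((R.comulMor p' ≫ R.mulMor p) ≫ F.obj b ◁ R.oneMor e) (R.cooneMor e')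
    rw [← h₁]
    simp
  constructor
  · intro H a b f
    have H' {a b : C} (f : F.obj a ⊗ 𝟙_ D ⟶ F.obj b ⊗ 𝟙_ D) :
        τ.tr (𝟙_ D) f = (ρ_ (F.obj a)).inv ≫ f ≫ (ρ_ (F.obj b)).hom := by
      -- `e` and `e'` are taken to be the retraction and the section of the unit object, so that
      -- they cancel against the copies placed around `f`.
      let r := F.coverRetract (𝟙_ D)
      obtain ⟨e, he⟩ := R.exists_oneMor r.r
      obtain ⟨e', he'⟩ := R.exists_cooneMor r.i
      obtain ⟨w, p, q, hpq⟩ := R.exists_comulMor_comp_mulMor (F.obj a ◁ r.r ≫ f ≫ F.obj b ◁ r.i)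
      have h₁ := (key p e q e').1 (H p e q e')
      have h₂ (a : C) : F.obj a ◁ r.i ≫ F.obj a ◁ r.r = 𝟙 _ := by
        rw [← MonoidalCategory.whiskerLeft_comp, r.retract, MonoidalCategory.whiskerLeft_id]
      rw [hpq, he, he'] at h₁
      simpa only [Category.assoc, h₂, reassoc_of% h₂, Category.comp_id] using h₁
    rw [τ.tr_retract_ends (F.coverRetract a) (F.coverRetract b), H']
    simp
  · intro H a b x x' y p e p' e'
    exact (key p e p' e').2 (H _)

/-- Tightening draws `p` and `p'` into the inner trace. On the other side, sliding `comulMor r'`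
around the loop turns the trace over an image object into one over `F.obj x ⊗ F.obj z`. The
relations `Assoc` and `Coassoc` say that the two morphisms to be traced differ by the associators.
-/
theorem TraceCompat.vanishTensor_iff : I.VanishTensor T ↔ τ.VanishTensor := by
  have key {a b x z y y' w v v' : C} (p : El I.mul (b, x) y) (q : El I.mul (y, z) w)
      (q' : El I.comul w (y', z)) (p' : El I.comul y' (a, x))
      (r : El I.mul (x, z) v) (s : El I.mul (b, v) w)
      (r' : El I.comul v' (x, z)) (s' : El I.comul w (a, v'))
      (h₁ : I.Assoc p q r s) (h₂ : I.Coassoc p' q' r' s') :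
      I.trAt T (I.actMul (𝟙 b) (𝟙 x) (I.trAt T q q') p) p' =
        I.trAt T (I.actMul (𝟙 b) (I.mulCounit r' r) (𝟙 w) s) s' ↔
      τ.tr (F.obj x) (τ.tr (F.obj z) (((R.comulMor p' ▷ F.obj z) ≫ R.comulMor q') ≫ R.mulMor q ≫
        (R.mulMor p ▷ F.obj z))) = τ.tr (F.obj x ⊗ F.obj z) ((α_ (F.obj a) (F.obj x) (F.obj z)).inv ≫ ((R.comulMor p' ▷ F.obj z ≫
          R.comulMor q') ≫ R.mulMor q ≫ R.mulMor p ▷ F.obj z) ≫ (α_ (F.obj b) (F.obj x) (F.obj z)).hom) := by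
    rw [R.assoc_iff] at h₁
    rw [R.coassoc_iff] at h₂
    rw [← F.map_injective.eq_iff, h.map_trAt, h.map_trAt, R.mulMor_actMul, R.mulMor_actMul, R.map_mulCounit,
      h.map_trAt]
    have h₃ := τ.tightening (R.comulMor p') (R.comulMor q' ≫ R.mulMor q) (R.mulMor p)
    have h₄ := τ.sliding (R.comulMor s' ≫ R.mulMor s ≫ F.obj b ◁ R.mulMor r) (R.comulMor r')
    simp only [Category.assoc, F.map_id, tensorHom_id, id_tensorHom, MonoidalCategory.id_whiskerRight,
      MonoidalCategory.whiskerLeft_comp, Category.id_comp, Category.comp_id] at h₃ h₄ ⊢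
    rw [← h₃, h₄, h₁, reassoc_of% ((Iso.inv_comp_eq _).2 h₂)]
  constructor
  · refine fun H => TraceOperator.vanishTensor_of_retractDense F fun {a b x z} f => ?_
    have H' {a b x z : C} (f : (F.obj a ⊗ F.obj x) ⊗ F.obj z ⟶ (F.obj b ⊗ F.obj x) ⊗ F.obj z) :
        τ.tr (F.obj x) (τ.tr (F.obj z) f) = τ.tr (F.obj x ⊗ F.obj z) ((α_ (F.obj a) (F.obj x) (F.obj z)).inv ≫ f ≫
          (α_ (F.obj b) (F.obj x) (F.obj z)).hom) := by
      -- Multiplications and comultiplications must meet in one object `w`; it is the cover of the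
      -- target of `f`. The former carry the retraction, the latter `f` followed by the section.
      let r := F.coverRetract ((F.obj b ⊗ F.obj x) ⊗ F.obj z)
      obtain ⟨y, p, q, h₁⟩ := R.exists_mul_mul r.r
      obtain ⟨y', p', q', h₂⟩ := R.exists_comul_comul (f ≫ r.i)
      obtain ⟨v, t, s, h₃⟩ := R.exists_mul_mul' (R.mulMor q ≫ R.mulMor p ▷ F.obj z ≫
        (α_ (F.obj b) (F.obj x) (F.obj z)).hom)
      obtain ⟨v', t', s', h₄⟩ := R.exists_comul_comul' ((α_ (F.obj a) (F.obj x) (F.obj z)).inv ≫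
        R.comulMor p' ▷ F.obj z ≫ R.comulMor q')
      have h₅ := (R.assoc_iff p q t s).2 h₃.symm
      have h₆ := (R.coassoc_iff p' q' t' s').2 ((Iso.inv_comp_eq _).1 h₄.symm)
      have h₇ := (key p q q' p' t s t' s' h₅ h₆).1 (H p q q' p' t s t' s' h₅ h₆)
      rw [h₁, h₂, Category.assoc, r.retract, Category.comp_id] at h₇
      exact h₇
    rw [H']
    simp only [Category.assoc, Iso.inv_hom_id, Iso.inv_hom_id_assoc, Category.comp_id]
  · intro H a b x z y y' w v v' p q q' p' r s r' s' h₁ h₂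
    refine (key p q q' p' r s r' s' h₁ h₂).2 ((H _).trans ?_).symm
    simp

/-- The unit of the adjunction states that `j'` followed by `j` is `F.map g` beside an identity; the
two reassociations rewrite `g ⊗ f` as a morphism with `r'` and `r` at the ends (`h₅`), and
tightening takes these out of the trace. -/
theorem TraceCompat.superpose_iff : I.Superpose T ↔ τ.Superpose := by
  have key {a b c c' x y z w w' : C} (g : c' ⟶ c) (p : El I.mul (b, x) y) (p' : El I.comul y (a, x))
      (j : El I.mul (c, y) z) (j' : El I.comul z (c', y))
      (r : El I.mul (c, b) w) (s : El I.mul (w, x) z)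
      (r' : El I.comul w' (c', a)) (s' : El I.comul z (w', x))
      (h₁ : I.mulUnit g (𝟙 y) = pr j j') (h₂ : I.Assoc r s p j) (h₃ : I.Coassoc r' s' p' j') :
      (pr (I.actMul (𝟙 c) (𝟙 b) (I.trAt T s s') r) r' : El (I.mul ≫ I.comul) (c, b) (c', a)) =
        I.mulUnit g (I.trAt T p p') ↔
      τ.tr (F.obj x) ((α_ (F.obj c') (F.obj a) (F.obj x)).hom ≫
        (F.map g ⊗ₘ (R.comulMor p' ≫ R.mulMor p)) ≫ (α_ (F.obj c) (F.obj b) (F.obj x)).inv) =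
        F.map g ⊗ₘ τ.tr (F.obj x) (R.comulMor p' ≫ R.mulMor p) := by
    rw [R.mulUnit_eq_iff, F.map_id] at h₁
    rw [R.assoc_iff] at h₂
    rw [R.coassoc_iff] at h₃
    rw [eq_comm, R.mulUnit_eq_iff, R.mulMor_actMul, h.map_trAt, h.map_trAt]
    have h₄ := τ.tightening (R.comulMor r') (R.comulMor s' ≫ R.mulMor s) (R.mulMor r)
    have h₅ : R.comulMor r' ▷ F.obj x ≫ (R.comulMor s' ≫ R.mulMor s) ≫ R.mulMor r ▷ F.obj x =
        (α_ (F.obj c') (F.obj a) (F.obj x)).hom ≫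
          (F.map g ⊗ₘ (R.comulMor p' ≫ R.mulMor p)) ≫ (α_ (F.obj c) (F.obj b) (F.obj x)).inv := by
      rw [← Category.assoc (α_ (F.obj c') (F.obj a) (F.obj x)).hom, Iso.eq_comp_inv]
      simp only [Category.assoc]
      rw [h₂, reassoc_of% h₃, reassoc_of% h₁]
      simp only [tensorHom_id, tensorHom_def', MonoidalCategory.whiskerLeft_comp, Category.assoc,
        MonoidalCategory.whisker_exchange, MonoidalCategory.whiskerLeft_id, Category.id_comp]
    rw [← h₅, h₄]
    simp
  constructor
  · refine fun H => TraceOperator.superpose_of_retractDense F fun {a b c d x} g f => ?_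
    obtain ⟨g, rfl⟩ := F.map_surjective g
    obtain ⟨y, p, p', rfl⟩ := R.exists_comulMor_comp_mulMor f
    obtain ⟨z, j, j', h₁⟩ := pair_surj (I.mulUnit g (𝟙 y))
    obtain ⟨w, r, s, h₂⟩ := R.exists_mul_mul (R.mulMor j ≫ F.obj d ◁ R.mulMor p ≫
      (α_ (F.obj d) (F.obj b) (F.obj x)).inv)
    obtain ⟨w', r', s', h₃⟩ := R.exists_comul_comul ((α_ (F.obj c) (F.obj a) (F.obj x)).hom ≫
       F.obj c ◁ R.comulMor p' ≫ R.comulMor j')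
    have h₂' : I.Assoc r s p j := by
      rw [R.assoc_iff, reassoc_of% h₂]
      simp
    have h₃' : I.Coassoc r' s' p' j' := (R.coassoc_iff r' s' p' j').2 h₃
    exact (key g p p' j j' r s r' s' h₁.symm h₂' h₃').1 (H g p p' j j' r s r' s' h₁.symm h₂' h₃')
  · intro H a b c c' x y z w w' g p p' j j' r s r' s' h₁ h₂ h₃
    exact (key g p p' j j' r s r' s' h₁ h₂ h₃).2 (H _ _)

end Axioms

end MonoidalRealization

theorem IsCauchyCompletion.traceCorrespondence {C D : Prof.{u}} [MonoidalCategory D] {F : C ⥤ D}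
    {I : RightAdjointPseudomonoid C} (R : MonoidalRealization F I) (hF : IsCauchyCompletion F) :
    (∀ T : I.traceLoop ⟶ 𝟙 C, ∃! τ : TraceOperator D, R.TraceCompat T τ) ∧
    (∀ τ : TraceOperator D, ∃! T : I.traceLoop ⟶ 𝟙 C, R.TraceCompat T τ) ∧
    (∀ (T : I.traceLoop ⟶ 𝟙 C) (τ : TraceOperator D), R.TraceCompat T τ →
      (I.VanishUnit T ↔ τ.VanishUnit) ∧ (I.VanishTensor T ↔ τ.VanishTensor) ∧
      (I.Superpose T ↔ τ.Superpose)) := by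
  have := hF.equivalence.full
  have := hF.equivalence.faithful
  have := hF.equivalence.retractDense
  exact ⟨fun T => ⟨R.traceOperator T, R.traceCompat_traceOperator T,
      fun τ h => h.eq_of_traceCompat' (R.traceCompat_traceOperator T)⟩,
    fun τ => ⟨R.traceHom τ, R.traceCompat_traceHom τ, fun T h => h.eq_of_traceCompat (R.traceCompat_traceHom τ)⟩,
    fun T τ h => ⟨h.vanishUnit_iff, h.vanishTensor_iff, h.superpose_iff⟩⟩

/-! ### The interpretation given by a traced monoidal category -/

section OfMonoidal
open MonoidalCategory

variable (C : Prof.{u}) [MonoidalCategory C]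

namespace Prof

/-- The multiplication 1-morphism of a monoidal category. -/
def tensorProf : C ⊠ C ⟶ C := companion (A := C ⊠ C) (B := C) (tensor C)

/-- The unit 1-morphism of a monoidal category. -/
def unitProf : tensorUnit ⟶ C :=
  companion (A := tensorUnit) (B := C) ((Functor.const (Discrete PUnit.{u + 1})).obj (𝟙_ C))

/-- The multiplication is represented by the tensor product. -/
def tensorRep : Rep (A := C × C) (B := C) (tensorProf C) (𝟭 C) (((𝟭 C).prod (𝟭 C)) ⋙ tensor C) where
  mor p := p
  bijective _ _ := Function.bijective_id
  mor_act _ _ _ := rfl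

/-- The right adjoint of the multiplication is corepresented by the tensor product. -/
def tensorCorep : Corep (A := C × C) (B := C) (conjoint (A := C ⊠ C) (B := C) (tensor C)) (𝟭 C)
    (((𝟭 C).prod (𝟭 C)) ⋙ tensor C) where
  mor p := p
  bijective _ _ := Function.bijective_id
  mor_act _ _ _ := rfl

/-- The unit is represented by the unit object. -/
def unitRep : Rep (A := Discrete PUnit.{u + 1}) (B := C) (unitProf C) (𝟭 C)
    ((Functor.const (Discrete PUnit.{u + 1})).obj (𝟙_ C)) :=
  Rep.toProfunctor _

/-- The right adjoint of the unit is corepresented by the unit object. -/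
def unitCorep : Corep (A := Discrete PUnit.{u + 1}) (B := C)
    (conjoint (A := tensorUnit) (B := C) ((Functor.const (Discrete PUnit.{u + 1})).obj (𝟙_ C))) (𝟭 C)
    ((Functor.const (Discrete PUnit.{u + 1})).obj (𝟙_ C)) :=
  Corep.toProfunctorRev _

/-- The generators of the pseudomonoid presentation given by a monoidal category. -/
noncomputable def pseudomonoidData : PseudomonoidData C where
  mul := tensorProf C
  one := unitProf C
  assoc := Rep.isoOfNatIso (A := (C × C) × C) (B := C) (PseudomonoidData.assocRepL (tensorRep C))
    (PseudomonoidData.assocRepR (tensorRep C))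
    (NatIso.ofComponents (fun (x : (C × C) × C) => α_ x.1.1 x.1.2 x.2)
      (fun f => associator_naturality f.1.1 f.1.2 f.2))
  lunit := Rep.isoOfNatIso (A := Discrete PUnit.{u + 1} × C) (B := C)
    (PseudomonoidData.lunitRepL (tensorRep C) (unitRep C)) (Rep.toProfunctor (prod.leftUnitor C))
    (NatIso.ofComponents (fun (x : Discrete PUnit.{u + 1} × C) => λ_ x.2)
      (fun {x y} f => (by simp : (𝟙 (𝟙_ C) ⊗ₘ f.2) ≫ (λ_ y.2).hom = (λ_ x.2).hom ≫ f.2)))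
  runit := Rep.isoOfNatIso (A := C × Discrete PUnit.{u + 1}) (B := C)
    (PseudomonoidData.runitRepL (tensorRep C) (unitRep C)) (Rep.toProfunctor (prod.rightUnitor C))
    (NatIso.ofComponents (fun (x : C × Discrete PUnit.{u + 1}) => ρ_ x.1)
      (fun {x y} f => (by simp : (f.1 ⊗ₘ 𝟙 (𝟙_ C)) ≫ (ρ_ y.1).hom = (ρ_ x.1).hom ≫ f.1)))

variable {C}

/-- The morphism given by an element of the multiplication. -/
def tensorMor {a b x : C} (p : El (tensorProf C) (a, b) x) : x ⟶ a ⊗ b := p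

/-- The morphism given by an element of the unit. -/
def unitMor {x : C} (p : El (unitProf C) star x) : x ⟶ 𝟙_ C := p

/-- `isoOfNatIso` postcomposes with the associator, so the equality of classes is one of morphisms.
-/
lemma pseudomonoidData_assoc_iff {a b c d x y : C} (p : El (pseudomonoidData C).mul (a, b) x)
    (q : El (pseudomonoidData C).mul (x, c) d)
    (r : El (pseudomonoidData C).mul (b, c) y) (s : El (pseudomonoidData C).mul (a, y) d) :
    (pseudomonoidData C).Assoc p q r s ↔
      tensorMor q ≫ tensorMor p ▷ c ≫ (α_ a b c).hom = tensorMor s ≫ a ◁ tensorMor r := by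
  have h₁ := Rep.mor_app_isoOfNatIso_hom (A := (C × C) × C) (B := C) (PseudomonoidData.assocRepL (tensorRep C))
    (PseudomonoidData.assocRepR (tensorRep C))
    (NatIso.ofComponents (fun (x : (C × C) × C) => α_ x.1.1 x.1.2 x.2)
      (fun f => associator_naturality f.1.1 f.1.2 f.2)) (a := ((a, b), c)) (pr (tp p (ofHom (𝟙 c))) q)
  have h₂ := PseudomonoidData.assocRepL_mor (tensorRep C) p q
  have h₃ := PseudomonoidData.assocRepR_mor (tensorRep C) r s
  refine ((PseudomonoidData.assocRepR (tensorRep C)).bijective ((a, b), c) d).1.eq_iff.symm.trans ?_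
  have h₂' : (PseudomonoidData.assocRepL (tensorRep C)).mor (a := ((a, b), c)) (pr (tp p (ofHom (𝟙 c))) q) ≫
      (α_ a b c).hom = tensorMor q ≫ tensorMor p ▷ c ≫ (α_ a b c).hom :=
    (congrArg (· ≫ (α_ a b c).hom) h₂).trans
      (by simp : (tensorMor q ≫ (tensorMor p ⊗ₘ 𝟙 c)) ≫ (α_ a b c).hom = _)
  have h₃' := h₃.trans (by simp : tensorMor s ≫ (𝟙 a ⊗ₘ tensorMor r) = tensorMor s ≫ a ◁ tensorMor r)
  have h₁' := h₁.trans h₂'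
  exact ⟨fun h => h₁'.symm.trans (h.trans h₃'), fun h => h₁'.trans (h.trans h₃'.symm)⟩

lemma pseudomonoidData_lam {x b c : C} (e : El (pseudomonoidData C).one star x)
    (p : El (pseudomonoidData C).mul (x, b) c) :
    (pseudomonoidData C).lam e p = tensorMor p ≫ unitMor e ▷ b ≫ (λ_ b).hom := by
  have h₁ := Rep.mor_app_isoOfNatIso_hom (A := Discrete PUnit.{u + 1} × C) (B := C)
    (PseudomonoidData.lunitRepL (tensorRep C) (unitRep C)) (Rep.toProfunctor (prod.leftUnitor C))
    (NatIso.ofComponents (fun (x : Discrete PUnit.{u + 1} × C) => λ_ x.2)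
      (fun {x y} f => (by simp : (𝟙 (𝟙_ C) ⊗ₘ f.2) ≫ (λ_ y.2).hom = (λ_ x.2).hom ≫ f.2)))
    (a := (⟨PUnit.unit⟩, b)) (pr (tp e (ofHom (𝟙 b))) p)
  have h₂ := PseudomonoidData.lunitRepL_mor (tensorRep C) (unitRep C) e p
  refine h₁.trans ((congrArg (· ≫ (λ_ b).hom) h₂).trans ?_)
  exact (by simp : (tensorMor p ≫ (unitMor e ⊗ₘ 𝟙 b)) ≫ (λ_ b).hom =
    tensorMor p ≫ unitMor e ▷ b ≫ (λ_ b).hom)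

lemma pseudomonoidData_rho {x b c : C} (e : El (pseudomonoidData C).one star x)
    (p : El (pseudomonoidData C).mul (b, x) c) :
    (pseudomonoidData C).rho e p = tensorMor p ≫ b ◁ unitMor e ≫ (ρ_ b).hom := by
  have h₁ := Rep.mor_app_isoOfNatIso_hom (A := C × Discrete PUnit.{u + 1}) (B := C)
    (PseudomonoidData.runitRepL (tensorRep C) (unitRep C)) (Rep.toProfunctor (prod.rightUnitor C))
    (NatIso.ofComponents (fun (x : C × Discrete PUnit.{u + 1}) => ρ_ x.1)
      (fun {x y} f => (by simp : (f.1 ⊗ₘ 𝟙 (𝟙_ C)) ≫ (ρ_ y.1).hom = (ρ_ x.1).hom ≫ f.1)))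
    (a := (b, ⟨PUnit.unit⟩)) (pr (tp (ofHom (𝟙 b)) e) p)
  have h₂ := PseudomonoidData.runitRepL_mor (tensorRep C) (unitRep C) e p
  refine h₁.trans ((congrArg (· ≫ (ρ_ b).hom) h₂).trans ?_)
  exact (by simp : (tensorMor p ≫ (𝟙 b ⊗ₘ unitMor e)) ≫ (ρ_ b).hom =
    tensorMor p ≫ b ◁ unitMor e ≫ (ρ_ b).hom)

/-- Both sides rebracket `r ≫ q ▷ d ≫ p ▷ c ▷ d`: `h₁`, `h₂`, `h₃` follow one path of the pentagon
in `C`, and `h₄`, `h₅` the other. -/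
lemma pentagon_of_assoc {a b c d e s t s₁ t₂ s₃ s' s'' : C}
    {p : s ⟶ a ⊗ b} {q : t ⟶ s ⊗ c} {r : e ⟶ t ⊗ d} {p₁ : s₁ ⟶ b ⊗ c} {q₁ : t ⟶ a ⊗ s₁} {q₂ : t₂ ⟶ s₁ ⊗ d}
    {r₂ : e ⟶ a ⊗ t₂} {p₃ : s₃ ⟶ c ⊗ d} {q₃ : t₂ ⟶ b ⊗ s₃} {q' : s' ⟶ c ⊗ d} {r' : e ⟶ s ⊗ s'}
    {p'' : s'' ⟶ b ⊗ s'} {r'' : e ⟶ a ⊗ s''}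
    (h₁ : q ≫ p ▷ c ≫ (α_ a b c).hom = q₁ ≫ a ◁ p₁) (h₂ : r ≫ q₁ ▷ d ≫ (α_ a s₁ d).hom = r₂ ≫ a ◁ q₂)
    (h₃ : q₂ ≫ p₁ ▷ d ≫ (α_ b c d).hom = q₃ ≫ b ◁ p₃) (h₄ : r ≫ q ▷ d ≫ (α_ s c d).hom = r' ≫ s ◁ q')
    (h₅ : r' ≫ p ▷ s' ≫ (α_ a b s').hom = r'' ≫ a ◁ p'') :
    r₂ ≫ a ◁ (q₃ ≫ b ◁ p₃) = r'' ≫ a ◁ (p'' ≫ b ◁ q') := by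
  have h₁' : q ▷ d ≫ p ▷ c ▷ d ≫ (α_ a b c).hom ▷ d = q₁ ▷ d ≫ (a ◁ p₁) ▷ d := by
    simp only [← MonoidalCategory.comp_whiskerRight, h₁]
  calc r₂ ≫ a ◁ (q₃ ≫ b ◁ p₃) = (r₂ ≫ a ◁ q₂) ≫ a ◁ p₁ ▷ d ≫ a ◁ (α_ b c d).hom := by
        rw [← h₃]
        simp
    _ = r ≫ (q₁ ▷ d ≫ (a ◁ p₁) ▷ d) ≫ (α_ a (b ⊗ c) d).hom ≫ a ◁ (α_ b c d).hom := by
        rw [← h₂]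
        simp
    _ = (r ≫ q ▷ d ≫ (α_ s c d).hom) ≫ p ▷ (c ⊗ d) ≫ (α_ a b (c ⊗ d)).hom := by
        rw [← h₁']
        simp
    _ = (r' ≫ p ▷ s' ≫ (α_ a b s').hom) ≫ a ◁ b ◁ q' := by
        rw [h₄]
        simp only [Category.assoc]
        rw [MonoidalCategory.whisker_exchange_assoc]
        simp
    _ = _ := by
        rw [h₅]
        simp

lemma triangle_of_assoc {a b c x s t : C} {e : x ⟶ 𝟙_ C} {p : s ⟶ a ⊗ x} {q : c ⟶ s ⊗ b} {r : t ⟶ x ⊗ b}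
    {q' : c ⟶ a ⊗ t} (h : q ≫ p ▷ b ≫ (α_ a x b).hom = q' ≫ a ◁ r) :
    q' ≫ a ◁ (r ≫ e ▷ b ≫ (λ_ b).hom) = q ≫ (p ≫ a ◁ e ≫ (ρ_ a).hom) ▷ b := by
  have h' : q' ≫ a ◁ (r ≫ e ▷ b ≫ (λ_ b).hom) = (q' ≫ a ◁ r) ≫ a ◁ e ▷ b ≫ a ◁ (λ_ b).hom := by simp
  rw [h', ← h]
  simp

variable (C) in
/-- The right-adjoint pseudomonoid given by a monoidal category. -/
noncomputable def rightAdjointPseudomonoid : RightAdjointPseudomonoid C where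
  toPseudomonoidData := pseudomonoidData C
  pentagon := by
    intro a b c d e s t s₁ t₂ s₃ s' s'' p q r p₁ q₁ q₂ r₂ p₃ q₃ q' r' p'' r'' h₁ h₂ h₃ h₄ h₅
    refine (PseudomonoidData.mulMulMulRep (tensorRep C)).ext (a := (a, (b, (c, d))))
      ((PseudomonoidData.mulMulMulRep_mor (tensorRep C) p₃ q₃ r₂).trans (Eq.trans ?_
        (PseudomonoidData.mulMulMulRep_mor (tensorRep C) q' p'' r'').symm))
    have h := pentagon_of_assoc ((pseudomonoidData_assoc_iff _ _ _ _).1 h₁)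
      ((pseudomonoidData_assoc_iff _ _ _ _).1 h₂) ((pseudomonoidData_assoc_iff _ _ _ _).1 h₃)
      ((pseudomonoidData_assoc_iff _ _ _ _).1 h₄) ((pseudomonoidData_assoc_iff _ _ _ _).1 h₅)
    rw [← id_tensorHom, ← id_tensorHom, ← id_tensorHom, ← id_tensorHom] at h
    exact h
  triangle := by
    intro a b c x s t e p q r q' h
    have h' := triangle_of_assoc (e := unitMor e) ((pseudomonoidData_assoc_iff _ _ _ _).1 h)
    rw [← pseudomonoidData_lam, ← pseudomonoidData_rho] at h'
    have h₁ (k : b ⟶ b) (l : t ⟶ b) : tensorMor q' ≫ a ◁ l = 𝟙 c ≫ tensorMor q' ≫ (𝟙 a ⊗ₘ l) := by simp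
    have h₂ (l : s ⟶ a) : tensorMor q ≫ l ▷ b = 𝟙 c ≫ tensorMor q ≫ (l ⊗ₘ 𝟙 b) := by simp
    exact (h₁ (𝟙 b) _).symm.trans (h'.trans (h₂ _))
  comul := conjoint (A := C ⊠ C) (B := C) (tensor C)
  coone := conjoint (A := tensorUnit) (B := C) ((Functor.const (Discrete PUnit.{u + 1})).obj (𝟙_ C))
  mulAdj := companionAdj (A := C ⊠ C) (B := C) (tensor C)
  oneAdj := companionAdj (A := tensorUnit) (B := C) ((Functor.const (Discrete PUnit.{u + 1})).obj (𝟙_ C))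

variable (C) in
/-- The right-adjoint pseudomonoid of a monoidal category is realized by the monoidal category. -/
noncomputable def monoidalRealization : MonoidalRealization (𝟭 C) (rightAdjointPseudomonoid C) where
  mulIso := (tensorRep C).toIso
  comulIso := (tensorCorep C).toIso
  oneIso := Rep.toIso (G := 𝟭 (Discrete PUnit.{u + 1})) (unitRep C)
  cooneIso := Corep.toIso (G := 𝟭 (Discrete PUnit.{u + 1})) (unitCorep C)
  mul_unit {a a' b b' x} f g j j' h := by
    have h' := congrArg (compMor (tensorRep C) (tensorCorep C) (a := (a, b)) (a' := (a', b'))) h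
    exact h'.symm.trans (Category.comp_id (f ⊗ₘ g))
  mul_counit _ _ := rfl
  one_unit {x} e e' h := by
    have h' := congrArg (compMor (unitRep C) (unitCorep C) (a := ⟨PUnit.unit⟩) (a' := ⟨PUnit.unit⟩)) h
    exact h'.symm.trans (Category.comp_id (𝟙 (𝟙_ C)))
  one_counit _ _ := rfl
  assoc _ _ _ _ h := (pseudomonoidData_assoc_iff _ _ _ _).1 h
  lunit := pseudomonoidData_lam
  runit := pseudomonoidData_rho

end Prof

theorem RightTrace.exists_tracedPseudomonoid {C : Prof.{u}} [MonoidalCategory C] (t : RightTrace C) :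
    ∃ (I : TracedPseudomonoid C) (R : MonoidalRealization (𝟭 C) I.toRightAdjointPseudomonoid),
      R.TraceCompat I.Tr t.toTraceOperator := by
  let R := monoidalRealization C
  have h : R.TraceCompat (R.traceHom t.toTraceOperator) t.toTraceOperator := R.traceCompat_traceHom _
  exact ⟨⟨rightAdjointPseudomonoid C, R.traceHom t.toTraceOperator, h.vanishUnit_iff.2 t.vanishUnit,
    h.vanishTensor_iff.2 t.vanishTensor, h.superpose_iff.2 t.superpose⟩, R, h⟩

end OfMonoidal

/-! ### Left adjoints in `Prof` as functors into the Cauchy completion -/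

namespace Prof

section Adjunctions
variable {A B : Prof.{u}} {P : A ⟶ B} {P' : B ⟶ A} (adj : P ⊣ P')

/-- The value of the counit of an adjunction on a pair of elements. -/
def counitHom {a : A} {b b' : B} (q : El P' b a) (p : El P a b') : b' ⟶ b := ap adj.counit (pr q p)

lemma counitHom_act_right {a : A} {b b' b'' : B} (q : El P' b a) (g : b'' ⟶ b') (p : El P a b') :
    counitHom adj q (act (A := A) (B := B) P (𝟙 a) g p) = g ≫ counitHom adj q p := by
  have h := app_act (P := comp P' P) (Q := Profunctor.id) adj.counit (𝟙 b) g (pair q p)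
  have h' : act (comp P' P) (𝟙 b) g (pair q p) = pair q (act (A := A) (B := B) P (𝟙 a) g p) :=
    (act_pair _ _ _ _).trans (congrArg (pair · _) (act_id P' q))
  refine ((congrArg _ h').symm.trans h).trans ?_
  exact congrArg (g ≫ ·) (Category.comp_id _)

lemma counitHom_act_left {a : A} {b b' c : B} (f : b ⟶ c) (q : El P' b a) (p : El P a b') :
    counitHom adj (act (A := B) (B := A) P' f (𝟙 a) q) p = counitHom adj q p ≫ f := by
  have h := app_act (P := comp P' P) (Q := Profunctor.id) adj.counit f (𝟙 b') (pair q p)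
  have h' : act (comp P' P) f (𝟙 b') (pair q p) = pair (act (A := B) (B := A) P' f (𝟙 a) q) p :=
    (act_pair _ _ _ _).trans (congrArg (pair _) (act_id P p))
  refine ((congrArg _ h').symm.trans h).trans ?_
  exact Category.id_comp _

lemma counitHom_slide {a a' : A} {b b' : B} (h : a ⟶ a') (q : El P' b a') (p : El P a b') :
    counitHom adj (act (A := B) (B := A) P' (𝟙 b) h q) p =
      counitHom adj q (act (A := A) (B := B) P h (𝟙 b') p) :=
  congrArg (ap adj.counit) (pair_slide (P := P') (Q := P) h q p)

variable {adj} {a : A} {x : B} {j : El P a x} {j' : El P' x a} 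

/-- `leftZigzag_iff` speaks of some representative of the unit at `a`; the expression depends only
on the class, so every representative will do. -/
lemma act_counitHom_left (hj : ap adj.unit (ofHom (𝟙 a)) = pr j j') {b : B} (p : El P a b) :
    act (A := A) (B := B) P (𝟙 a) (counitHom adj j' p) j = p := by
  obtain ⟨y, k, k', hk, h⟩ := (leftZigzag_iff _ _).1 adj.left_triangle p
  exact (congrArg (fun z => app (P := comp (comp P P') P) (Q := P)
      ((α_ P P' P).hom ≫ P ◁ adj.counit ≫ (ρ_ P).hom) (pair (P := comp P P') (Q := P) z p))
      (hj.symm.trans hk)).trans h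

lemma act_counitHom_right (hj : ap adj.unit (ofHom (𝟙 a)) = pr j j') {b : B} (q : El P' b a) :
    act (A := B) (B := A) P' (counitHom adj q j) (𝟙 a) j' = q := by
  obtain ⟨y, k, k', hk, h⟩ := (rightZigzag_iff _ _).1 adj.right_triangle q
  exact (congrArg (fun z => app (P := comp P' (comp P P')) (Q := P')
      ((α_ P' P P').inv ≫ adj.counit ▷ P' ≫ (λ_ P').hom) (pair (P := P') (Q := comp P P') q z))
      (hj.symm.trans hk)).trans h

/-- Dual basis identity: `counitHom adj q j` acts on `j'` to give back `q`. In particular `counitHom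
adj j' j` is idempotent. -/
lemma counitHom_comp (hj : ap adj.unit (ofHom (𝟙 a)) = pr j j') {b c : B} (p : El P a b)
    (q : El P' c a) : counitHom adj j' p ≫ counitHom adj q j = counitHom adj q p := by
  rw [← counitHom_act_left, act_counitHom_right hj]

lemma act_unit_ofHom (hj : ap adj.unit (ofHom (𝟙 a)) = pr j j') {a' : A} (f : a' ⟶ a) :
    ap adj.unit (ofHom f) = pr j (act (A := B) (B := A) P' (𝟙 x) f j') := by
  have h := app_act (P := Profunctor.id) (Q := comp P P') adj.unit (𝟙 a) f (𝟙 a : a ⟶ a)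
  have h' : act (Profunctor.id (C := A)) (a := a) (b := a) (𝟙 a) f (𝟙 a : a ⟶ a) = f :=
    (by simp : f ≫ 𝟙 a ≫ 𝟙 a = f)
  refine ((congrArg _ h').symm.trans h).trans ?_
  refine (congrArg (act (comp P P') (𝟙 a) f) hj).trans ((act_pair (P := P) (Q := P') _ _ _ _).trans ?_)
  exact congrArg (pair · _) (act_id P j)

variable {D : Type u} [SmallCategory D] (F : B ⥤ D) [F.Full] [F.Faithful]

/-- A left adjoint in `Prof` is represented, after Cauchy completion of its target, by a functor. -/
theorem exists_rep_of_adjunction [IsIdempotentComplete D] (adj : P ⊣ P') :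
    ∃ (X : A ⥤ D) (r : Rep (A := A) (B := B) P F X) (s : Corep (A := A) (B := B) P' F X),
      CounitCompat adj r s ∧ ∀ {a a' : A} {b : B} (f : a' ⟶ a) (j : El P a b) (j' : El P' b a'),
        ap adj.unit (ofHom f) = pr j j' → s.mor j' ≫ r.mor j = X.map f := by
  -- A representative of the unit at each `a`, with middle object `x a`: a dual basis for `P` and
  -- `P'` at `a`.
  choose x j j' hj using fun a : A => pair_surj (P := P) (Q := P') (ap adj.unit (ofHom (𝟙 a)))
  replace hj (a : A) : ap adj.unit (ofHom (𝟙 a)) = pr (j a) (j' a) := (hj a).symm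
  let k {a : A} {b b' : B} (q : El P' b a) (p : El P a b') : b' ⟶ b := counitHom adj q p
  have star {a : A} {b c : B} (p : El P a b) (q : El P' c a) : k (j' a) p ≫ k q (j a) = k q p :=
    counitHom_comp (hj a) p q
  -- The assignment `a ↦ x a` with action `t` is multiplicative, but `t (𝟙 a)` is only the
  -- idempotent `k (j' a) (j a)`; its splitting in `D` gives a functor.
  let t {a a' : A} (f : a ⟶ a') : x a ⟶ x a' := k (j' a') (act (A := A) (B := B) P f (𝟙 _) (j a))
  have comp_t {a a' : A} (f : a ⟶ a') {b : B} (p : El P a b) :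
      k (j' a) p ≫ t f = k (j' a') (act (A := A) (B := B) P f (𝟙 _) p) := by
    refine (congrArg (k (j' a) p ≫ ·) (counitHom_slide adj f (j' a') (j a)).symm).trans ?_
    exact (star p _).trans (counitHom_slide adj f (j' a') p)
  have t_comp {a a' : A} (g : a' ⟶ a) {b : B} (q : El P' b a) :
      t g ≫ k q (j a) = k (act (A := B) (B := A) P' (𝟙 b) g q) (j a') :=
    (star _ q).trans (counitHom_slide adj g q (j a')).symm
  have t_id (a : A) : t (𝟙 a) = k (j' a) (j a) := congrArg (k (j' a)) (act_id P (j a))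
  choose X i π hiπ hπi using fun a => IsIdempotentComplete.idempotents_split _
    (F.map (k (j' a) (j a))) (by rw [← F.map_comp, star])
  have hk {a : A} {b : B} (p : El P a b) : F.map (k (j' a) p) ≫ π a ≫ i a = F.map (k (j' a) p) := by
    rw [hπi, ← F.map_comp, star]
  have hk' {a : A} {b : B} (q : El P' b a) : π a ≫ i a ≫ F.map (k q (j a)) = F.map (k q (j a)) := by
    rw [← Category.assoc, hπi, ← F.map_comp, star]
  let Y : A ⥤ D :=
    { obj := X
      map f := i _ ≫ F.map (t f) ≫ π _
      map_id a := by
        rw [t_id, ← hπi]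
        simp [hiπ]
      map_comp {a a' a''} f g := by
        have h : t f ≫ t g = t (f ≫ g) := by
          refine (comp_t g _).trans (congrArg (k (j' a'')) ?_)
          exact (act_act P f g _ _ _).trans
            (congrArg (fun l => act (A := A) (B := B) P (f ≫ g) l (j a)) (Category.comp_id _))
        simp only [Category.assoc]
        rw [← h, F.map_comp, ← reassoc_of% (hk (act (A := A) (B := B) P f (𝟙 _) (j a)))]
        simp only [Category.assoc]
        rfl }
  have preL {a : A} {b : B} (p : El P a b) :
      act (A := A) (B := B) P (𝟙 a) (k (j' a) p) (j a) = p := act_counitHom_left (hj a) p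
  have preR {a : A} {b : B} (q : El P' b a) :
      act (A := B) (B := A) P' (k q (j a)) (𝟙 a) (j' a) = q := act_counitHom_right (hj a) q
  -- An element is sent to its coordinate with respect to the dual basis. Coordinates are fixed by
  -- the idempotent, so they factor through its splitting, and `preL` recovers the element.
  let r : Rep (A := A) (B := B) P F Y :=
    { mor {a b} p := F.map (k (j' a) p) ≫ π a
      bijective a b := by
        constructor
        · intro p q h
          have h' := congrArg (· ≫ i a) h
          simp only [Category.assoc] at h'
          rw [hk, hk] at h'
          rw [← preL p, F.map_injective h', preL]
        · intro (f : F.obj b ⟶ X a)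
          refine ⟨act (A := A) (B := B) P (𝟙 a) (F.preimage (f ≫ i a)) (j a), ?_⟩
          have h : k (j' a) (act (A := A) (B := B) P (𝟙 a) (F.preimage (f ≫ i a)) (j a)) =
            F.preimage (f ≫ i a) ≫ k (j' a) (j a) := counitHom_act_right adj _ _ _
          dsimp only
          rw [h, F.map_comp, F.map_preimage, ← hπi]
          simp [hiπ]
      mor_act {a a' b b'} f g p := by
        have h : k (j' a') (act (A := A) (B := B) P f g p) = g ≫ k (j' a) p ≫ t f := by
          rw [comp_t]
          refine Eq.trans ?_ (counitHom_act_right adj _ _ _)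
          refine congrArg (k (j' a')) ?_
          rw [act_act]
          simp
        rw [h]
        change _ = _ ≫ (_ ≫ _) ≫ _ ≫ _ ≫ _
        rw [F.map_comp, F.map_comp, ← reassoc_of% (hk p)]
        simp only [Category.assoc] }
  let s : Corep (A := A) (B := B) P' F Y :=
    { mor {a b} q := i a ≫ F.map (k q (j a))
      bijective a b := by
        constructor
        · intro p q h
          have h' := congrArg (π a ≫ ·) h
          dsimp only at h'
          rw [hk', hk'] at h'
          rw [← preR p, F.map_injective h', preR]
        · intro (f : X a ⟶ F.obj b)
          refine ⟨act (A := B) (B := A) P' (F.preimage (π a ≫ f)) (𝟙 a) (j' a), ?_⟩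
          have h : k (act (A := B) (B := A) P' (F.preimage (π a ≫ f)) (𝟙 a) (j' a)) (j a) =
            k (j' a) (j a) ≫ F.preimage (π a ≫ f) := counitHom_act_left adj _ _ _
          dsimp only
          rw [h, F.map_comp, F.map_preimage, ← hπi]
          simp [reassoc_of% (hiπ a)]
      mor_act {a a' b b'} f g q := by
        have h : k (act (A := B) (B := A) P' f g q) (j a') = t g ≫ k q (j a) ≫ f := by
          rw [← Category.assoc, t_comp]
          refine Eq.trans ?_ (counitHom_act_left adj _ _ _)
          refine congrArg (fun z => k z (j a')) ?_
          rw [act_act]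
          simp
        rw [h]
        change _ = (_ ≫ _ ≫ _) ≫ (_ ≫ _) ≫ _
        rw [F.map_comp, F.map_comp]
        simp only [Category.assoc]
        rw [reassoc_of% (hk' q)] }
  refine ⟨Y, r, s, ⟨fun {a b b'} q p => ?_⟩, fun {a a' b} f p q h => ?_⟩
  · have h : F.map (k q p) = (F.map (k (j' a) p) ≫ π a) ≫ i a ≫ F.map (k q (j a)) := by
      rw [Category.assoc, hk', ← F.map_comp, star]
    exact h
  · have h' := congrArg (compMor r s) (h.symm.trans (act_unit_ofHom (hj a) f))
    refine h'.trans ?_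
    change s.mor (act (A := B) (B := A) P' (𝟙 (x a)) f (j' a)) ≫ r.mor (j a) = _
    rw [s.mor_act]
    have h2 : s.mor (j' a) ≫ r.mor (j a) = 𝟙 (X a) := by
      change (i a ≫ F.map (k (j' a) (j a))) ≫ F.map (k (j' a) (j a)) ≫ π a = _
      rw [← hπi]
      simp [hiπ]
    rw [F.map_id, Category.comp_id, Category.assoc, h2]
    exact Category.comp_id _

end Adjunctions

end Prof

/-! ### Pentagon and triangle, up to retracts and from elements -/

section MonoidalStruct
open MonoidalCategory

/-- A functorial tensor product with natural associator and unitors. -/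
class FunctorialTensor (D : Type u) [SmallCategory D] [MonoidalCategoryStruct D] : Prop where
  id_tensorHom_id : ∀ X Y : D, 𝟙 X ⊗ₘ 𝟙 Y = 𝟙 (X ⊗ Y)
  tensorHom_comp : ∀ {X₁ Y₁ Z₁ X₂ Y₂ Z₂ : D} (f₁ : X₁ ⟶ Y₁) (f₂ : X₂ ⟶ Y₂) (g₁ : Y₁ ⟶ Z₁)
    (g₂ : Y₂ ⟶ Z₂), (f₁ ⊗ₘ f₂) ≫ (g₁ ⊗ₘ g₂) = (f₁ ≫ g₁) ⊗ₘ (f₂ ≫ g₂)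
  associator_naturality : ∀ {X₁ X₂ X₃ Y₁ Y₂ Y₃ : D} (f₁ : X₁ ⟶ Y₁) (f₂ : X₂ ⟶ Y₂) (f₃ : X₃ ⟶ Y₃),
    ((f₁ ⊗ₘ f₂) ⊗ₘ f₃) ≫ (MonoidalCategoryStruct.associator Y₁ Y₂ Y₃).hom =
      (MonoidalCategoryStruct.associator X₁ X₂ X₃).hom ≫ (f₁ ⊗ₘ (f₂ ⊗ₘ f₃))
  leftUnitor_naturality : ∀ {X Y : D} (f : X ⟶ Y),
    (𝟙 (𝟙_ D) ⊗ₘ f) ≫ (MonoidalCategoryStruct.leftUnitor Y).hom =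
      (MonoidalCategoryStruct.leftUnitor X).hom ≫ f
  rightUnitor_naturality : ∀ {X Y : D} (f : X ⟶ Y),
    (f ⊗ₘ 𝟙 (𝟙_ D)) ≫ (MonoidalCategoryStruct.rightUnitor Y).hom =
      (MonoidalCategoryStruct.rightUnitor X).hom ≫ f

namespace FunctorialTensor

variable {D : Type u} [SmallCategory D] [MonoidalCategoryStruct D] [FunctorialTensor D]

local notation "asc" => fun X Y Z => MonoidalCategoryStruct.associator X Y Z

lemma tensorHom_comp_assoc {X₁ Y₁ Z₁ X₂ Y₂ Z₂ V : D} (f₁ : X₁ ⟶ Y₁) (f₂ : X₂ ⟶ Y₂) (g₁ : Y₁ ⟶ Z₁)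
    (g₂ : Y₂ ⟶ Z₂) (k : Z₁ ⊗ Z₂ ⟶ V) :
    (f₁ ⊗ₘ f₂) ≫ (g₁ ⊗ₘ g₂) ≫ k = ((f₁ ≫ g₁) ⊗ₘ (f₂ ≫ g₂)) ≫ k := by
  rw [← Category.assoc, tensorHom_comp]

lemma associator_naturality_assoc {X₁ X₂ X₃ Y₁ Y₂ Y₃ V : D} (f₁ : X₁ ⟶ Y₁) (f₂ : X₂ ⟶ Y₂) (f₃ : X₃ ⟶ Y₃)
    (k : Y₁ ⊗ (Y₂ ⊗ Y₃) ⟶ V) :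
    ((f₁ ⊗ₘ f₂) ⊗ₘ f₃) ≫ (asc Y₁ Y₂ Y₃).hom ≫ k = (asc X₁ X₂ X₃).hom ≫ (f₁ ⊗ₘ (f₂ ⊗ₘ f₃)) ≫ k := by
  rw [← Category.assoc, associator_naturality, Category.assoc]

lemma tensorHom_comp_id {X Y Z : D} (f : X ⟶ Y) (g : Y ⟶ Z) (W : D) :
    (f ≫ g) ⊗ₘ 𝟙 W = (f ⊗ₘ 𝟙 W) ≫ (g ⊗ₘ 𝟙 W) := by
  rw [tensorHom_comp, Category.comp_id]

lemma id_tensorHom_comp {X Y Z : D} (f : X ⟶ Y) (g : Y ⟶ Z) (W : D) :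
    𝟙 W ⊗ₘ (f ≫ g) = (𝟙 W ⊗ₘ f) ≫ (𝟙 W ⊗ₘ g) := by
  rw [tensorHom_comp, Category.comp_id]

variable (D) in
/-- The pentagon at given objects. -/
def Pentagon (W X Y Z : D) : Prop :=
  ((asc W X Y).hom ⊗ₘ 𝟙 Z) ≫ (asc W (X ⊗ Y) Z).hom ≫ (𝟙 W ⊗ₘ (asc X Y Z).hom) =
    (asc (W ⊗ X) Y Z).hom ≫ (asc W X (Y ⊗ Z)).hom

variable (D) in
/-- The triangle at given objects. -/
def Triangle (X Y : D) : Prop :=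
  (asc X (𝟙_ D) Y).hom ≫ (𝟙 X ⊗ₘ (MonoidalCategoryStruct.leftUnitor Y).hom) =
    (MonoidalCategoryStruct.rightUnitor X).hom ⊗ₘ 𝟙 Y

/-- The tensor product of two retracts. -/
def tensorRetract {X X' Y Y' : D} (r : Retract X X') (s : Retract Y Y') : Retract (X ⊗ Y) (X' ⊗ Y') where
  i := r.i ⊗ₘ s.i
  r := r.r ⊗ₘ s.r
  retract := by rw [tensorHom_comp, r.retract, s.retract, id_tensorHom_id]

/-- The tensor product of the four retractions is a split epimorphism, and naturality moves it
through both sides of the pentagon. -/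
lemma pentagon_retract {W X Y Z W' X' Y' Z' : D} (w : Retract W W') (x : Retract X X') (y : Retract Y Y')
    (z : Retract Z Z') (h : Pentagon D W' X' Y' Z') : Pentagon D W X Y Z := by
  rw [Pentagon, ← cancel_epi (tensorRetract (tensorRetract (tensorRetract w x) y) z).r]
  simp only [tensorRetract]
  have h₁ : (((w.r ⊗ₘ x.r) ⊗ₘ y.r) ⊗ₘ z.r) ≫ ((asc W X Y).hom ⊗ₘ 𝟙 Z) =
      ((asc W' X' Y').hom ⊗ₘ 𝟙 Z') ≫ ((w.r ⊗ₘ (x.r ⊗ₘ y.r)) ⊗ₘ z.r) := by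
    rw [tensorHom_comp, tensorHom_comp, associator_naturality, Category.comp_id, Category.id_comp]
  have h₂ : (w.r ⊗ₘ ((x.r ⊗ₘ y.r) ⊗ₘ z.r)) ≫ (𝟙 W ⊗ₘ (asc X Y Z).hom) =
      (𝟙 W' ⊗ₘ (asc X' Y' Z').hom) ≫ (w.r ⊗ₘ (x.r ⊗ₘ (y.r ⊗ₘ z.r))) := by
    rw [tensorHom_comp, tensorHom_comp, associator_naturality, Category.comp_id, Category.id_comp]
  rw [reassoc_of% h₁, associator_naturality_assoc, h₂, associator_naturality_assoc,
    associator_naturality, ← reassoc_of% h]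

lemma triangle_retract {X Y X' Y' : D} (x : Retract X X') (y : Retract Y Y') (h : Triangle D X' Y') :
    Triangle D X Y := by
  rw [Triangle, ← cancel_epi (tensorRetract (tensorRetract x (.refl (𝟙_ D))) y).r]
  simp only [tensorRetract, Retract.refl]
  have h₁ : (x.r ⊗ₘ (𝟙 (𝟙_ D) ⊗ₘ y.r)) ≫ (𝟙 X ⊗ₘ (MonoidalCategoryStruct.leftUnitor Y).hom) =
      (𝟙 X' ⊗ₘ (MonoidalCategoryStruct.leftUnitor Y').hom) ≫ (x.r ⊗ₘ y.r) := by
    rw [tensorHom_comp, tensorHom_comp, leftUnitor_naturality, Category.comp_id, Category.id_comp]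
  rw [associator_naturality_assoc, h₁, reassoc_of% h, tensorHom_comp, tensorHom_comp,
    rightUnitor_naturality, Category.comp_id, Category.id_comp]

/-- Converse to the computation in a monoidal category: the relations `h₁` to `h₅` replace the
associators along both paths, and what is left is `h`, the pentagon of a pseudomonoid on one class.
The pentagon of `D` results because the common first factor can be made any morphism from an image
object. -/
lemma pentagon_of_assoc {a b c d e s t s₁ t₂ s₃ s' s'' : D}
    {p : s ⟶ a ⊗ b} {q : t ⟶ s ⊗ c} {r : e ⟶ t ⊗ d} {p₁ : s₁ ⟶ b ⊗ c} {q₁ : t ⟶ a ⊗ s₁} {q₂ : t₂ ⟶ s₁ ⊗ d}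
    {r₂ : e ⟶ a ⊗ t₂} {p₃ : s₃ ⟶ c ⊗ d} {q₃ : t₂ ⟶ b ⊗ s₃} {q' : s' ⟶ c ⊗ d} {r' : e ⟶ s ⊗ s'}
    {p'' : s'' ⟶ b ⊗ s'} {r'' : e ⟶ a ⊗ s''}
    (h₁ : q ≫ (p ⊗ₘ 𝟙 c) ≫ (asc a b c).hom = q₁ ≫ (𝟙 a ⊗ₘ p₁))
    (h₂ : r ≫ (q₁ ⊗ₘ 𝟙 d) ≫ (asc a s₁ d).hom = r₂ ≫ (𝟙 a ⊗ₘ q₂))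
    (h₃ : q₂ ≫ (p₁ ⊗ₘ 𝟙 d) ≫ (asc b c d).hom = q₃ ≫ (𝟙 b ⊗ₘ p₃))
    (h₄ : r ≫ (q ⊗ₘ 𝟙 d) ≫ (asc s c d).hom = r' ≫ (𝟙 s ⊗ₘ q'))
    (h₅ : r' ≫ (p ⊗ₘ 𝟙 s') ≫ (asc a b s').hom = r'' ≫ (𝟙 a ⊗ₘ p''))
    (h : r₂ ≫ (𝟙 a ⊗ₘ (q₃ ≫ (𝟙 b ⊗ₘ p₃))) = r'' ≫ (𝟙 a ⊗ₘ (p'' ≫ (𝟙 b ⊗ₘ q')))) :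
    (r ≫ ((q ≫ (p ⊗ₘ 𝟙 c)) ⊗ₘ 𝟙 d)) ≫
        ((asc a b c).hom ⊗ₘ 𝟙 d) ≫ (asc a (b ⊗ c) d).hom ≫ (𝟙 a ⊗ₘ (asc b c d).hom) =
      (r ≫ ((q ≫ (p ⊗ₘ 𝟙 c)) ⊗ₘ 𝟙 d)) ≫ (asc (a ⊗ b) c d).hom ≫ (asc a b (c ⊗ d)).hom := by
  have hL : ((q ≫ (p ⊗ₘ 𝟙 c)) ⊗ₘ 𝟙 d) ≫ ((asc a b c).hom ⊗ₘ 𝟙 d) =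
      (q₁ ⊗ₘ 𝟙 d) ≫ ((𝟙 a ⊗ₘ p₁) ⊗ₘ 𝟙 d) := by
    rw [← tensorHom_comp_id, ← tensorHom_comp_id, Category.assoc, h₁]
  calc _ = (r ≫ (q₁ ⊗ₘ 𝟙 d) ≫ (asc a s₁ d).hom) ≫ (𝟙 a ⊗ₘ ((p₁ ⊗ₘ 𝟙 d) ≫ (asc b c d).hom)) := by
        rw [id_tensorHom_comp, Category.assoc, reassoc_of% hL, associator_naturality_assoc]
        simp only [Category.assoc]
    _ = r'' ≫ (𝟙 a ⊗ₘ (p'' ≫ (𝟙 b ⊗ₘ q'))) := by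
        rw [h₂, Category.assoc, ← id_tensorHom_comp, h₃, h]
    _ = (r' ≫ (p ⊗ₘ 𝟙 s') ≫ (asc a b s').hom) ≫ (𝟙 a ⊗ₘ (𝟙 b ⊗ₘ q')) := by
        rw [h₅, Category.assoc, id_tensorHom_comp]
    _ = (r' ≫ (𝟙 s ⊗ₘ q')) ≫ (p ⊗ₘ 𝟙 (c ⊗ d)) ≫ (asc a b (c ⊗ d)).hom := by
        simp only [Category.assoc]
        rw [← associator_naturality, tensorHom_comp_assoc, tensorHom_comp_assoc, id_tensorHom_id]
        simp
    _ = _ := by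
        rw [← h₄, tensorHom_comp_id]
        simp only [Category.assoc]
        rw [associator_naturality_assoc, id_tensorHom_id]

lemma triangle_of_assoc {a b c x s t : D} {e : x ⟶ 𝟙_ D} {p : s ⟶ a ⊗ x} {q : c ⟶ s ⊗ b} {r : t ⟶ x ⊗ b}
    {q' : c ⟶ a ⊗ t} (h : q ≫ (p ⊗ₘ 𝟙 b) ≫ (asc a x b).hom = q' ≫ (𝟙 a ⊗ₘ r))
    (h' : q' ≫ (𝟙 a ⊗ₘ (r ≫ (e ⊗ₘ 𝟙 b) ≫ (MonoidalCategoryStruct.leftUnitor b).hom)) =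
      q ≫ ((p ≫ (𝟙 a ⊗ₘ e) ≫ (MonoidalCategoryStruct.rightUnitor a).hom) ⊗ₘ 𝟙 b)) :
    (q ≫ ((p ≫ (𝟙 a ⊗ₘ e)) ⊗ₘ 𝟙 b)) ≫ (asc a (𝟙_ D) b).hom ≫
        (𝟙 a ⊗ₘ (MonoidalCategoryStruct.leftUnitor b).hom) =
      (q ≫ ((p ≫ (𝟙 a ⊗ₘ e)) ⊗ₘ 𝟙 b)) ≫ ((MonoidalCategoryStruct.rightUnitor a).hom ⊗ₘ 𝟙 b) := by
  rw [Category.assoc, Category.assoc, ← tensorHom_comp_id, Category.assoc, ← h', tensorHom_comp_id,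
    Category.assoc, associator_naturality_assoc, id_tensorHom_comp, ← reassoc_of% h, id_tensorHom_comp]

end FunctorialTensor

end MonoidalStruct

/-! ### The monoidal structure on the Cauchy completion -/

namespace PseudomonoidData

variable {C D : Prof.{u}} {F : C ⥤ D} [F.Full] [F.Faithful] [F.RetractDense]
  {T : D × D ⥤ D} {U : D} (M : PseudomonoidData C)
  (r : Rep (A := C × C) (B := C) M.mul F ((F.prod F) ⋙ T))
  (s : Rep (A := Discrete PUnit.{u + 1}) (B := C) M.one F ((Functor.const (Discrete PUnit.{u + 1})).obj U))

/-- The associativity 2-morphism as an isomorphism of functors. -/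
noncomputable def assocNatIso : (((F.prod F) ⋙ T).prod F) ⋙ T ≅
    (prod.associator C C C ⋙ F.prod (F.prod F)) ⋙ (𝟭 D).prod T ⋙ T :=
  Rep.natIso (assocRepL r) (assocRepR r) M.assoc

/-- The left unit 2-morphism as an isomorphism of functors. -/
noncomputable def lunitNatIso :
    ((Functor.const (Discrete PUnit.{u + 1})).obj U).prod F ⋙ T ≅ prod.leftUnitor C ⋙ F :=
  Rep.natIso (lunitRepL r s) (Rep.companion (prod.leftUnitor C) F) M.lunit

/-- The right unit 2-morphism as an isomorphism of functors. -/
noncomputable def runitNatIso :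
    F.prod ((Functor.const (Discrete PUnit.{u + 1})).obj U) ⋙ T ≅ prod.rightUnitor C ⋙ F :=
  Rep.natIso (runitRepL r s) (Rep.companion (prod.rightUnitor C) F) M.runit

/-- The associator of a tensor product which represents the multiplication. -/
noncomputable def associatorIso : (T.prod (𝟭 D)) ⋙ T ≅ prod.associator D D D ⋙ ((𝟭 D).prod T) ⋙ T :=
  ((F.prod F).prod F).extendNatIso
    (NatIso.ofComponents (fun x => (assocNatIso M r).app x) (fun f => (assocNatIso M r).hom.naturality f))

lemma assocRepL_mor_comp_associatorIso {a b c d : C}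
    (z : El (A := (C × C) × C) (B := C) ((M.mul ⊠₁ 𝟙 C) ≫ M.mul) ((a, b), c) d) :
    (assocRepL r).mor (a := ((a, b), c)) z ≫ (associatorIso M r).hom.app ((F.obj a, F.obj b), F.obj c) =
      (assocRepR r).mor (a := ((a, b), c)) (ap M.assoc.hom z) := by
  have h : (associatorIso M r).hom.app ((F.obj a, F.obj b), F.obj c) =
      (assocNatIso M r).hom.app ((a, b), c) :=
    ((F.prod F).prod F).extendNatTrans_app_obj _ ((a, b), c)
  rw [h]
  exact Rep.mor_comp_natTrans _ _ _ z

/-- The left unitor of a tensor product which represents the multiplication. -/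
noncomputable def leftUnitorIso : Prod.sectR U D ⋙ T ≅ 𝟭 D :=
  F.extendNatIso (H' := 𝟭 D)
    (NatIso.ofComponents (fun b => (lunitNatIso M r s).app (⟨PUnit.unit⟩, b))
      (fun {b b'} f => (lunitNatIso M r s).hom.naturality (X := (⟨PUnit.unit⟩, b))
        (Y := (⟨PUnit.unit⟩, b')) (𝟙 _, f)))

lemma map_lam_leftUnitorIso {x b c : C} (e : El M.one star x) (p : El M.mul (x, b) c) :
    F.map (M.lam e p) = r.mor (a := (x, b)) p ≫ T.map (X := (F.obj x, F.obj b)) (Y := (U, F.obj b))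
      (s.mor (a := ⟨PUnit.unit⟩) e, 𝟙 (F.obj b)) ≫ (leftUnitorIso M r s).hom.app (F.obj b) := by
  have h : (leftUnitorIso M r s).hom.app (F.obj b) = (lunitNatIso M r s).hom.app (⟨PUnit.unit⟩, b) :=
    F.extendNatTrans_app_obj (H' := 𝟭 D) _ b
  rw [h]
  refine Eq.trans (Rep.mor_comp_natTrans (lunitRepL r s) (Rep.companion (prod.leftUnitor C) F) M.lunit.hom
    (a := (⟨PUnit.unit⟩, b)) (pr (tp e (ofHom (𝟙 b))) p)).symm ?_
  exact (congrArg (· ≫ (lunitNatIso M r s).hom.app (⟨PUnit.unit⟩, b)) (lunitRepL_mor r s e p)).trans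
    (Category.assoc _ _ _)

/-- The right unitor of a tensor product which represents the multiplication. -/
noncomputable def rightUnitorIso : Prod.sectL D U ⋙ T ≅ 𝟭 D :=
  F.extendNatIso (H' := 𝟭 D)
    (NatIso.ofComponents (fun b => (runitNatIso M r s).app (b, ⟨PUnit.unit⟩))
      (fun {b b'} f => (runitNatIso M r s).hom.naturality (X := (b, ⟨PUnit.unit⟩))
        (Y := (b', ⟨PUnit.unit⟩)) (f, 𝟙 _)))

lemma map_rho_rightUnitorIso {x b c : C} (e : El M.one star x) (p : El M.mul (b, x) c) :
    F.map (M.rho e p) = r.mor (a := (b, x)) p ≫ T.map (X := (F.obj b, F.obj x)) (Y := (F.obj b, U))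
      (𝟙 (F.obj b), s.mor (a := ⟨PUnit.unit⟩) e) ≫ (rightUnitorIso M r s).hom.app (F.obj b) := by
  have h : (rightUnitorIso M r s).hom.app (F.obj b) = (runitNatIso M r s).hom.app (b, ⟨PUnit.unit⟩) :=
    F.extendNatTrans_app_obj (H' := 𝟭 D) _ b
  rw [h]
  refine Eq.trans (Rep.mor_comp_natTrans (runitRepL r s) (Rep.companion (prod.rightUnitor C) F) M.runit.hom
    (a := (b, ⟨PUnit.unit⟩)) (pr (tp (ofHom (𝟙 b)) e) p)).symm ?_
  exact (congrArg (· ≫ (runitNatIso M r s).hom.app (b, ⟨PUnit.unit⟩)) (runitRepL_mor r s e p)).trans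
    (Category.assoc _ _ _)

/-- The tensor product, the unit object, the associator and the unitors of the monoidal category given by
representations of the generators of a pseudomonoid. -/
@[reducible] noncomputable def monoidalStruct : MonoidalCategoryStruct D where
  tensorObj X Y := T.obj (X, Y)
  whiskerLeft X _ _ f := T.map (𝟙 X, f)
  whiskerRight f Y := T.map (f, 𝟙 Y)
  tensorHom f g := T.map (f, g)
  tensorUnit := U
  associator X Y Z := (associatorIso M r).app ((X, Y), Z)
  leftUnitor X := (leftUnitorIso M r s).app X
  rightUnitor X := (rightUnitorIso M r s).app X

/-- Functoriality of `T` and naturality of the extended isomorphisms; after this only the pentagon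
and the triangle remain. -/
lemma functorialTensor : @FunctorialTensor D _ (monoidalStruct M r s) :=
  letI := monoidalStruct M r s
  { id_tensorHom_id X Y := T.map_id (X, Y)
    tensorHom_comp f₁ f₂ g₁ g₂ := (T.map_comp (X := (_, _)) (Y := (_, _)) (Z := (_, _)) (f₁, f₂) (g₁, g₂)).symm
    associator_naturality {X₁ X₂ X₃ Y₁ Y₂ Y₃} f₁ f₂ f₃ :=
      (associatorIso M r).hom.naturality (X := ((X₁, X₂), X₃)) (Y := ((Y₁, Y₂), Y₃)) ((f₁, f₂), f₃)
    leftUnitor_naturality f := (leftUnitorIso M r s).hom.naturality f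
    rightUnitor_naturality f := (rightUnitorIso M r s).hom.naturality f }

end PseudomonoidData

namespace Pseudomonoid
open MonoidalCategory PseudomonoidData FunctorialTensor

variable {C D : Prof.{u}} {F : C ⥤ D} [F.Full] [F.Faithful] [F.RetractDense]
  {T : D × D ⥤ D} {U : D} (M : Pseudomonoid C)
  (r : Rep (A := C × C) (B := C) M.mul F ((F.prod F) ⋙ T))
  (s : Rep (A := Discrete PUnit.{u + 1}) (B := C) M.one F ((Functor.const (Discrete PUnit.{u + 1})).obj U))

/-- The morphism which represents an element of the multiplication. -/
def mulMor {a b x : C} (p : El M.mul (a, b) x) :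
    letI := monoidalStruct M.toPseudomonoidData r s
    F.obj x ⟶ F.obj a ⊗ F.obj b := r.mor (a := (a, b)) p

/-- The morphism which represents an element of the unit. -/
def oneMor {x : C} (p : El M.one star x) :
    letI := monoidalStruct M.toPseudomonoidData r s
    F.obj x ⟶ 𝟙_ D := s.mor (a := ⟨PUnit.unit⟩) p

lemma mulMor_assoc {a b c d x y : C} {p : El M.mul (a, b) x} {q : El M.mul (x, c) d}
    {p' : El M.mul (b, c) y} {q' : El M.mul (a, y) d} (h : M.Assoc p q p' q') :
    letI := monoidalStruct M.toPseudomonoidData r s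
    M.mulMor r s q ≫ (M.mulMor r s p ⊗ₘ 𝟙 (F.obj c)) ≫
        (MonoidalCategoryStruct.associator (F.obj a) (F.obj b) (F.obj c)).hom =
      M.mulMor r s q' ≫ (𝟙 (F.obj a) ⊗ₘ M.mulMor r s p') := by
  have h₁ := (assocRepL_mor_comp_associatorIso M.toPseudomonoidData r (pr (tp p (ofHom (𝟙 c))) q)).trans
    ((congrArg (assocRepR r).mor h).trans (assocRepR_mor r p' q'))
  refine Eq.trans ?_ h₁
  refine Eq.trans ?_ (congrArg (· ≫ (associatorIso M.toPseudomonoidData r).hom.app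
    ((F.obj a, F.obj b), F.obj c)) (assocRepL_mor r p q)).symm
  exact (Category.assoc _ _ _).symm

/-- The pentagon is tested on all morphisms `v` from image objects; each is a composite of three
represented multiplications, to which the pentagon of the pseudomonoid applies. -/
lemma pentagon_obj (a b c d : C) :
    letI := monoidalStruct M.toPseudomonoidData r s
    Pentagon D (F.obj a) (F.obj b) (F.obj c) (F.obj d) := by
  let := monoidalStruct M.toPseudomonoidData r s
  have := functorialTensor M.toPseudomonoidData r s
  refine F.retractDense_hom_ext (𝟭 D) fun e (v : F.obj e ⟶ ((F.obj a ⊗ F.obj b) ⊗ F.obj c) ⊗ F.obj d) => ?_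
  simp only [Functor.id_map]
  -- Successive covers of the partial products: each multiplication contains the retraction of its
  -- own cover, and the section of that cover is put into the next one, so that everything but `v`
  -- cancels.
  let ρ := F.coverRetract (F.obj a ⊗ F.obj b)
  let σ := F.coverRetract ((F.obj a ⊗ F.obj b) ⊗ F.obj c)
  obtain ⟨p, hp⟩ : ∃ p, M.mulMor r s p = ρ.r := r.exists_elt (a := (a, b)) _
  obtain ⟨q, hq⟩ : ∃ q, M.mulMor r s q = σ.r ≫ (ρ.i ⊗ₘ 𝟙 (F.obj c)) := r.exists_elt (a := (_, c)) _
  obtain ⟨q₀, hr⟩ : ∃ q₀, M.mulMor r s q₀ = v ≫ (σ.i ⊗ₘ 𝟙 (F.obj d)) := r.exists_elt (a := (_, d)) _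
  have h₁ : M.mulMor r s q ≫ (M.mulMor r s p ⊗ₘ 𝟙 (F.obj c)) = σ.r := by
    rw [hp, hq, Category.assoc, ← tensorHom_comp_id, ρ.retract, FunctorialTensor.id_tensorHom_id, Category.comp_id]
  have hv : M.mulMor r s q₀ ≫ ((M.mulMor r s q ≫ (M.mulMor r s p ⊗ₘ 𝟙 (F.obj c))) ⊗ₘ 𝟙 (F.obj d)) = v := by
    rw [h₁, hr, Category.assoc, ← tensorHom_comp_id, σ.retract, FunctorialTensor.id_tensorHom_id, Category.comp_id]
  rw [← hv]
  obtain ⟨_, p₁, q₁, e₁⟩ := exists_assoc r p q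
  obtain ⟨_, q₂, r₂, e₂⟩ := exists_assoc r q₁ q₀
  obtain ⟨_, p₃, q₃, e₃⟩ := exists_assoc r p₁ q₂
  obtain ⟨_, q', r', e₄⟩ := exists_assoc r q q₀
  obtain ⟨_, p'', r'', e₅⟩ := exists_assoc r p r'
  have h := M.pentagon p q q₀ p₁ q₁ q₂ r₂ p₃ q₃ q' r' p'' r'' e₁ e₂ e₃ e₄ e₅
  refine pentagon_of_assoc (M.mulMor_assoc r s e₁) (M.mulMor_assoc r s e₂) (M.mulMor_assoc r s e₃)
    (M.mulMor_assoc r s e₄) (M.mulMor_assoc r s e₅) ?_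
  exact (mulMulMulRep_mor r p₃ q₃ r₂).symm.trans ((congrArg (mulMulMulRep r).mor h).trans
    (mulMulMulRep_mor r q' p'' r''))

/-- As for the pentagon, with a cover of the unit object used to express it by an element `e` of the
unit. -/
lemma triangle_obj (a b : C) :
    letI := monoidalStruct M.toPseudomonoidData r s
    Triangle D (F.obj a) (F.obj b) := by
  let := monoidalStruct M.toPseudomonoidData r s
  have := functorialTensor M.toPseudomonoidData r s
  refine F.retractDense_hom_ext (𝟭 D) fun c (v : F.obj c ⟶ (F.obj a ⊗ 𝟙_ D) ⊗ F.obj b) => ?_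
  simp only [Functor.id_map]
  let ρ := F.coverRetract (𝟙_ D)
  let σ := F.coverRetract (F.obj a ⊗ 𝟙_ D)
  obtain ⟨e, he⟩ : ∃ e, M.oneMor r s e = ρ.r := s.exists_elt (a := ⟨PUnit.unit⟩) _
  obtain ⟨p, hp⟩ : ∃ p, M.mulMor r s p = σ.r ≫ (𝟙 (F.obj a) ⊗ₘ ρ.i) := r.exists_elt (a := (a, _)) _
  obtain ⟨q, hq⟩ : ∃ q, M.mulMor r s q = v ≫ (σ.i ⊗ₘ 𝟙 (F.obj b)) := r.exists_elt (a := (_, b)) _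
  have h₁ : M.mulMor r s p ≫ (𝟙 (F.obj a) ⊗ₘ M.oneMor r s e) = σ.r := by
    rw [hp, he, Category.assoc, ← id_tensorHom_comp, ρ.retract, FunctorialTensor.id_tensorHom_id, Category.comp_id]
  have hv : M.mulMor r s q ≫ ((M.mulMor r s p ≫ (𝟙 (F.obj a) ⊗ₘ M.oneMor r s e)) ⊗ₘ 𝟙 (F.obj b)) = v := by
    rw [h₁, hq, Category.assoc, ← tensorHom_comp_id, σ.retract, FunctorialTensor.id_tensorHom_id, Category.comp_id]
  rw [← hv]
  obtain ⟨t, p', q', h⟩ := exists_assoc r p q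
  refine triangle_of_assoc (M.mulMor_assoc r s h) ?_
  have hl := map_lam_leftUnitorIso M.toPseudomonoidData r s e p'
  have hr := map_rho_rightUnitorIso M.toPseudomonoidData r s e p
  have h' := congrArg (r.mor (a := (a, b))) (M.triangle e p q p' q' h)
  have hl' : r.mor (a := (a, b)) (M.actMul (𝟙 a) (M.lam e p') (𝟙 c) q') =
      M.mulMor r s q' ≫ (𝟙 (F.obj a) ⊗ₘ F.map (M.lam e p')) := by
    refine (r.mor_act (a := (a, t)) (a' := (a, b)) (𝟙 a, M.lam e p') (𝟙 c) q').trans ?_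
    rw [F.map_id, Category.id_comp]
    exact congrArg (fun k => r.mor (a := (a, t)) q' ≫ T.map (X := (F.obj a, F.obj t)) (Y := (F.obj a, F.obj b))
      (k, F.map (M.lam e p'))) (F.map_id a)
  have hr' : r.mor (a := (a, b)) (M.actMul (M.rho e p) (𝟙 b) (𝟙 c) q) =
      M.mulMor r s q ≫ (F.map (M.rho e p) ⊗ₘ 𝟙 (F.obj b)) := by
    refine (r.mor_act (a := (_, b)) (a' := (a, b)) (M.rho e p, 𝟙 b) (𝟙 c) q).trans ?_
    rw [F.map_id, Category.id_comp]
    exact congrArg (fun k => r.mor (a := (_, b)) q ≫ T.map (X := (F.obj _, F.obj b)) (Y := (F.obj a, F.obj b))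
      (F.map (M.rho e p), k)) (F.map_id b)
  rw [hl', hr', hl, hr] at h'
  exact h'

/-- The monoidal category given by representations of the generators of a pseudomonoid. -/
@[reducible] noncomputable def monoidal : MonoidalCategory D :=
  let := monoidalStruct M.toPseudomonoidData r s
  have := functorialTensor M.toPseudomonoidData r s
  MonoidalCategory.ofTensorHom
    (id_tensorHom_id := FunctorialTensor.id_tensorHom_id)
    (id_tensorHom := fun _ _ _ _ => rfl)
    (tensorHom_id := fun _ _ => rfl)
    (tensorHom_comp_tensorHom := tensorHom_comp)
    (associator_naturality := FunctorialTensor.associator_naturality)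
    (leftUnitor_naturality := FunctorialTensor.leftUnitor_naturality)
    (rightUnitor_naturality := FunctorialTensor.rightUnitor_naturality)
    (pentagon := fun W X Y Z => pentagon_retract (F.coverRetract W) (F.coverRetract X) (F.coverRetract Y)
      (F.coverRetract Z) (M.pentagon_obj r s _ _ _ _))
    (triangle := fun X Y => triangle_retract (F.coverRetract X) (F.coverRetract Y) (M.triangle_obj r s _ _))

end Pseudomonoid

/-! ### Existence of a realization -/

namespace Prof

section
variable {A B : Prof.{u}} {P : A ⟶ B} {P' : B ⟶ A} {adj : P ⊣ P'} {D : Type u} [SmallCategory D] {F : B ⥤ D}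
  {X Y : A ⥤ D} {r : Rep (A := A) (B := B) P F X} {s : Corep (A := A) (B := B) P' F X}

lemma CounitCompat.congr (h : CounitCompat adj r s) (i : X ≅ Y) :
    CounitCompat adj (r.congr (Iso.refl _) i) (s.congr (Iso.refl _) i) := by
  refine ⟨fun {a b b'} q p => (h.map_counit q p).trans ?_⟩
  change _ = (r.mor p ≫ i.hom.app a) ≫ i.inv.app a ≫ s.mor q
  simp

lemma congr_mor_comp_mor (i : X ≅ Y) {a a' : A} {b : B} {f : a' ⟶ a} {j : El P a b} {j' : El P' b a'}
    (h : s.mor j' ≫ r.mor j = X.map f) :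
    (s.congr (Iso.refl _) i).mor j' ≫ (r.congr (Iso.refl _) i).mor j = Y.map f := by
  change (i.inv.app a' ≫ s.mor j') ≫ r.mor j ≫ i.hom.app a = _
  rw [Category.assoc, reassoc_of% h]
  simp

end

end Prof

namespace RightAdjointPseudomonoid
open MonoidalCategory PseudomonoidData

variable {C D : Prof.{u}} (F : C ⥤ D) [F.Full] [F.Faithful] [F.RetractDense] [IsIdempotentComplete D]

/-- The multiplication and the unit are left adjoints, hence represented by functors into `D`. The
first of these extends from `C × C` to `D × D`, and the monoidal structure is built on the
extension. -/
theorem exists_monoidalRealization (I : RightAdjointPseudomonoid C) :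
    ∃ (_ : MonoidalCategory D), Nonempty (MonoidalRealization F I) := by
  obtain ⟨X, r, r', hr, hr'⟩ := exists_rep_of_adjunction F I.mulAdj
  obtain ⟨T, ⟨i⟩⟩ := (F.prod F).exists_extension (A := C × C) (B := D × D) X
  obtain ⟨Y, s, s', hs, hs'⟩ := exists_rep_of_adjunction F I.oneAdj
  -- A functor on the terminal category is an object; this object is the unit of the tensor product.
  let k : Y ≅ (Functor.const (Discrete PUnit.{u + 1})).obj (Y.obj star) :=
    Discrete.natIso (fun _ => Iso.refl _)
  let m : Rep (A := C × C) (B := C) I.mul F ((F.prod F) ⋙ T) := r.congr (Iso.refl _) i.symm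
  let m' : Corep (A := C × C) (B := C) I.comul F ((F.prod F) ⋙ T) := r'.congr (Iso.refl _) i.symm
  have hm : CounitCompat I.mulAdj m m' := hr.congr i.symm
  let n : Rep (A := Discrete PUnit.{u + 1}) (B := C) I.one F
    ((Functor.const (Discrete PUnit.{u + 1})).obj (Y.obj star)) := s.congr (Iso.refl _) k
  let n' : Corep (A := Discrete PUnit.{u + 1}) (B := C) I.coone F
    ((Functor.const (Discrete PUnit.{u + 1})).obj (Y.obj star)) := s'.congr (Iso.refl _) k
  have hn : CounitCompat I.oneAdj n n' := hs.congr k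
  let := I.toPseudomonoid.monoidal m n
  refine ⟨this, ⟨?_⟩⟩
  exact
    { mulIso := Rep.toIso (H := tensor D) ⟨m.mor, m.bijective, m.mor_act⟩
      comulIso := Corep.toIso (H := tensor D) ⟨m'.mor, m'.bijective, m'.mor_act⟩
      oneIso := Rep.toIso (G := 𝟭 (Discrete PUnit.{u + 1})) n
      cooneIso := Corep.toIso (G := 𝟭 (Discrete PUnit.{u + 1})) n'
      mul_unit := fun {a a' b b' x} f g j j' h =>
        congr_mor_comp_mor (A := C ⊠ C) (B := C) (r := r) (s := r') i.symm (a := (a, b)) (a' := (a', b'))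
          (f := (f, g)) (hr' (a := (a, b)) (a' := (a', b')) (f, g) j j' h)
      mul_counit := fun q p => hm.map_counit q p
      one_unit := fun e e' h =>
        congr_mor_comp_mor (A := tensorUnit) (B := C) (r := s) (s := s') k (a := star) (a' := star)
          (f := 𝟙 star) (hs' (a := star) (a' := star) (𝟙 star) e e' h)
      one_counit := fun q p => hn.map_counit (a := star) q p
      assoc := fun p q p' q' h => I.toPseudomonoid.mulMor_assoc m n h
      lunit := fun e p => map_lam_leftUnitorIso I.toPseudomonoidData m n e p
      runit := fun e p => map_rho_rightUnitorIso I.toPseudomonoidData m n e p }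

end RightAdjointPseudomonoid

open MonoidalCategory in
theorem IsCauchyCompletion.exists_rightTrace {C D : Prof.{u}} {F : C ⥤ D} (hF : IsCauchyCompletion F)
    (I : TracedPseudomonoid C) :
    ∃ (_ : MonoidalCategory D) (t : RightTrace D)
      (R : MonoidalRealization F I.toRightAdjointPseudomonoid),
      R.TraceCompat I.Tr t.toTraceOperator := by
  have := hF.equivalence.full
  have := hF.equivalence.faithful
  have := hF.equivalence.retractDense
  have := hF.complete
  obtain ⟨_, ⟨R⟩⟩ := I.toRightAdjointPseudomonoid.exists_monoidalRealization F
  have h : R.TraceCompat I.Tr (R.traceOperator I.Tr) := R.traceCompat_traceOperator _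
  exact ⟨_, ⟨R.traceOperator I.Tr, h.vanishUnit_iff.1 I.vanishUnit, h.vanishTensor_iff.1 I.vanishTensor,
    h.superpose_iff.1 I.superpose⟩, R, h⟩

/-! ### Comparison of realizations and monoidal structures on functors -/

namespace Prof

/-- The image of a representation under a fully faithful functor. -/
def Rep.postcomp {A B D D' : Type u} [SmallCategory A] [SmallCategory B] [SmallCategory D] [SmallCategory D']
    {P : Profunctor.{u} A B} {F : B ⥤ D} {X : A ⥤ D} (r : Rep P F X) (G : D ⥤ D') [G.Full] [G.Faithful] :
    Rep P (F ⋙ G) (X ⋙ G) where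
  mor p := G.map (r.mor p)
  bijective a b := ⟨fun _ _ h => r.ext (G.map_injective h), fun f => by
    obtain ⟨p, hp⟩ := r.exists_elt (G.preimage f)
    exact ⟨p, (congrArg G.map hp).trans (G.map_preimage f)⟩⟩
  mor_act f g p := by simp [r.mor_act]

end Prof

namespace MonoidalRealization
open MonoidalCategory Functor.OplaxMonoidal Functor.LaxMonoidal

variable {C D D' : Prof.{u}} {F : C ⥤ D} {G : D ⥤ D'} [MonoidalCategory D] [MonoidalCategory D']
  {I : RightAdjointPseudomonoid C} (R : MonoidalRealization F I) (S : MonoidalRealization (F ⋙ G) I)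

/-- The monoidal structure of `G` is compatible with the realizations along `F` and along `F ⋙ G`. -/
def MapCompat (_ : G.Monoidal) : Prop :=
  (∀ {a b c : C} (p : El I.mul (a, b) c), S.mulMor p = G.map (R.mulMor p) ≫ δ G (F.obj a) (F.obj b)) ∧
  (∀ {c : C} (e : El I.one star c), S.oneMor e = G.map (R.oneMor e) ≫ η G)

variable [F.Full] [F.Faithful] [F.RetractDense] 

/-- The morphisms `mulMor p` are all morphisms from image objects into `F.obj a ⊗ F.obj b`, so they
determine the comparison there; naturality along tensor products of retractions determines the rest.
The unit comparison is treated in the same way. -/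
lemma MapCompat.unique {R : MonoidalRealization F I} {S : MonoidalRealization (F ⋙ G) I}
    {M M' : G.Monoidal} (h : R.MapCompat S M) (h' : R.MapCompat S M') : M = M' := by
  apply Functor.Monoidal.toOplaxMonoidal_injective
  ext X Y
  · refine F.retractDense_hom_ext G fun c v => ?_
    obtain ⟨e, rfl⟩ := R.exists_oneMor v
    exact (h.2 e).symm.trans (h'.2 e)
  · have hobj (a b : C) : M.δ (F.obj a) (F.obj b) = M'.δ (F.obj a) (F.obj b) := by
      refine F.retractDense_hom_ext G fun c v => ?_
      obtain ⟨p, rfl⟩ := R.exists_mulMor v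
      exact (h.1 p).symm.trans (h'.1 p)
    let x := F.coverRetract X
    let y := F.coverRetract Y
    have : IsSplitEpi (G.map (x.r ⊗ₘ y.r)) := .mk' ⟨G.map (x.i ⊗ₘ y.i), by
      rw [← G.map_comp, tensorHom_comp_tensorHom, x.retract, y.retract, id_tensorHom_id, G.map_id]⟩
    have h₂ := @δ_natural _ _ _ _ _ _ G M.toOplaxMonoidal _ _ _ _ x.r y.r
    have h₃ := @δ_natural _ _ _ _ _ _ G M'.toOplaxMonoidal _ _ _ _ x.r y.r
    rw [hobj] at h₂
    exact (cancel_epi (G.map (x.r ⊗ₘ y.r))).1 (h₂.symm.trans h₃)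

variable [G.Full] [G.Faithful] [(F ⋙ G).RetractDense]

/-- The comparison of tensor products given by two realizations, on objects in the image of `F`. -/
noncomputable def comparisonObj :
    ((F.prod F) ⋙ tensor D) ⋙ G ≅ ((F ⋙ G).prod (F ⋙ G)) ⋙ tensor D' :=
  let i : I.mul ≅ I.mul := Iso.refl _
  Rep.natIso (R.mulRep.postcomp G) S.mulRep i

/-- The comparison of tensor products given by two realizations, as a natural isomorphism. -/
noncomputable def comparisonIso : tensor D ⋙ G ≅ (G.prod G) ⋙ tensor D' :=
  (F.prod F).extendNatIso (NatIso.ofComponents (fun x => (R.comparisonObj S).app x)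
    (fun f => (R.comparisonObj S).hom.naturality f))

/-- The comparison of tensor products given by two realizations. -/
noncomputable def comparison (X Y : D) : G.obj (X ⊗ Y) ≅ G.obj X ⊗ G.obj Y :=
  (R.comparisonIso S).app (X, Y)

lemma map_mulMor_comp_comparison {a b c : C} (p : El I.mul (a, b) c) :
    G.map (R.mulMor p) ≫ (R.comparison S (F.obj a) (F.obj b)).hom = S.mulMor p := by
  have h : (R.comparison S (F.obj a) (F.obj b)).hom = (R.comparisonObj S).hom.app (a, b) :=
    (F.prod F).extendNatTrans_app_obj _ (a, b)
  rw [h]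
  let i : I.mul ⟶ I.mul := 𝟙 _
  exact Rep.mor_comp_natTrans (R.mulRep.postcomp G) S.mulRep i (a := (a, b)) p

lemma comparison_natural {X Y X' Y' : D} (f : X ⟶ X') (g : Y ⟶ Y') :
    G.map (f ⊗ₘ g) ≫ (R.comparison S X' Y').hom = (R.comparison S X Y).hom ≫ (G.map f ⊗ₘ G.map g) :=
  (R.comparisonIso S).hom.naturality (X := (X, Y)) (Y := (X', Y')) (f, g)

lemma comparison_natural_left {X X' : D} (f : X ⟶ X') (Y : D) :
    G.map (f ▷ Y) ≫ (R.comparison S X' Y).hom = (R.comparison S X Y).hom ≫ G.map f ▷ G.obj Y := by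
  have h := R.comparison_natural S f (𝟙 Y)
  rwa [G.map_id, tensorHom_id, tensorHom_id] at h

lemma comparison_natural_right (X : D) {Y Y' : D} (f : Y ⟶ Y') :
    G.map (X ◁ f) ≫ (R.comparison S X Y').hom = (R.comparison S X Y).hom ≫ G.obj X ◁ G.map f := by
  have h := R.comparison_natural S (𝟙 X) f
  rwa [G.map_id, id_tensorHom, id_tensorHom] at h

/-- The comparison of unit objects given by two realizations. -/
noncomputable def unitComparison : G.obj (𝟙_ D) ≅ 𝟙_ D' :=
  let i : I.one ≅ I.one := Iso.refl _
  (Rep.natIso (R.oneRep.postcomp G) S.oneRep i).app ⟨PUnit.unit⟩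

lemma map_oneMor_comp_unitComparison {c : C} (e : El I.one star c) :
    G.map (R.oneMor e) ≫ (R.unitComparison S).hom = S.oneMor e := by
  let i : I.one ⟶ I.one := 𝟙 _
  exact Rep.mor_comp_natTrans (R.oneRep.postcomp G) S.oneRep i (a := ⟨PUnit.unit⟩) e

/-- It is tested on composites of represented multiplications. The single relation `I.Assoc` yields
the associativity equations of both realizations, and the comparison carries one to the other. -/
lemma comparison_assoc_obj (a b c : C) :
    (R.comparison S (F.obj a ⊗ F.obj b) (F.obj c)).hom ≫
        (R.comparison S (F.obj a) (F.obj b)).hom ▷ G.obj (F.obj c) ≫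
          (α_ (G.obj (F.obj a)) (G.obj (F.obj b)) (G.obj (F.obj c))).hom =
      G.map (α_ (F.obj a) (F.obj b) (F.obj c)).hom ≫
        (R.comparison S (F.obj a) (F.obj b ⊗ F.obj c)).hom ≫
          G.obj (F.obj a) ◁ (R.comparison S (F.obj b) (F.obj c)).hom := by
  refine F.retractDense_hom_ext G fun d v => ?_
  obtain ⟨x, p, q, rfl⟩ := R.exists_mul_mul v
  obtain ⟨y, p', q', h⟩ := PseudomonoidData.exists_assoc R.mulRep p q
  have h₁ := (R.assoc_iff _ _ _ _).1 h
  have h₂ : S.mulMor q ≫ S.mulMor p ▷ G.obj (F.obj c) ≫ (α_ (G.obj (F.obj a)) (G.obj (F.obj b)) (G.obj (F.obj c))).hom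
    = S.mulMor q' ≫ G.obj (F.obj a) ◁ S.mulMor p' := S.assoc p q p' q' h
  rw [← G.map_comp_assoc, Category.assoc, h₁, G.map_comp, G.map_comp, Category.assoc, Category.assoc,
    reassoc_of% R.comparison_natural_left S (R.mulMor p),
    reassoc_of% R.comparison_natural_right S _ (R.mulMor p'), ← MonoidalCategory.comp_whiskerRight_assoc,
    ← MonoidalCategory.whiskerLeft_comp, map_mulMor_comp_comparison, map_mulMor_comp_comparison,
    reassoc_of% R.map_mulMor_comp_comparison S q, reassoc_of% R.map_mulMor_comp_comparison S q', h₂]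

lemma comparison_assoc (X Y Z : D) :
    (R.comparison S (X ⊗ Y) Z).hom ≫ (R.comparison S X Y).hom ▷ G.obj Z ≫
        (α_ (G.obj X) (G.obj Y) (G.obj Z)).hom =
      G.map (α_ X Y Z).hom ≫ (R.comparison S X (Y ⊗ Z)).hom ≫ G.obj X ◁ (R.comparison S Y Z).hom := by
  let x := F.coverRetract X
  let y := F.coverRetract Y
  let z := F.coverRetract Z
  have : IsSplitEpi (G.map ((x.r ⊗ₘ y.r) ⊗ₘ z.r)) := .mk' ⟨G.map ((x.i ⊗ₘ y.i) ⊗ₘ z.i), by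
    rw [← G.map_comp, tensorHom_comp_tensorHom, tensorHom_comp_tensorHom, x.retract, y.retract, z.retract,
      id_tensorHom_id, id_tensorHom_id, G.map_id]⟩
  rw [← cancel_epi (G.map ((x.r ⊗ₘ y.r) ⊗ₘ z.r)), reassoc_of% R.comparison_natural S (x.r ⊗ₘ y.r) z.r,
    ← G.map_comp_assoc, associator_naturality, G.map_comp_assoc,
    reassoc_of% R.comparison_natural S x.r (y.r ⊗ₘ z.r)]
  have h₁ : (G.map (x.r ⊗ₘ y.r) ⊗ₘ G.map z.r) ≫ (R.comparison S X Y).hom ▷ G.obj Z =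
      (R.comparison S _ _).hom ▷ _ ≫ ((G.map x.r ⊗ₘ G.map y.r) ⊗ₘ G.map z.r) := by
    rw [← tensorHom_id, ← tensorHom_id, tensorHom_comp_tensorHom, tensorHom_comp_tensorHom,
      R.comparison_natural, Category.comp_id, Category.id_comp]
  have h₂ : (G.map x.r ⊗ₘ G.map (y.r ⊗ₘ z.r)) ≫ G.obj X ◁ (R.comparison S Y Z).hom =
      _ ◁ (R.comparison S _ _).hom ≫ (G.map x.r ⊗ₘ (G.map y.r ⊗ₘ G.map z.r)) := by
    rw [← id_tensorHom, ← id_tensorHom, tensorHom_comp_tensorHom, tensorHom_comp_tensorHom,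
      R.comparison_natural, Category.comp_id, Category.id_comp]
  have h := R.comparison_assoc_obj S (F.cover X) (F.cover Y) (F.cover Z)
  rw [reassoc_of% h₁, h₂, associator_naturality, ← reassoc_of% h]

/-- On image objects, both realizations evaluate the same morphism `I.lam e p`; naturality along the
retraction of a cover extends this to all objects. -/
lemma comparison_leftUnitor (X : D) :
    G.map (λ_ X).hom = (R.comparison S (𝟙_ D) X).hom ≫ (R.unitComparison S).hom ▷ G.obj X ≫
      (λ_ (G.obj X)).hom := by
  have hobj (a : C) : G.map (λ_ (F.obj a)).hom = (R.comparison S (𝟙_ D) (F.obj a)).hom ≫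
      (R.unitComparison S).hom ▷ G.obj (F.obj a) ≫ (λ_ (G.obj (F.obj a))).hom := by
    refine F.retractDense_hom_ext G fun c v => ?_
    let r := F.coverRetract (𝟙_ D)
    obtain ⟨e, he⟩ := R.exists_oneMor r.r
    obtain ⟨p, hp⟩ := R.exists_mulMor (v ≫ r.i ▷ F.obj a)
    have hv : R.mulMor p ≫ R.oneMor e ▷ F.obj a = v := by
      rw [he, hp, Category.assoc, ← MonoidalCategory.comp_whiskerRight, r.retract]
      simp
    have h₁ := congrArg G.map (R.map_lam e p)
    have h₂ : G.map (F.map (I.lam e p)) =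
      S.mulMor p ≫ S.oneMor e ▷ G.obj (F.obj a) ≫ (λ_ (G.obj (F.obj a))).hom := S.map_lam e p
    rw [← Category.assoc, hv] at h₁
    rw [← G.map_comp, ← h₁, h₂, ← hv, G.map_comp, Category.assoc,
      reassoc_of% R.comparison_natural_left S (R.oneMor e), reassoc_of% R.map_mulMor_comp_comparison S p,
      ← MonoidalCategory.comp_whiskerRight_assoc, map_oneMor_comp_unitComparison]
  let x := F.coverRetract X
  have : IsSplitEpi (G.map (𝟙_ D ◁ x.r)) := .mk' ⟨G.map (𝟙_ D ◁ x.i), by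
    rw [← G.map_comp, ← MonoidalCategory.whiskerLeft_comp, x.retract, MonoidalCategory.whiskerLeft_id, G.map_id]⟩
  rw [← cancel_epi (G.map (𝟙_ D ◁ x.r)), ← G.map_comp, MonoidalCategory.leftUnitor_naturality, G.map_comp, hobj,
    reassoc_of% R.comparison_natural_right S (𝟙_ D) x.r]
  simp only [Category.assoc]
  rw [MonoidalCategory.whisker_exchange_assoc, MonoidalCategory.leftUnitor_naturality]

lemma comparison_rightUnitor (X : D) :
    G.map (ρ_ X).hom = (R.comparison S X (𝟙_ D)).hom ≫ G.obj X ◁ (R.unitComparison S).hom ≫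
      (ρ_ (G.obj X)).hom := by
  have hobj (a : C) : G.map (ρ_ (F.obj a)).hom = (R.comparison S (F.obj a) (𝟙_ D)).hom ≫
      G.obj (F.obj a) ◁ (R.unitComparison S).hom ≫ (ρ_ (G.obj (F.obj a))).hom := by
    refine F.retractDense_hom_ext G fun c v => ?_
    let r := F.coverRetract (𝟙_ D)
    obtain ⟨e, he⟩ := R.exists_oneMor r.r
    obtain ⟨p, hp⟩ := R.exists_mulMor (v ≫ F.obj a ◁ r.i)
    have hv : R.mulMor p ≫ F.obj a ◁ R.oneMor e = v := by
      rw [he, hp, Category.assoc, ← MonoidalCategory.whiskerLeft_comp, r.retract]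
      simp
    have h₁ := congrArg G.map (R.map_rho e p)
    have h₂ : G.map (F.map (I.rho e p)) =
      S.mulMor p ≫ G.obj (F.obj a) ◁ S.oneMor e ≫ (ρ_ (G.obj (F.obj a))).hom := S.map_rho e p
    rw [← Category.assoc, hv] at h₁
    rw [← G.map_comp, ← h₁, h₂, ← hv, G.map_comp, Category.assoc,
      reassoc_of% R.comparison_natural_right S _ (R.oneMor e), reassoc_of% R.map_mulMor_comp_comparison S p,
      ← MonoidalCategory.whiskerLeft_comp_assoc, map_oneMor_comp_unitComparison]
  let x := F.coverRetract X
  have : IsSplitEpi (G.map (x.r ▷ 𝟙_ D)) := .mk' ⟨G.map (x.i ▷ 𝟙_ D), by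
    rw [← G.map_comp, ← MonoidalCategory.comp_whiskerRight, x.retract, MonoidalCategory.id_whiskerRight,
      G.map_id]⟩
  rw [← cancel_epi (G.map (x.r ▷ 𝟙_ D)), ← G.map_comp, MonoidalCategory.rightUnitor_naturality, G.map_comp, hobj,
    reassoc_of% R.comparison_natural_left S x.r (𝟙_ D)]
  simp only [Category.assoc]
  rw [← MonoidalCategory.whisker_exchange_assoc, MonoidalCategory.rightUnitor_naturality]

/-- The oplax monoidal structure given by two realizations. -/
@[reducible] noncomputable def oplaxMonoidalFunctor : G.OplaxMonoidal where
  η := (R.unitComparison S).hom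
  δ X Y := (R.comparison S X Y).hom
  δ_natural_left f Y := (R.comparison_natural_left S f Y).symm
  δ_natural_right X f := (R.comparison_natural_right S X f).symm
  oplax_associativity := R.comparison_assoc S
  oplax_left_unitality X := by
    rw [← cancel_mono (λ_ (G.obj X)).hom]
    simp only [Category.assoc]
    rw [← R.comparison_leftUnitor S, ← G.map_comp]
    simp
  oplax_right_unitality X := by
    rw [← cancel_mono (ρ_ (G.obj X)).hom]
    simp only [Category.assoc]
    rw [← R.comparison_rightUnitor S, ← G.map_comp]
    simp

/-- The monoidal structure given by two realizations. -/
@[reducible] noncomputable def monoidalFunctor : G.Monoidal :=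
  letI := R.oplaxMonoidalFunctor S
  haveI : IsIso (η G) := inferInstanceAs (IsIso (R.unitComparison S).hom)
  haveI (X Y : D) : IsIso (δ G X Y) := inferInstanceAs (IsIso (R.comparison S X Y).hom)
  Functor.Monoidal.ofOplaxMonoidal G

lemma mapCompat_monoidalFunctor : R.MapCompat S (R.monoidalFunctor S) :=
  ⟨fun p => (R.map_mulMor_comp_comparison S p).symm, fun e => (R.map_oneMor_comp_unitComparison S e).symm⟩

/-- Two realizations of an interpretation, one along `F` and one along `F ⋙ G`, are related by a unique monoidal
structure on `G`. -/
theorem existsUnique_mapCompat : ∃! M : G.Monoidal, R.MapCompat S M :=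
  ⟨R.monoidalFunctor S, R.mapCompat_monoidalFunctor S, fun _ h => h.unique (R.mapCompat_monoidalFunctor S)⟩

variable {R S}

/-- Comultiplications are determined by multiplications, as right adjoints: composed with `S.mulMor
p`, both sides give the image of `I.mulCounit q p`. -/
lemma MapCompat.comulMor_eq {_ : G.Monoidal} (h : R.MapCompat S ‹_›) {a b c : C} (q : El I.comul c (a, b)) :
    S.comulMor q = μ G (F.obj a) (F.obj b) ≫ G.map (R.comulMor q) := by
  rw [← cancel_epi (δ G (F.obj a) (F.obj b)), Functor.Monoidal.δ_μ_assoc]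
  refine F.retractDense_hom_ext G fun x v => ?_
  obtain ⟨p, rfl⟩ := R.exists_mulMor v
  have h₁ : G.map (F.map (I.mulCounit q p)) = S.mulMor p ≫ S.comulMor q := S.map_mulCounit q p
  rw [← G.map_comp, ← R.map_mulCounit, h₁, h.1, Category.assoc]

/-- The trace of `D'` restricts along the fully faithful `G` to an operation on `D`. It is
compatible with the same 2-morphism as `t`, hence equal to it. -/
lemma MapCompat.preservesTrace {_ : G.Monoidal} (h : R.MapCompat S ‹_›) {T : I.traceLoop ⟶ 𝟙 C} {t : RightTrace D}
    {t' : RightTrace D'} (ht : R.TraceCompat T t.toTraceOperator) (ht' : S.TraceCompat T t'.toTraceOperator) :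
    PreservesTrace G t t' := by
  let τ : TraceOperator D :=
    { tr := fun {a b} x f => G.preimage (t'.tr (G.obj x) (μ G a x ≫ G.map f ≫ δ G b x))
      tightening := fun {a a' b b' x} g f k => G.map_injective (by
        simp only [G.map_preimage, G.map_comp]
        rw [← t'.tightening]
        simp)
      sliding := fun {a b x y} f g => G.map_injective (by
        simp only [G.map_preimage, G.map_comp]
        have h := t'.sliding (μ G a x ≫ G.map f ≫ δ G b y) (G.map g)
        simpa using h) }
  have hτ : R.TraceCompat T τ := fun {a b x y} p q => G.map_injective (by
    have h₁ : G.map (F.map (I.trAt T p q)) = t'.tr (G.obj (F.obj x)) (S.comulMor q ≫ S.mulMor p) := ht' p q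
    rw [h.comulMor_eq, h.1, Category.assoc, ← G.map_comp_assoc] at h₁
    exact h₁.trans (G.map_preimage _).symm)
  have h₂ := ht.eq_of_traceCompat' hτ
  intro a b x f
  have h₃ : t.tr x f = τ.tr x f := by rw [h₂]
  rw [h₃]
  exact G.map_preimage _

end MonoidalRealization

/-! ### Restriction along functors of represented profunctors -/

namespace Prof

section
variable {A B A' B' D : Type u} [SmallCategory A] [SmallCategory B] [SmallCategory A'] [SmallCategory B']
  [SmallCategory D] {K₀ : A ⥤ A'} {K : B ⥤ B'} {H : B ⥤ D} {F' : B' ⥤ D} {X : A ⥤ D} {X' : A' ⥤ D}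

/-- The restriction of a representation along functors. -/
def Rep.pullback {P : Profunctor.{u} A B} {P' : Profunctor.{u} A' B'} (r : Rep P' F' X')
    (e : P ≅ P'.whiskerLeft₂ K₀ K) (θ : H ≅ K ⋙ F') (τ : X ≅ K₀ ⋙ X') : Rep P H X where
  mor {a b} p := θ.hom.app b ≫ r.mor (a := K₀.obj a) (b := K.obj b) (app e.hom p) ≫ τ.inv.app a
  bijective a b := by
    have h : Function.Bijective fun f : F'.obj (K.obj b) ⟶ X'.obj (K₀.obj a) =>
        θ.hom.app b ≫ f ≫ τ.inv.app a :=
      Function.bijective_iff_has_inverse.2 ⟨fun g => θ.inv.app b ≫ g ≫ τ.hom.app a,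
        fun f => by simp [← Functor.comp_obj], fun g => by simp⟩
    exact h.comp ((r.bijective _ _).comp (app_hom_bijective e a b))
  mor_act f g p := by
    rw [app_act]
    have h := r.mor_act (K₀.map f) (K.map g) (app e.hom p)
    refine (congrArg (fun k => θ.hom.app _ ≫ k ≫ τ.inv.app _) h).trans ?_
    have h₁ := θ.hom.naturality g
    have h₂ := τ.inv.naturality f
    simp only [Functor.comp_map] at h₁ h₂
    simp only [Category.assoc]
    rw [← reassoc_of% h₁, h₂]

/-- The restriction of a corepresentation along functors. -/
def Corep.pullback {P : Profunctor.{u} B A} {P' : Profunctor.{u} B' A'} (r : Corep P' F' X')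
    (e : P ≅ P'.whiskerLeft₂ K K₀) (θ : H ≅ K ⋙ F') (τ : X ≅ K₀ ⋙ X') : Corep P H X where
  mor {a b} p := τ.hom.app a ≫ r.mor (a := K₀.obj a) (b := K.obj b) (app e.hom p) ≫ θ.inv.app b
  bijective a b := by
    have h : Function.Bijective fun f : X'.obj (K₀.obj a) ⟶ F'.obj (K.obj b) =>
        τ.hom.app a ≫ f ≫ θ.inv.app b :=
      Function.bijective_iff_has_inverse.2 ⟨fun g => τ.inv.app a ≫ g ≫ θ.hom.app b,
        fun f => by simp [← Functor.comp_obj], fun g => by simp⟩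
    exact h.comp ((r.bijective _ _).comp (app_hom_bijective e b a))
  mor_act f g p := by
    rw [app_act]
    have h := r.mor_act (K.map f) (K₀.map g) (app e.hom p)
    refine (congrArg (fun k => τ.hom.app _ ≫ k ≫ θ.inv.app _) h).trans ?_
    have h₁ := τ.hom.naturality g
    have h₂ := θ.inv.naturality f
    simp only [Functor.comp_map] at h₁ h₂
    simp only [Category.assoc]
    rw [← reassoc_of% h₁, h₂]

/-- The isomorphism given by two corepresentations of the same functor. -/
noncomputable def Corep.isoOfCorep {P Q : Profunctor.{u} B A} (r : Corep P H X) (s : Corep Q H X) : P ≅ Q where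
  hom := homMk (fun b a p => s.elt (r.mor p)) (fun f g p => s.ext (by simp [s.mor_act, r.mor_act]))
  inv := homMk (fun b a p => r.elt (s.mor p)) (fun f g p => r.ext (by simp [s.mor_act, r.mor_act]))
  hom_inv_id := hom_ext fun a b p => r.ext (by simp)
  inv_hom_id := hom_ext fun a b p => s.ext (by simp)

lemma Corep.mor_app_isoOfCorep_hom {P Q : Profunctor.{u} B A} (r : Corep P H X) (s : Corep Q H X) {a : A} {b : B}
    (p : El P b a) : s.mor (app (r.isoOfCorep s).hom p) = r.mor p := s.mor_elt _

end

end Prof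

/-! ### Transport of a realization along an isomorphism of functors -/

open MonoidalCategory

section
variable {C C' D' : Prof.{u}} [MonoidalCategory D'] {K : C ⥤ C'} {H : C ⥤ D'} {F' : C' ⥤ D'}

/-- The isomorphism of tensor products given by an isomorphism of functors. -/
def tensorNatIso (θ : H ≅ K ⋙ F') : (H.prod H) ⋙ tensor D' ≅ (K.prod K) ⋙ (F'.prod F') ⋙ tensor D' :=
  NatIso.ofComponents (fun x => θ.app x.1 ⊗ᵢ θ.app x.2) (fun {x y} f => by
    have h : (H.map f.1 ⊗ₘ H.map f.2) ≫ (θ.hom.app y.1 ⊗ₘ θ.hom.app y.2) =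
        (θ.hom.app x.1 ⊗ₘ θ.hom.app x.2) ≫ (F'.map (K.map f.1) ⊗ₘ F'.map (K.map f.2)) := by
      rw [tensorHom_comp_tensorHom, tensorHom_comp_tensorHom, θ.hom.naturality, θ.hom.naturality]
      rfl
    exact h)

namespace InterpretationEquiv

variable {I : TracedPseudomonoid C} {I' : TracedPseudomonoid C'} (e : InterpretationEquiv K I I')

/-- The action of an equivalence of interpretations on the elements of the multiplication. -/
def mulMap {a b c : C} (p : El I.mul (a, b) c) : El I'.mul (K.obj a, K.obj b) (K.obj c) := app e.mulIso.hom p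

/-- The action of an equivalence of interpretations on the elements of the comultiplication. -/
def comulMap {a b c : C} (p : El I.comul c (a, b)) : El I'.comul (K.obj c) (K.obj a, K.obj b) :=
  app e.comulIso.hom p

/-- The action of an equivalence of interpretations on the elements of the unit. -/
def oneMap {c : C} (p : El I.one star c) : El I'.one star (K.obj c) := app e.oneIso.hom p

/-- The action of an equivalence of interpretations on the elements of the counit. -/
def cooneMap {c : C} (p : El I.coone c star) : El I'.coone (K.obj c) star := app e.cooneIso.hom p

end InterpretationEquiv

namespace MonoidalRealization

variable {I : TracedPseudomonoid C} {I' : TracedPseudomonoid C'}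
  (R' : MonoidalRealization F' I'.toRightAdjointPseudomonoid) (e : InterpretationEquiv K I I')
  (θ : H ≅ K ⋙ F')

/-- The multiplication is represented along an equivalence of interpretations. -/
def pullbackMulRep : Rep (A := C × C) (B := C) I.mul H ((H.prod H) ⋙ tensor D') :=
  R'.mulRep.pullback e.mulIso θ (tensorNatIso θ)

/-- The comultiplication is corepresented along an equivalence of interpretations. -/
def pullbackComulRep : Corep (A := C × C) (B := C) I.comul H ((H.prod H) ⋙ tensor D') :=
  R'.comulRep.pullback e.comulIso θ (tensorNatIso θ)

variable (D') in
/-- The constant functor at the unit object, restricted along the identity. -/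
def unitNatIso : 𝟭 (Discrete PUnit.{u + 1}) ⋙ (Functor.const (Discrete PUnit.{u + 1})).obj (𝟙_ D') ≅
    𝟭 (Discrete PUnit.{u + 1}) ⋙ 𝟭 (Discrete PUnit.{u + 1}) ⋙ (Functor.const (Discrete PUnit.{u + 1})).obj (𝟙_ D') :=
  NatIso.ofComponents (fun _ => Iso.refl (𝟙_ D'))

/-- The unit is represented along an equivalence of interpretations. -/
def pullbackOneRep : Rep (A := Discrete PUnit.{u + 1}) (B := C) I.one H
    (𝟭 _ ⋙ (Functor.const (Discrete PUnit.{u + 1})).obj (𝟙_ D')) :=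
  R'.oneRep.pullback e.oneIso θ (unitNatIso D')

/-- The counit is corepresented along an equivalence of interpretations. -/
def pullbackCooneRep : Corep (A := Discrete PUnit.{u + 1}) (B := C) I.coone H
    (𝟭 _ ⋙ (Functor.const (Discrete PUnit.{u + 1})).obj (𝟙_ D')) :=
  R'.cooneRep.pullback e.cooneIso θ (unitNatIso D')

/-- The multiplication of a realization, transported along `θ`. -/
def conjMulMor {a b c : C} (p : El I'.mul (K.obj a, K.obj b) (K.obj c)) : H.obj c ⟶ H.obj a ⊗ H.obj b :=
  θ.hom.app c ≫ R'.mulMor p ≫ (θ.inv.app a ⊗ₘ θ.inv.app b)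

/-- The comultiplication of a realization, transported along `θ`. -/
def conjComulMor {a b c : C} (p : El I'.comul (K.obj c) (K.obj a, K.obj b)) : H.obj a ⊗ H.obj b ⟶ H.obj c :=
  (θ.hom.app a ⊗ₘ θ.hom.app b) ≫ R'.comulMor p ≫ θ.inv.app c

/-- The unit of a realization, transported along `θ`. -/
def conjOneMor {c : C} (p : El I'.one star (K.obj c)) : H.obj c ⟶ 𝟙_ D' := θ.hom.app c ≫ R'.oneMor p

/-- The counit of a realization, transported along `θ`. -/
def conjCooneMor {c : C} (p : El I'.coone (K.obj c) star) : 𝟙_ D' ⟶ H.obj c := R'.cooneMor p ≫ θ.inv.app c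

lemma pullbackOneRep_mor {c : C} (p : El I.one star c) :
    (R'.pullbackOneRep e θ).mor (a := ⟨PUnit.unit⟩) p = R'.conjOneMor θ (e.oneMap p) :=
  congrArg (θ.hom.app c ≫ ·) (Category.comp_id (R'.oneMor (e.oneMap p)))

lemma pullbackCooneRep_mor {c : C} (p : El I.coone c star) :
    (R'.pullbackCooneRep e θ).mor (a := ⟨PUnit.unit⟩) p = R'.conjCooneMor θ (e.cooneMap p) :=
  Category.id_comp (R'.cooneMor (e.cooneMap p) ≫ θ.inv.app c)

lemma conjComulMor_comp_conjMulMor {a b a' b' c : C} (p : El I'.mul (K.obj a, K.obj b) (K.obj c))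
    (q : El I'.comul (K.obj c) (K.obj a', K.obj b')) :
    R'.conjComulMor θ q ≫ R'.conjMulMor θ p =
      (θ.hom.app a' ⊗ₘ θ.hom.app b') ≫ (R'.comulMor q ≫ R'.mulMor p) ≫ (θ.inv.app a ⊗ₘ θ.inv.app b) := by
  simp only [conjComulMor, conjMulMor, Category.assoc]
  rw [θ.inv_hom_id_app_assoc]

lemma conjMulMor_comp_conjComulMor {a b c c' : C} (p : El I'.mul (K.obj a, K.obj b) (K.obj c))
    (q : El I'.comul (K.obj c') (K.obj a, K.obj b)) :
    R'.conjMulMor θ p ≫ R'.conjComulMor θ q = θ.hom.app c ≫ F'.map (I'.mulCounit q p) ≫ θ.inv.app c' := by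
  simp only [conjComulMor, conjMulMor, Category.assoc]
  rw [R'.map_mulCounit, tensorHom_comp_tensorHom_assoc, Iso.inv_hom_id_app, Iso.inv_hom_id_app]
  have h : (𝟙 ((K ⋙ F').obj a) ⊗ₘ 𝟙 ((K ⋙ F').obj b)) ≫ R'.comulMor q ≫ θ.inv.app c' =
      R'.comulMor q ≫ θ.inv.app c' := by
    rw [id_tensorHom_id]
    exact Category.id_comp _
  rw [h, Category.assoc]

/-- By naturality of the associator, both sides of the first equation are those of the second
between the same two components of `θ`, which are invertible. -/
lemma conjMulMor_assoc_iff {a b c d x y : C} (p : El I'.mul (K.obj a, K.obj b) (K.obj x))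
    (q : El I'.mul (K.obj x, K.obj c) (K.obj d)) (r : El I'.mul (K.obj b, K.obj c) (K.obj y))
    (s : El I'.mul (K.obj a, K.obj y) (K.obj d)) :
    R'.conjMulMor θ q ≫ R'.conjMulMor θ p ▷ H.obj c ≫ (α_ (H.obj a) (H.obj b) (H.obj c)).hom =
        R'.conjMulMor θ s ≫ H.obj a ◁ R'.conjMulMor θ r ↔
      R'.mulMor q ≫ R'.mulMor p ▷ F'.obj (K.obj c) ≫
          (α_ (F'.obj (K.obj a)) (F'.obj (K.obj b)) (F'.obj (K.obj c))).hom =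
        R'.mulMor s ≫ F'.obj (K.obj a) ◁ R'.mulMor r := by
  have h₁ : R'.conjMulMor θ q ≫ R'.conjMulMor θ p ▷ H.obj c ≫ (α_ (H.obj a) (H.obj b) (H.obj c)).hom =
      θ.hom.app d ≫ (R'.mulMor q ≫ R'.mulMor p ▷ F'.obj (K.obj c) ≫
        (α_ (F'.obj (K.obj a)) (F'.obj (K.obj b)) (F'.obj (K.obj c))).hom) ≫
          (θ.inv.app a ⊗ₘ (θ.inv.app b ⊗ₘ θ.inv.app c)) := by
    have h : (θ.inv.app x ⊗ₘ θ.inv.app c) ≫ R'.conjMulMor θ p ▷ H.obj c =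
        R'.mulMor p ▷ F'.obj (K.obj c) ≫ ((θ.inv.app a ⊗ₘ θ.inv.app b) ⊗ₘ θ.inv.app c) := by
      rw [← tensorHom_id, ← tensorHom_id, tensorHom_comp_tensorHom, tensorHom_comp_tensorHom, conjMulMor,
        θ.inv_hom_id_app_assoc, Category.comp_id]
      exact congrArg (_ ⊗ₘ ·) (Category.id_comp _).symm
    have h' := associator_naturality (θ.inv.app a) (θ.inv.app b) (θ.inv.app c)
    conv_lhs => rw [conjMulMor]
    simp only [Category.assoc]
    rw [reassoc_of% h, h']
    rfl
  have h₂ : R'.conjMulMor θ s ≫ H.obj a ◁ R'.conjMulMor θ r =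
      θ.hom.app d ≫ (R'.mulMor s ≫ F'.obj (K.obj a) ◁ R'.mulMor r) ≫
        (θ.inv.app a ⊗ₘ (θ.inv.app b ⊗ₘ θ.inv.app c)) := by
    have h : (θ.inv.app a ⊗ₘ θ.inv.app y) ≫ H.obj a ◁ R'.conjMulMor θ r =
        F'.obj (K.obj a) ◁ R'.mulMor r ≫ (θ.inv.app a ⊗ₘ (θ.inv.app b ⊗ₘ θ.inv.app c)) := by
      rw [← id_tensorHom, ← id_tensorHom, tensorHom_comp_tensorHom, tensorHom_comp_tensorHom, conjMulMor,
        θ.inv_hom_id_app_assoc, Category.comp_id]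
      exact congrArg (· ⊗ₘ _) (Category.id_comp _).symm
    conv_lhs => rw [conjMulMor]
    simp only [Category.assoc]
    rw [h]
  rw [h₁, h₂, cancel_epi, cancel_mono]

lemma map_lam_conj {x b c : C} (e : El I'.one star (K.obj x)) (p : El I'.mul (K.obj x, K.obj b) (K.obj c)) :
    R'.conjMulMor θ p ≫ R'.conjOneMor θ e ▷ H.obj b ≫ (λ_ (H.obj b)).hom =
      θ.hom.app c ≫ F'.map (I'.lam e p) ≫ θ.inv.app b := by
  have h : (θ.inv.app x ⊗ₘ θ.inv.app b) ≫ R'.conjOneMor θ e ▷ H.obj b =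
      R'.oneMor e ▷ F'.obj (K.obj b) ≫ 𝟙_ D' ◁ θ.inv.app b := by
    rw [← tensorHom_id, ← tensorHom_id, ← id_tensorHom, tensorHom_comp_tensorHom, tensorHom_comp_tensorHom,
      conjOneMor, θ.inv_hom_id_app_assoc, Category.comp_id, Category.comp_id]
    exact congrArg (_ ⊗ₘ ·) (Category.id_comp _).symm
  rw [conjMulMor, R'.map_lam]
  simp only [Category.assoc]
  rw [reassoc_of% h, MonoidalCategory.leftUnitor_naturality]

lemma map_rho_conj {x b c : C} (e : El I'.one star (K.obj x)) (p : El I'.mul (K.obj b, K.obj x) (K.obj c)) :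
    R'.conjMulMor θ p ≫ H.obj b ◁ R'.conjOneMor θ e ≫ (ρ_ (H.obj b)).hom =
      θ.hom.app c ≫ F'.map (I'.rho e p) ≫ θ.inv.app b := by
  have h : (θ.inv.app b ⊗ₘ θ.inv.app x) ≫ H.obj b ◁ R'.conjOneMor θ e =
      F'.obj (K.obj b) ◁ R'.oneMor e ≫ θ.inv.app b ▷ 𝟙_ D' := by
    rw [← tensorHom_id, ← id_tensorHom, ← id_tensorHom, tensorHom_comp_tensorHom, tensorHom_comp_tensorHom,
      conjOneMor, θ.inv_hom_id_app_assoc, Category.comp_id, Category.comp_id]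
    exact congrArg (· ⊗ₘ _) (Category.id_comp _).symm
  rw [conjMulMor, R'.map_rho]
  simp only [Category.assoc]
  rw [reassoc_of% h, MonoidalCategory.rightUnitor_naturality]

/-- The components of `θ` are retracts, so `tr_retract_all` applies, and the inner factors cancel
because these retracts are invertible. -/
lemma tr_conj (τ : TraceOperator D') {a b x y : C} (p : El I'.mul (K.obj b, K.obj x) (K.obj y))
    (q : El I'.comul (K.obj y) (K.obj a, K.obj x)) :
    τ.tr (H.obj x) (R'.conjComulMor θ q ≫ R'.conjMulMor θ p) =
      θ.hom.app a ≫ τ.tr (F'.obj (K.obj x)) (R'.comulMor q ≫ R'.mulMor p) ≫ θ.inv.app b := by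
  let ret (c : C) : Retract (H.obj c) (F'.obj (K.obj c)) := ⟨θ.hom.app c, θ.inv.app c, θ.hom_inv_id_app c⟩
  have h (c : C) : θ.inv.app c ≫ θ.hom.app c = 𝟙 (F'.obj (K.obj c)) := θ.inv_hom_id_app c
  rw [τ.tr_retract_all (ret a) (ret b) (ret x), conjComulMor_comp_conjMulMor]
  simp only [ret, Category.assoc]
  rw [tensorHom_comp_tensorHom, tensorHom_comp_tensorHom_assoc, h, h, h, id_tensorHom_id, id_tensorHom_id,
    Category.id_comp, Category.comp_id]

lemma map_conj {a b : C} (f : a ⟶ b) : θ.hom.app a ≫ F'.map (K.map f) ≫ θ.inv.app b = H.map f := by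
  have h := θ.hom.naturality f
  simp only [Functor.comp_map] at h
  rw [← reassoc_of% h, θ.hom_inv_id_app, Category.comp_id]

end MonoidalRealization

end

/-! ### Full faithfulness inherited from a composite -/

namespace CategoryTheory.Functor
variable {A B E : Type*} [Category* A] [Category* B] [Category* E]

lemma RetractDense.of_iso {F G : A ⥤ B} [F.RetractDense] (θ : F ≅ G) : G.RetractDense where
  exists_retract b := ⟨F.cover b, ⟨(F.coverRetract b).trans (.ofIso (θ.app _))⟩⟩

instance (F : A ⥤ B) (G : B ⥤ E) [F.RetractDense] [G.RetractDense] : (F ⋙ G).RetractDense where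
  exists_retract b := ⟨F.cover (G.cover b),
    ⟨(G.coverRetract b).trans ((F.coverRetract (G.cover b)).map G)⟩⟩

/-- A morphism between images is enlarged to one between the images of the covers, lifted there, and
cut down again by the retracts. -/
lemma full_of_comp_of_retractDense (F : A ⥤ B) (G : B ⥤ E) [F.RetractDense] [(F ⋙ G).Full] : G.Full where
  map_surjective {X Y} h := by
    let x := (F.coverRetract X).map G
    let y := (F.coverRetract Y).map G
    let k : F.cover X ⟶ F.cover Y := (F ⋙ G).preimage (x.r ≫ h ≫ y.i)
    have hk : G.map (F.map k) = x.r ≫ h ≫ y.i := (F ⋙ G).map_preimage _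
    refine ⟨(F.coverRetract X).i ≫ F.map k ≫ (F.coverRetract Y).r, ?_⟩
    rw [G.map_comp, G.map_comp, hk]
    change x.i ≫ (x.r ≫ h ≫ y.i) ≫ y.r = h
    simp

lemma faithful_of_comp_of_retractDense (F : A ⥤ B) (G : B ⥤ E) [F.Full] [F.RetractDense] [(F ⋙ G).Faithful] :
    G.Faithful where
  map_injective {X Y} f g h := by
    let x := F.coverRetract X
    let y := F.coverRetract Y
    have hk : F.preimage (x.r ≫ f ≫ y.i) = F.preimage (x.r ≫ g ≫ y.i) := (F ⋙ G).map_injective (by simp [h])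
    have h' := congrArg F.map hk
    rw [F.map_preimage, F.map_preimage] at h'
    exact (cancel_mono y.i).1 ((cancel_epi x.r).1 h')

end CategoryTheory.Functor

namespace Prof

section
variable {A B A' B' D D' : Type u} [SmallCategory A] [SmallCategory B] [SmallCategory A'] [SmallCategory B']
  [SmallCategory D] [SmallCategory D'] {H : B ⥤ D} {F' : B' ⥤ D} {X : A ⥤ D} {X' : A' ⥤ D}

/-- The image of a corepresentation under a fully faithful functor. -/
def Corep.postcomp {P : Profunctor.{u} B A} {F : B ⥤ D} {X : A ⥤ D} (r : Corep P F X) (G : D ⥤ D') [G.Full]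
    [G.Faithful] : Corep P (F ⋙ G) (X ⋙ G) where
  mor p := G.map (r.mor p)
  bijective a b := ⟨fun _ _ h => r.ext (G.map_injective h), fun f => by
    obtain ⟨p, hp⟩ := r.exists_elt (G.preimage f)
    exact ⟨p, (congrArg G.map hp).trans (G.map_preimage f)⟩⟩
  mor_act f g p := by simp [r.mor_act]

/-- The isomorphism given by two representations of the same functor. -/
noncomputable def Rep.isoOfRep {P Q : Profunctor.{u} A B} (r : Rep P H X) (s : Rep Q H X) : P ≅ Q where
  hom := homMk (fun b a p => s.elt (r.mor p)) (fun f g p => s.ext (by simp [s.mor_act, r.mor_act]))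
  inv := homMk (fun b a p => r.elt (s.mor p)) (fun f g p => r.ext (by simp [s.mor_act, r.mor_act]))
  hom_inv_id := hom_ext fun a b p => r.ext (by simp)
  inv_hom_id := hom_ext fun a b p => s.ext (by simp)

lemma Rep.mor_app_isoOfRep_hom {P Q : Profunctor.{u} A B} (r : Rep P H X) (s : Rep Q H X) {a : A} {b : B}
    (p : El P a b) : s.mor (app (r.isoOfRep s).hom p) = r.mor p := s.mor_elt _

/-- The representation of a restricted profunctor. -/
def Rep.whisker {P' : Profunctor.{u} A' B'} (r : Rep P' F' X') {K₀ : A ⥤ A'} {K : B ⥤ B'} (θ : H ≅ K ⋙ F')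
    (τ : X ≅ K₀ ⋙ X') : Rep (P'.whiskerLeft₂ K₀ K) H X := r.pullback (Iso.refl _) θ τ

/-- The corepresentation of a restricted profunctor. -/
def Corep.whisker {P' : Profunctor.{u} B' A'} (r : Corep P' F' X') {K₀ : A ⥤ A'} {K : B ⥤ B'} (θ : H ≅ K ⋙ F')
    (τ : X ≅ K₀ ⋙ X') : Corep (P'.whiskerLeft₂ K K₀) H X := r.pullback (Iso.refl _) θ τ

end

end Prof

/-! ### Realizations and equivalences of interpretations -/

open MonoidalCategory

namespace MonoidalRealization

section
variable {C C' D' : Prof.{u}} [MonoidalCategory D'] {K : C ⥤ C'} {H : C ⥤ D'} {F' : C' ⥤ D'}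
  {I : TracedPseudomonoid C} {I' : TracedPseudomonoid C'}
  (R' : MonoidalRealization F' I'.toRightAdjointPseudomonoid) (e : InterpretationEquiv K I I')
  (θ : H ≅ K ⋙ F')

lemma conjComulMor_comp_conjMulMor_eq_iff {a b a' b' c : C} (f : a' ⟶ a) (g : b' ⟶ b)
    (p : El I'.mul (K.obj a, K.obj b) (K.obj c)) (q : El I'.comul (K.obj c) (K.obj a', K.obj b')) :
    R'.conjComulMor θ q ≫ R'.conjMulMor θ p = H.map f ⊗ₘ H.map g ↔
      R'.comulMor q ≫ R'.mulMor p = F'.map (K.map f) ⊗ₘ F'.map (K.map g) := by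
  rw [conjComulMor_comp_conjMulMor, ← map_conj θ f, ← map_conj θ g, ← tensorHom_comp_tensorHom,
    ← tensorHom_comp_tensorHom, cancel_epi, cancel_mono]

lemma map_conj_eq_iff [F'.Faithful] {a b : C} (f : a ⟶ b) (k : K.obj a ⟶ K.obj b) :
    θ.hom.app a ≫ F'.map k ≫ θ.inv.app b = H.map f ↔ K.map f = k := by
  rw [← map_conj θ f, cancel_epi, cancel_mono]
  exact F'.map_injective.eq_iff.trans eq_comm

lemma conjCooneMor_comp_conjOneMor {c : C} (p : El I'.one star (K.obj c)) (q : El I'.coone (K.obj c) star) :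
    R'.conjCooneMor θ q ≫ R'.conjOneMor θ p = R'.cooneMor q ≫ R'.oneMor p := by
  simp only [conjCooneMor, conjOneMor, Category.assoc]
  rw [θ.inv_hom_id_app_assoc]

lemma conjOneMor_comp_conjCooneMor {c c' : C} (p : El I'.one star (K.obj c)) (q : El I'.coone (K.obj c') star) :
    R'.conjOneMor θ p ≫ R'.conjCooneMor θ q = θ.hom.app c ≫ F'.map (I'.oneCounit q p) ≫ θ.inv.app c' := by
  simp only [conjCooneMor, conjOneMor, Category.assoc]
  rw [R'.map_oneCounit, Category.assoc]

/-- The restriction of a realization along an equivalence of interpretations. -/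
noncomputable def pullback : MonoidalRealization H I.toRightAdjointPseudomonoid where
  mulIso := (R'.pullbackMulRep e θ).toIso
  comulIso := (R'.pullbackComulRep e θ).toIso
  oneIso := Rep.toIso (G := 𝟭 (Discrete PUnit.{u + 1})) (R'.pullbackOneRep e θ)
  cooneIso := Corep.toIso (G := 𝟭 (Discrete PUnit.{u + 1})) (R'.pullbackCooneRep e θ)
  mul_unit f g j j' h := (R'.conjComulMor_comp_conjMulMor_eq_iff θ f g (e.mulMap j) (e.comulMap j')).2
    (R'.comulMor_comp_mulMor (e.mul_unit f g j j' h))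
  mul_counit q p := (map_conj θ _).symm.trans ((congrArg (fun k => θ.hom.app _ ≫ F'.map k ≫ θ.inv.app _)
    (e.mul_counit q p)).trans (R'.conjMulMor_comp_conjComulMor θ (e.mulMap p) (e.comulMap q)).symm)
  one_unit p p' h := (congrArg₂ (· ≫ ·) (R'.pullbackCooneRep_mor e θ p') (R'.pullbackOneRep_mor e θ p)).trans
    ((R'.conjCooneMor_comp_conjOneMor θ _ _).trans (R'.cooneMor_comp_oneMor (e.one_unit p p' h)))
  one_counit q p := (map_conj θ _).symm.trans ((congrArg (fun k => θ.hom.app _ ≫ F'.map k ≫ θ.inv.app _)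
    (e.one_counit q p)).trans ((R'.conjOneMor_comp_conjCooneMor θ (e.oneMap p) (e.cooneMap q)).symm.trans
      (congrArg₂ (· ≫ ·) (R'.pullbackOneRep_mor e θ p) (R'.pullbackCooneRep_mor e θ q)).symm))
  assoc p q r s h := (R'.conjMulMor_assoc_iff θ (e.mulMap p) (e.mulMap q) (e.mulMap r) (e.mulMap s)).2
    (R'.assoc _ _ _ _ (e.assoc p q r s h))
  lunit {_ b _} k p := (map_conj θ _).symm.trans ((congrArg (fun k => θ.hom.app _ ≫ F'.map k ≫ θ.inv.app _)
    (e.lunit k p)).trans ((R'.map_lam_conj θ (e.oneMap k) (e.mulMap p)).symm.trans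
      (congrArg (fun l => R'.conjMulMor θ (e.mulMap p) ≫ l ▷ H.obj b ≫ (λ_ (H.obj b)).hom)
        (R'.pullbackOneRep_mor e θ k)).symm))
  runit {_ b _} k p := (map_conj θ _).symm.trans ((congrArg (fun k => θ.hom.app _ ≫ F'.map k ≫ θ.inv.app _)
    (e.runit k p)).trans ((R'.map_rho_conj θ (e.oneMap k) (e.mulMap p)).symm.trans
      (congrArg (fun l => R'.conjMulMor θ (e.mulMap p) ≫ H.obj b ◁ l ≫ (ρ_ (H.obj b)).hom)
        (R'.pullbackOneRep_mor e θ k)).symm))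

lemma pullback_oneMor {c : C} (p : El I.one star c) :
    (R'.pullback e θ).oneMor p = R'.conjOneMor θ (e.oneMap p) := R'.pullbackOneRep_mor e θ p

lemma pullback_cooneMor {c : C} (p : El I.coone c star) :
    (R'.pullback e θ).cooneMor p = R'.conjCooneMor θ (e.cooneMap p) := R'.pullbackCooneRep_mor e θ p

variable {R'} in
lemma TraceCompat.pullback {τ : TraceOperator D'} (h : R'.TraceCompat I'.Tr τ) :
    (R'.pullback e θ).TraceCompat I.Tr τ := fun {a b x y} p q => by
  have h' : F'.map (I'.trAt I'.Tr (e.mulMap p) (e.comulMap q)) =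
    τ.tr (F'.obj (K.obj x)) (R'.comulMor (e.comulMap q) ≫ R'.mulMor (e.mulMap p)) := h (e.mulMap p) (e.comulMap q)
  refine (map_conj θ _).symm.trans ((congrArg (fun k => θ.hom.app _ ≫ F'.map k ≫ θ.inv.app _)
    (e.trace p q)).trans ((congrArg (fun k => θ.hom.app _ ≫ k ≫ θ.inv.app _) h').trans ?_))
  exact (R'.tr_conj θ τ (e.mulMap p) (e.comulMap q)).symm

variable (S : MonoidalRealization H I.toRightAdjointPseudomonoid)

/-- A right adjoint is determined by its left adjoint: the counit fixes the composites with all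
`mulMor p`, which are jointly epimorphic. -/
lemma comulMor_eq_of_mulMor_eq [H.RetractDense] {S S' : MonoidalRealization H I.toRightAdjointPseudomonoid}
    (h : ∀ {a b c : C} (p : El I.mul (a, b) c), S.mulMor p = S'.mulMor p) {a b c : C} (q : El I.comul c (a, b)) :
    S.comulMor q = S'.comulMor q := by
  refine H.retractDense_hom_ext (𝟭 _) fun x v => ?_
  obtain ⟨p, rfl⟩ := S.exists_mulMor v
  refine (S.map_mulCounit q p).symm.trans ((S'.map_mulCounit q p).trans ?_)
  exact congrArg (· ≫ S'.comulMor q) (h p).symm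

lemma cooneMor_eq_of_oneMor_eq [H.RetractDense] {S S' : MonoidalRealization H I.toRightAdjointPseudomonoid}
    (h : ∀ {c : C} (p : El I.one star c), S.oneMor p = S'.oneMor p) {c : C} (q : El I.coone c star) :
    S.cooneMor q = S'.cooneMor q := by
  refine H.retractDense_hom_ext (𝟭 _) fun x v => ?_
  obtain ⟨p, rfl⟩ := S.exists_oneMor v
  refine (S.map_oneCounit q p).symm.trans ((S'.map_oneCounit q p).trans ?_)
  exact congrArg (· ≫ S'.cooneMor q) (h p).symm

/-- The comparison of the multiplications of two realizations. -/
noncomputable def mulComparison : (show Profunctor.{u} (C × C) C from I.mul) ≅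
    (show Profunctor.{u} (C' × C') C' from I'.mul).whiskerLeft₂ (K.prod K) K :=
  Rep.isoOfRep S.mulRep (R'.mulRep.whisker θ (tensorNatIso θ))

/-- The comparison of the comultiplications of two realizations. -/
noncomputable def comulComparison : (show Profunctor.{u} C (C × C) from I.comul) ≅
    (show Profunctor.{u} C' (C' × C') from I'.comul).whiskerLeft₂ K (K.prod K) :=
  Corep.isoOfCorep S.comulRep (R'.comulRep.whisker θ (tensorNatIso θ))

/-- The comparison of the units of two realizations. -/
noncomputable def oneComparison : (show Profunctor.{u} (Discrete PUnit.{u + 1}) C from I.one) ≅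
    (show Profunctor.{u} (Discrete PUnit.{u + 1}) C' from I'.one).whiskerLeft₂ (𝟭 _) K :=
  Rep.isoOfRep S.oneRep (R'.oneRep.whisker θ (unitNatIso D'))

/-- The comparison of the counits of two realizations. -/
noncomputable def cooneComparison : (show Profunctor.{u} C (Discrete PUnit.{u + 1}) from I.coone) ≅
    (show Profunctor.{u} C' (Discrete PUnit.{u + 1}) from I'.coone).whiskerLeft₂ K (𝟭 _) :=
  Corep.isoOfCorep S.cooneRep (R'.cooneRep.whisker θ (unitNatIso D'))

/-- The comparison of the elements of the multiplications of two realizations. -/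
noncomputable def mulTransfer {a b c : C} (p : El I.mul (a, b) c) : El I'.mul (K.obj a, K.obj b) (K.obj c) :=
  app (R'.mulComparison θ S).hom p

/-- The comparison of the elements of the comultiplications of two realizations. -/
noncomputable def comulTransfer {a b c : C} (p : El I.comul c (a, b)) : El I'.comul (K.obj c) (K.obj a, K.obj b) :=
  app (R'.comulComparison θ S).hom p

/-- The comparison of the elements of the units of two realizations. -/
noncomputable def oneTransfer {c : C} (p : El I.one star c) : El I'.one star (K.obj c) :=
  app (R'.oneComparison θ S).hom p

/-- The comparison of the elements of the counits of two realizations. -/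
noncomputable def cooneTransfer {c : C} (p : El I.coone c star) : El I'.coone (K.obj c) star :=
  app (R'.cooneComparison θ S).hom p

lemma conjMulMor_mulTransfer {a b c : C} (p : El I.mul (a, b) c) :
    R'.conjMulMor θ (R'.mulTransfer θ S p) = S.mulMor p :=
  Rep.mor_app_isoOfRep_hom S.mulRep (R'.mulRep.whisker θ (tensorNatIso θ)) (a := (a, b)) p

lemma conjComulMor_comulTransfer {a b c : C} (p : El I.comul c (a, b)) :
    R'.conjComulMor θ (R'.comulTransfer θ S p) = S.comulMor p :=
  Corep.mor_app_isoOfCorep_hom S.comulRep (R'.comulRep.whisker θ (tensorNatIso θ)) (a := (a, b)) p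

lemma conjOneMor_oneTransfer {c : C} (p : El I.one star c) :
    R'.conjOneMor θ (R'.oneTransfer θ S p) = S.oneMor p :=
  (congrArg (θ.hom.app c ≫ ·) (Category.comp_id (R'.oneMor (R'.oneTransfer θ S p)))).symm.trans
    (Rep.mor_app_isoOfRep_hom S.oneRep (R'.oneRep.whisker θ (unitNatIso D')) (a := ⟨PUnit.unit⟩) p)

lemma conjCooneMor_cooneTransfer {c : C} (p : El I.coone c star) :
    R'.conjCooneMor θ (R'.cooneTransfer θ S p) = S.cooneMor p :=
  (Category.id_comp (R'.cooneMor (R'.cooneTransfer θ S p) ≫ θ.inv.app c)).symm.trans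
    (Corep.mor_app_isoOfCorep_hom S.cooneRep (R'.cooneRep.whisker θ (unitNatIso D')) (a := ⟨PUnit.unit⟩) p)

variable [F'.Full] [F'.Faithful] [F'.RetractDense]

variable {R' S} in
/-- The equivalence of interpretations given by two realizations in the same traced monoidal category. -/
noncomputable def interpretationEquiv {τ : TraceOperator D'} (hR' : R'.TraceCompat I'.Tr τ)
    (hS : S.TraceCompat I.Tr τ) : InterpretationEquiv K I I' where
  mulIso := R'.mulComparison θ S
  comulIso := R'.comulComparison θ S
  oneIso := R'.oneComparison θ S
  cooneIso := R'.cooneComparison θ S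
  -- All fields follow one pattern: the claim about `I'` is translated into an equation in `D'`,
  -- where the transferred elements, conjugated by `θ`, have the same morphisms as the original ones
  -- in `S`.
  mul_unit f g j j' h := (R'.mulUnit_eq_iff _ _ (R'.mulTransfer θ S j) (R'.comulTransfer θ S j')).2 (by
    rw [← R'.conjComulMor_comp_conjMulMor_eq_iff θ, conjMulMor_mulTransfer, conjComulMor_comulTransfer]
    exact S.comulMor_comp_mulMor h)
  mul_counit q p := (map_conj_eq_iff θ _ (I'.mulCounit (R'.comulTransfer θ S q) (R'.mulTransfer θ S p))).1 (by
    rw [← conjMulMor_comp_conjComulMor, conjMulMor_mulTransfer, conjComulMor_comulTransfer]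
    exact (S.map_mulCounit q p).symm)
  one_unit p p' h := (R'.oneUnit_eq_iff (R'.oneTransfer θ S p) (R'.cooneTransfer θ S p')).2 (by
    rw [← R'.conjCooneMor_comp_conjOneMor θ, conjOneMor_oneTransfer, conjCooneMor_cooneTransfer]
    exact S.cooneMor_comp_oneMor h)
  one_counit q p := (map_conj_eq_iff θ _ (I'.oneCounit (R'.cooneTransfer θ S q) (R'.oneTransfer θ S p))).1 (by
    rw [← conjOneMor_comp_conjCooneMor, conjOneMor_oneTransfer, conjCooneMor_cooneTransfer]
    exact (S.map_oneCounit q p).symm)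
  assoc p q r s h := (R'.assoc_iff (R'.mulTransfer θ S p) (R'.mulTransfer θ S q) (R'.mulTransfer θ S r)
      (R'.mulTransfer θ S s)).2 (by
    rw [← R'.conjMulMor_assoc_iff θ, conjMulMor_mulTransfer, conjMulMor_mulTransfer, conjMulMor_mulTransfer,
      conjMulMor_mulTransfer]
    exact S.assoc p q r s h)
  lunit k p := (map_conj_eq_iff θ _ (I'.lam (R'.oneTransfer θ S k) (R'.mulTransfer θ S p))).1 (by
    rw [← map_lam_conj, conjOneMor_oneTransfer, conjMulMor_mulTransfer]
    exact (S.map_lam k p).symm)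
  runit k p := (map_conj_eq_iff θ _ (I'.rho (R'.oneTransfer θ S k) (R'.mulTransfer θ S p))).1 (by
    rw [← map_rho_conj, conjOneMor_oneTransfer, conjMulMor_mulTransfer]
    exact (S.map_rho k p).symm)
  trace {a b x y} p q := (map_conj_eq_iff θ _ (I'.trAt I'.Tr (R'.mulTransfer θ S p) (R'.comulTransfer θ S q))).1 (by
    have h : F'.map (I'.trAt I'.Tr (R'.mulTransfer θ S p) (R'.comulTransfer θ S q)) =
      τ.tr (F'.obj (K.obj x)) (R'.comulMor (R'.comulTransfer θ S q) ≫ R'.mulMor (R'.mulTransfer θ S p)) := hR' _ _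
    rw [h, ← R'.tr_conj θ, conjMulMor_mulTransfer, conjComulMor_comulTransfer]
    exact (hS p q).symm)

variable {R' S} in
/-- Two realizations in the same traced monoidal category are related by a unique equivalence of
interpretations. -/
theorem existsUnique_interpretationEquiv [H.RetractDense] {τ : TraceOperator D'} (hR' : R'.TraceCompat I'.Tr τ)
    (hS : S.TraceCompat I.Tr τ) : ∃! e : InterpretationEquiv K I I',
      (∀ {a b c : C} (p : El I.mul (a, b) c), R'.conjMulMor θ (e.mulMap p) = S.mulMor p) ∧
      (∀ {c : C} (p : El I.one star c), R'.conjOneMor θ (e.oneMap p) = S.oneMor p) := by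
  refine ⟨interpretationEquiv θ hR' hS, ⟨R'.conjMulMor_mulTransfer θ S, R'.conjOneMor_oneTransfer θ S⟩,
    fun e h => InterpretationEquiv.ext ?_ ?_ ?_ ?_⟩
  · refine Iso.ext (hom_ext fun a b p => ?_)
    exact (R'.mulRep.whisker θ (tensorNatIso θ)).ext ((h.1 p).trans (R'.conjMulMor_mulTransfer θ S p).symm)
  -- The conditions on `e` do not mention the comultiplication. It is forced, because `R'.pullback e
  -- θ` and `S` are realizations with the same multiplication.
  · refine Iso.ext (hom_ext fun b a p => ?_)
    exact (R'.comulRep.whisker θ (tensorNatIso θ)).ext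
      ((comulMor_eq_of_mulMor_eq (S := R'.pullback e θ) (S' := S) h.1 p).trans
        (R'.conjComulMor_comulTransfer θ S p).symm)
  · refine Iso.ext (hom_ext fun a b p => ?_)
    exact R'.oneMor_injective ((cancel_epi (θ.hom.app b)).1
      ((h.2 p).trans (R'.conjOneMor_oneTransfer θ S p).symm))
  · refine Iso.ext (hom_ext fun b a p => ?_)
    have h' := cooneMor_eq_of_oneMor_eq (S := R'.pullback e θ) (S' := S)
      (fun p => (R'.pullback_oneMor e θ p).trans (h.2 p)) p
    exact R'.cooneMor_injective ((cancel_mono (θ.inv.app b)).1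
      ((R'.pullback_cooneMor e θ p).symm.trans (h'.trans (R'.conjCooneMor_cooneTransfer θ S p).symm)))

end

end MonoidalRealization

/-! ### Image of a realization under a monoidal functor -/

open MonoidalCategory Functor.OplaxMonoidal Functor.LaxMonoidal

namespace MonoidalRealization

section
variable {C D D' : Prof.{u}} {F : C ⥤ D} [MonoidalCategory D] [MonoidalCategory D']
  {I : RightAdjointPseudomonoid C} (R : MonoidalRealization F I) (G : D ⥤ D') [G.Full] [G.Faithful] [G.Monoidal]

variable (F) in
/-- The comparison of a monoidal functor, as an isomorphism between functors on the source of `F`. -/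
def mapTensorIso : ((F.prod F) ⋙ tensor D) ⋙ G ≅ ((F ⋙ G).prod (F ⋙ G)) ⋙ tensor D' :=
  NatIso.ofComponents (fun x => (Functor.Monoidal.μIso G (F.obj x.1) (F.obj x.2)).symm) (fun {x y} f => by
    have h : G.map (F.map f.1 ⊗ₘ F.map f.2) ≫ δ G (F.obj y.1) (F.obj y.2) =
        δ G (F.obj x.1) (F.obj x.2) ≫ (G.map (F.map f.1) ⊗ₘ G.map (F.map f.2)) := (δ_natural G _ _).symm
    exact h)

/-- The comparison of unit objects of a monoidal functor, as an isomorphism between constant functors. -/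
def mapUnitIso : (𝟭 _ ⋙ (Functor.const (Discrete PUnit.{u + 1})).obj (𝟙_ D)) ⋙ G ≅
    𝟭 _ ⋙ (Functor.const (Discrete PUnit.{u + 1})).obj (𝟙_ D') :=
  NatIso.ofComponents (fun _ => (Functor.Monoidal.εIso G).symm)
    (fun _ => (by simp : G.map (𝟙 (𝟙_ D)) ≫ η G = η G ≫ 𝟙 (𝟙_ D')))

/-- The multiplication is represented in the target of a monoidal functor. -/
def mapMulRep : Rep (A := C × C) (B := C) I.mul (F ⋙ G) (((F ⋙ G).prod (F ⋙ G)) ⋙ tensor D') :=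
  let i : I.mul ≅ I.mul := Iso.refl _
  (R.mulRep.postcomp G).congr i (mapTensorIso F G)

/-- The comultiplication is corepresented in the target of a monoidal functor. -/
def mapComulRep : Corep (A := C × C) (B := C) I.comul (F ⋙ G) (((F ⋙ G).prod (F ⋙ G)) ⋙ tensor D') :=
  let i : I.comul ≅ I.comul := Iso.refl _
  (R.comulRep.postcomp G).congr i (mapTensorIso F G)

/-- The unit is represented in the target of a monoidal functor. -/
def mapOneRep : Rep (A := Discrete PUnit.{u + 1}) (B := C) I.one (F ⋙ G)
    (𝟭 _ ⋙ (Functor.const (Discrete PUnit.{u + 1})).obj (𝟙_ D')) :=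
  let i : I.one ≅ I.one := Iso.refl _
  (R.oneRep.postcomp G).congr i (mapUnitIso G)

/-- The counit is corepresented in the target of a monoidal functor. -/
def mapCooneRep : Corep (A := Discrete PUnit.{u + 1}) (B := C) I.coone (F ⋙ G)
    (𝟭 _ ⋙ (Functor.const (Discrete PUnit.{u + 1})).obj (𝟙_ D')) :=
  let i : I.coone ≅ I.coone := Iso.refl _
  (R.cooneRep.postcomp G).congr i (mapUnitIso G)

/-- The image of a realization under a fully faithful monoidal functor. -/
noncomputable def mapRealization : MonoidalRealization (F ⋙ G) I where
  mulIso := (R.mapMulRep G).toIso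
  comulIso := (R.mapComulRep G).toIso
  oneIso := Rep.toIso (G := 𝟭 (Discrete PUnit.{u + 1})) (R.mapOneRep G)
  cooneIso := Corep.toIso (G := 𝟭 (Discrete PUnit.{u + 1})) (R.mapCooneRep G)
  mul_unit {a a' b b' x} f g j j' h := by
    change (μ G (F.obj a') (F.obj b') ≫ G.map (R.comulMor j')) ≫ G.map (R.mulMor j) ≫ δ G (F.obj a) (F.obj b) =
      G.map (F.map f) ⊗ₘ G.map (F.map g)
    rw [Category.assoc, ← G.map_comp_assoc, R.comulMor_comp_mulMor h, ← μ_natural_assoc, Functor.Monoidal.μ_δ,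
      Category.comp_id]
  mul_counit {a b x y} q p := by
    change G.map (F.map (I.mulCounit q p)) =
      (G.map (R.mulMor p) ≫ δ G (F.obj a) (F.obj b)) ≫ μ G (F.obj a) (F.obj b) ≫ G.map (R.comulMor q)
    rw [R.map_mulCounit, Category.assoc, Functor.Monoidal.δ_μ_assoc, G.map_comp]
  one_unit {x} p p' h := by
    change (Functor.LaxMonoidal.ε G ≫ G.map (R.cooneMor p')) ≫ G.map (R.oneMor p) ≫ η G = 𝟙 (𝟙_ D')
    rw [Category.assoc, ← G.map_comp_assoc, R.cooneMor_comp_oneMor h, G.map_id, Category.id_comp,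
      Functor.Monoidal.ε_η]
  one_counit {x y} q p := by
    change G.map (F.map (I.oneCounit q p)) =
      (G.map (R.oneMor p) ≫ η G) ≫ Functor.LaxMonoidal.ε G ≫ G.map (R.cooneMor q)
    rw [R.map_oneCounit, Category.assoc, Functor.Monoidal.η_ε_assoc, G.map_comp]
  assoc {a b c d x y} p q r s h := by
    change (G.map (R.mulMor q) ≫ δ G (F.obj x) (F.obj c)) ≫
        (G.map (R.mulMor p) ≫ δ G (F.obj a) (F.obj b)) ▷ G.obj (F.obj c) ≫
          (α_ (G.obj (F.obj a)) (G.obj (F.obj b)) (G.obj (F.obj c))).hom =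
      (G.map (R.mulMor s) ≫ δ G (F.obj a) (F.obj y)) ≫
        G.obj (F.obj a) ◁ (G.map (R.mulMor r) ≫ δ G (F.obj b) (F.obj c))
    have h' : R.mulMor q ≫ R.mulMor p ▷ F.obj c ≫ (α_ (F.obj a) (F.obj b) (F.obj c)).hom =
      R.mulMor s ≫ F.obj a ◁ R.mulMor r := R.assoc p q r s h
    rw [MonoidalCategory.comp_whiskerRight, MonoidalCategory.whiskerLeft_comp]
    simp only [Category.assoc]
    rw [δ_natural_left_assoc, Functor.OplaxMonoidal.associativity, δ_natural_right_assoc, ← G.map_comp_assoc,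
      ← G.map_comp_assoc, ← G.map_comp_assoc, Category.assoc, h']
  lunit {x b c} k p := by
    change G.map (F.map (I.lam k p)) = (G.map (R.mulMor p) ≫ δ G (F.obj x) (F.obj b)) ≫
      (G.map (R.oneMor k) ≫ η G) ▷ G.obj (F.obj b) ≫ (λ_ (G.obj (F.obj b))).hom
    rw [R.map_lam, MonoidalCategory.comp_whiskerRight]
    simp only [Category.assoc]
    rw [δ_natural_left_assoc, Functor.OplaxMonoidal.left_unitality_hom]
    simp
  runit {x b c} k p := by
    change G.map (F.map (I.rho k p)) = (G.map (R.mulMor p) ≫ δ G (F.obj b) (F.obj x)) ≫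
      G.obj (F.obj b) ◁ (G.map (R.oneMor k) ≫ η G) ≫ (ρ_ (G.obj (F.obj b))).hom
    rw [R.map_rho, MonoidalCategory.whiskerLeft_comp]
    simp only [Category.assoc]
    rw [δ_natural_right_assoc, Functor.OplaxMonoidal.right_unitality_hom]
    simp

variable {R} in
lemma TraceCompat.mapRealization {T : I.traceLoop ⟶ 𝟙 C} {t : RightTrace D} {t' : RightTrace D'}
    (h : R.TraceCompat T t.toTraceOperator) (hG : PreservesTrace G t t') :
    (R.mapRealization G).TraceCompat T t'.toTraceOperator := fun {a b x y} p q => by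
  have h' : F.map (I.trAt T p q) = t.tr (F.obj x) (R.comulMor q ≫ R.mulMor p) := h p q
  change G.map (F.map (I.trAt T p q)) = t'.tr (G.obj (F.obj x))
    ((μ G (F.obj a) (F.obj x) ≫ G.map (R.comulMor q)) ≫ G.map (R.mulMor p) ≫ δ G (F.obj b) (F.obj x))
  rw [h', hG, Category.assoc, G.map_comp, Category.assoc]

end

end MonoidalRealization

/-! ### Equivalences of interpretations and trace-preserving monoidal structures -/

section
variable {C C' D D' : Prof.{u}} [MonoidalCategory D] [MonoidalCategory D'] {K : C ⥤ C'}
  {F : C ⥤ D} {F' : C' ⥤ D'} {G : D ⥤ D'} {θ : F ⋙ G ≅ K ⋙ F'} {I : TracedPseudomonoid C}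
  {I' : TracedPseudomonoid C'} {R : MonoidalRealization F I.toRightAdjointPseudomonoid}
  {R' : MonoidalRealization F' I'.toRightAdjointPseudomonoid}

/-- Moving the components of `θ` to the other side makes compatibility a comparison of two
realizations of `I` along `F ⋙ G`: the restriction of `R'` along `e`, and the image of `R` under
`G`. -/
lemma InterpretationEquiv.compat_iff [G.Monoidal] (e : InterpretationEquiv K I I') :
    e.Compat R R' θ ↔
      (∀ {a b c : C} (p : El I.mul (a, b) c),
        R'.conjMulMor θ (e.mulMap p) = G.map (R.mulMor p) ≫ δ G (F.obj a) (F.obj b)) ∧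
      (∀ {c : C} (p : El I.one star c), R'.conjOneMor θ (e.oneMap p) = G.map (R.oneMor p) ≫ η G) := by
  refine and_congr ?_ ?_
  · refine forall_congr' fun a => forall_congr' fun b => forall_congr' fun c => forall_congr' fun p => ?_
    change R'.mulMor (e.mulMap p) = θ.inv.app c ≫ G.map (R.mulMor p) ≫ δ G (F.obj a) (F.obj b) ≫
      (θ.hom.app a ⊗ₘ θ.hom.app b) ↔ θ.hom.app c ≫ R'.mulMor (e.mulMap p) ≫ (θ.inv.app a ⊗ₘ θ.inv.app b) = _
    have h₁ : (θ.hom.app a ⊗ₘ θ.hom.app b) ≫ (θ.inv.app a ⊗ₘ θ.inv.app b) = 𝟙 _ := by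
      rw [tensorHom_comp_tensorHom, θ.hom_inv_id_app, θ.hom_inv_id_app, id_tensorHom_id]
    rw [← cancel_epi (θ.hom.app c), ← cancel_mono (θ.inv.app a ⊗ₘ θ.inv.app b), θ.hom_inv_id_app_assoc]
    simp only [Category.assoc]
    rw [h₁]
    exact Eq.congr_right (congrArg (G.map (R.mulMor p) ≫ ·) (Category.comp_id _))
  · refine forall_congr' fun c => forall_congr' fun p => ?_
    change R'.oneMor (e.oneMap p) = θ.inv.app c ≫ G.map (R.oneMor p) ≫ η G ↔
      θ.hom.app c ≫ R'.oneMor (e.oneMap p) = _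
    rw [← cancel_epi (θ.hom.app c), θ.hom_inv_id_app_assoc]

variable {t : RightTrace D} {t' : RightTrace D'}

/-- The restriction of `R'` along `e` realizes `I` along `F ⋙ G`; comparing it with `R` gives the
unique monoidal structure on `G`, and preservation of the trace is automatic. -/
theorem existsUnique_monoidal_compat (θ : F ⋙ G ≅ K ⋙ F') [F.Full] [F.Faithful] [F.RetractDense] [G.Full]
    [G.Faithful] [(F ⋙ G).RetractDense] (hR : R.TraceCompat I.Tr t.toTraceOperator)
    (hR' : R'.TraceCompat I'.Tr t'.toTraceOperator) (e : InterpretationEquiv K I I') :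
    ∃! _M : G.Monoidal, PreservesTrace G t t' ∧ e.Compat R R' θ := by
  obtain ⟨M, hM, hu⟩ := R.existsUnique_mapCompat (R'.pullback e θ)
  refine ⟨M, ⟨hM.preservesTrace hR (hR'.pullback e θ), e.compat_iff.2 ⟨hM.1, fun p => ?_⟩⟩, fun M' h => hu M' ?_⟩
  · exact (R'.pullback_oneMor e θ p).symm.trans (hM.2 p)
  · have h' := e.compat_iff.1 h.2
    exact ⟨h'.1, fun p => (R'.pullback_oneMor e θ p).trans (h'.2 p)⟩

/-- The image of `R` under `G` is compatible with `t'` because `G` preserves the trace. It and `R'`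
then take values in the same traced monoidal category, where elements with equal morphisms are
matched. -/
theorem existsUnique_interpretationEquiv_compat (θ : F ⋙ G ≅ K ⋙ F') [F'.Full] [F'.Faithful]
    [F'.RetractDense] [G.Full] [G.Faithful] [(F ⋙ G).RetractDense] [G.Monoidal]
    (hR : R.TraceCompat I.Tr t.toTraceOperator) (hR' : R'.TraceCompat I'.Tr t'.toTraceOperator)
    (hG : PreservesTrace G t t') : ∃! e : InterpretationEquiv K I I', e.Compat R R' θ := by
  have hS : (R.mapRealization G).TraceCompat I.Tr t'.toTraceOperator := hR.mapRealization G hG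
  obtain ⟨e, he, hu⟩ := MonoidalRealization.existsUnique_interpretationEquiv θ hR' hS
  exact ⟨e, e.compat_iff.2 he, fun e' h => hu e' (e'.compat_iff.1 h)⟩

end

theorem IsCauchyCompletion.equivalenceCorrespondence (C C' D D' : Prof.{u}) [MonoidalCategory D]
    [MonoidalCategory D'] (K : C ⥤ C') (F : C ⥤ D) (F' : C' ⥤ D') (G : D ⥤ D') (θ : F ⋙ G ≅ K ⋙ F')
    (I : TracedPseudomonoid C) (I' : TracedPseudomonoid C') (t : RightTrace D) (t' : RightTrace D')
    (R : MonoidalRealization F I.toRightAdjointPseudomonoid)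
    (R' : MonoidalRealization F' I'.toRightAdjointPseudomonoid) (hK : IsProfEquivalence K)
    (hF : IsCauchyCompletion F) (hF' : IsCauchyCompletion F')
    (hR : R.TraceCompat I.Tr t.toTraceOperator) (hR' : R'.TraceCompat I'.Tr t'.toTraceOperator) :
    (∀ e : InterpretationEquiv K I I', ∃! _M : G.Monoidal, PreservesTrace G t t' ∧ e.Compat R R' θ) ∧
      (∀ _M : G.Monoidal, PreservesTrace G t t' → ∃! e : InterpretationEquiv K I I', e.Compat R R' θ) := by
  have := hF.equivalence.full
  have := hF.equivalence.faithful
  have := hF.equivalence.retractDense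
  have := hF'.equivalence.full
  have := hF'.equivalence.faithful
  have := hF'.equivalence.retractDense
  have := hK.full
  have := hK.faithful
  have := hK.retractDense
  -- `F ⋙ G` is isomorphic to `K ⋙ F'` and inherits its properties. Full faithfulness then passes to
  -- `G`, because every object of `D` is a retract of an image object of `F`.
  have : (F ⋙ G).Full := .of_iso θ.symm
  have : (F ⋙ G).Faithful := .of_iso θ.symm
  have : (F ⋙ G).RetractDense := .of_iso θ.symm
  have := F.full_of_comp_of_retractDense G
  have := F.faithful_of_comp_of_retractDense G
  exact ⟨existsUnique_monoidal_compat θ hR hR', fun _ => existsUnique_interpretationEquiv_compat θ hR hR'⟩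

theorem theorem2 :
    -- every Cauchy complete traced monoidal category gives an interpretation
    (∀ (C : Prof.{u}) [MonoidalCategory C] (t : RightTrace C), IsIdempotentComplete C →
      ∃ (I : TracedPseudomonoid C)
        (R : MonoidalRealization (𝟭 C) I.toRightAdjointPseudomonoid),
        R.TraceCompat I.Tr t.toTraceOperator) ∧
    -- every interpretation is given by a trace on a monoidal structure on any Cauchy completion of
    -- the underlying category
    (∀ (C D : Prof.{u}) (F : C ⥤ D), IsCauchyCompletion F → ∀ I : TracedPseudomonoid C,
      ∃ (_ : MonoidalCategory D) (t : RightTrace D)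
        (R : MonoidalRealization F I.toRightAdjointPseudomonoid),
        R.TraceCompat I.Tr t.toTraceOperator) ∧
    -- Cauchy completions exist
    (∀ C : Prof.{u}, ∃ (D : Prof.{u}) (F : C ⥤ D), IsCauchyCompletion F) ∧
    -- equivalences of interpretations are trace-preserving monoidal structures on the functor
    -- between the traced monoidal categories
    (∀ (C C' D D' : Prof.{u}) [MonoidalCategory D] [MonoidalCategory D'] (K : C ⥤ C')
      (F : C ⥤ D) (F' : C' ⥤ D') (G : D ⥤ D') (θ : F ⋙ G ≅ K ⋙ F')
      (I : TracedPseudomonoid C) (I' : TracedPseudomonoid C')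
      (t : RightTrace D) (t' : RightTrace D')
      (R : MonoidalRealization F I.toRightAdjointPseudomonoid)
      (R' : MonoidalRealization F' I'.toRightAdjointPseudomonoid),
      IsProfEquivalence K → IsCauchyCompletion F → IsCauchyCompletion F' →
      R.TraceCompat I.Tr t.toTraceOperator → R'.TraceCompat I'.Tr t'.toTraceOperator →
      (∀ e : InterpretationEquiv K I I',
        ∃! _M : G.Monoidal, PreservesTrace G t t' ∧ e.Compat R R' θ) ∧
      (∀ _M : G.Monoidal, PreservesTrace G t t' →
        ∃! e : InterpretationEquiv K I I', e.Compat R R' θ)) ∧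
    -- over a right-adjoint pseudomonoid, 2-morphisms `Tr` without any equation are the same as
    -- operations that satisfy tightening and sliding, and the three equations of the presentation
    -- are the other three axiom families
    (∀ (C D : Prof.{u}) [MonoidalCategory D] (F : C ⥤ D) (I : RightAdjointPseudomonoid C)
      (R : MonoidalRealization F I), IsCauchyCompletion F →
      (∀ T : I.traceLoop ⟶ 𝟙 C, ∃! τ : TraceOperator D, R.TraceCompat T τ) ∧
      (∀ τ : TraceOperator D, ∃! T : I.traceLoop ⟶ 𝟙 C, R.TraceCompat T τ) ∧
      (∀ (T : I.traceLoop ⟶ 𝟙 C) (τ : TraceOperator D), R.TraceCompat T τ →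
        (I.VanishUnit T ↔ τ.VanishUnit) ∧ (I.VanishTensor T ↔ τ.VanishTensor) ∧
        (I.Superpose T ↔ τ.Superpose))) := by
  refine ⟨fun C _ t _ => t.exists_tracedPseudomonoid, fun C D F hF I => hF.exists_rightTrace I,
    Prof.exists_isCauchyCompletion, IsCauchyCompletion.equivalenceCorrespondence,
    fun C D _ F I R hF => hF.traceCorrespondence R⟩
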